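/- Let $n,d\in\mathbb N$, $Y=(0,1)^d$, $\Theta=[-\pi,\pi)^d$. Let $\mathcal M^\#_{n,d}$ be the set of $a\in L^\infty(\mathbb R^d;L(\mathbb C^{n\times d}))$ with $a(\cdot+k)=a$ for all $k\in\mathbb Z^d$ and $\operatorname{Re}a\ge\nu 1_{\mathbb C^{n\times d}}$ for some $\nu>0$, and let $\mathcal S^\#_{n,d}$ be the set of $s\in L^\infty(\mathbb R^d;L(\mathbb C^{n}))$ with the same two properties ($1_{\mathbb C^n}$ in place of $1_{\mathbb C^{n\times d}}$). Write $a_{ijkl}$ and $s_{ij}$ for the components: $(aX)_{ij}=\sum_{k=1}^n\sum_{l=1}^d a_{ijkl}X_{kl}$ and $(sv)_i=\sum_{j=1}^n s_{ij}v_j$. Let $\nabla$ be the weak gradient $[L^2(\mathbb R^d)]^n\supseteq[H^1(\mathbb R^d)]^n\to[L^2(\mathbb R^d)]^{n\times d}$, $(\phi_i)_i\mapsto(\partial_j\phi_i)_{ij}$. For $\theta\in\Theta$ let $H^1_\theta(Y)$ be the $H^1(Y)$-closure of the smooth functions $\phi$ on $\mathbb R^d$ (restricted to $Y$) with $\phi(\cdot+k)=e^{i\theta\cdot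 k}\phi$ for all $k\in\mathbb Z^d$, and let $\nabla_\theta$ be the gradient $[L^2(Y)]^n\supseteq[H^1_\theta(Y)]^n\to[L^2(Y)]^{n\times d}$. Put $\operatorname{div}=-\nabla^*$ and $\operatorname{div}_\theta=-\nabla_\theta^*$ (Hilbert space adjoints); second-order operators carry their natural domains. Let $H^1_\theta(Y)\perp e^{i\theta\cdot y}$ denote the set of elements of $H^1_\theta(Y)$ that are $L^2(Y)$-orthogonal to $y\mapsto e^{i\theta\cdot y}$. For $\varepsilon>0$ let the Gelfand transform $\mathcal U_\varepsilon:[L^2(\mathbb R^d)]^n\to L^2(\Theta;[L^2(Y)]^n)$ be the unitary operator that extends $$\mathcal U_\varepsilon f(\theta,y)=\Big(\frac{\varepsilon}{2\pi}\Big)^{d/2}\sum_{k\in\mathbb Z^d}f(\varepsilon(y+k))e^{-i\theta\cdot k}\qquad(f\in[C_c(\mathbb R^d)]^n).$$ **Theorem 3.1 (Fibre homogenisation theorem).** Let $a\in\mathcal M^\#_{n,d}$ and $s\in\mathcal S^\#_{n,d}$. For all $\theta\in\Theta$, $r\in\{1,\dots,n\}$, $q\in\{1,\dots,d\}$ there is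 a unique $N^{(rq)}_\theta\in[H^1_\theta(Y)\perp e^{i\theta\cdot y}]^n$ such that $$\big\langle a[\nabla_\theta N^{(rq)}_\theta+e^{i\theta\cdot y}e_r\otimes e_q],\nabla_\theta\phi\big\rangle_{[L^2(Y)]^{n\times d}}=0\qquad\text{for all }\phi\in[H^1_\theta(Y)\perp e^{i\theta\cdot y}]^n .$$ Define the constant tensor $a^{\rm hom}(\theta)$ and the constant matrix $m(s)$ by $$a^{\rm hom}_{ijrq}(\theta)=\sum_{k=1}^n\sum_{l=1}^d\int_Y a_{ijkl}(y)\big(\partial_lN^{(rq)}_{\theta,k}(y)+e^{i\theta\cdot y}\delta_{kr}\delta_{lq}\big)e^{-i\theta\cdot y}\,dy,\qquad m(s)_{ij}=\int_Y s_{ij}(y)\,dy .$$ Then $a^{\rm hom}(\theta)\in\mathcal M^\#_{n,d}$ for all $\theta\in\Theta$, $m(s)\in\mathcal S^\#_{n,d}$, and there is $\kappa>0$ such that for all $\varepsilon>0$ the inverses below exist as bounded everywhere defined operators, the direct integral is a well-defined bounded operator, and $$\Big\|\big(-\operatorname{div}a(\tfrac{\cdot}{\varepsilon})\nabla+s(\tfrac{\cdot}{\varepsilon})\big)^{-1}-\mathcal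 U_\varepsilon^{-1}\int_\Theta^{\oplus}\big(-\varepsilon^{-2}\operatorname{div}_\theta a^{\rm hom}(\theta)\nabla_\theta+m(s)\big)^{-1}d\theta\;\mathcal U_\varepsilon\Big\|\le\kappa\,\varepsilon .$$ -/

import Mathlib

noncomputable section

namespace FibreHom

open MeasureTheory

/-! ### Spaces -/

/-- `ℝ^d` with its Euclidean structure. -/
abbrev RSpace (d : ℕ) := EuclideanSpace ℝ (Fin d)

/-- `ℂ^n`. -/
abbrev Vec (n : ℕ) := EuclideanSpace ℂ (Fin n)

/-- `ℂ^{n × d}` with the Frobenius inner product. -/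
abbrev Ten (n d : ℕ) := EuclideanSpace ℂ (Fin n × Fin d)

/-- The open unit cell `Y = (0,1)^d`. -/
def cellY (d : ℕ) : Set (RSpace d) := {y | ∀ i, y i ∈ Set.Ioo (0 : ℝ) 1}

/-- The Brillouin zone `Θ = [-π,π)^d`. -/
def zoneΘ (d : ℕ) : Set (RSpace d) := {θ | ∀ i, θ i ∈ Set.Ico (-Real.pi) Real.pi}

/-- Lebesgue measure on `Y`. -/
abbrev volY (d : ℕ) : Measure (RSpace d) := volume.restrict (cellY d)

/-- Lebesgue measure on `Θ`. -/
abbrev volΘ (d : ℕ) : Measure (RSpace d) := volume.restrict (zoneΘ d)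

/-- An element of `ℤ^d` as a vector of `ℝ^d`. -/
def intVec {d : ℕ} (k : Fin d → ℤ) : RSpace d := WithLp.toLp 2 (fun i => (k i : ℝ))

/-- The `j`-th Euclidean basis vector of `ℝ^d`. -/
def basisVec {d : ℕ} (j : Fin d) : RSpace d := EuclideanSpace.single j 1

/-- The plane wave `e^{i ⟨θ, y⟩}`. -/
def planeWave {d : ℕ} (θ y : RSpace d) : ℂ := Complex.exp (Complex.I * (inner ℝ θ y : ℝ))

/-- `[L²(ℝ^d)]^n`. -/
abbrev L2R (n d : ℕ) := Lp (Vec n) 2 (volume : Measure (RSpace d))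

/-- `[L²(ℝ^d)]^{n × d}`. -/
abbrev L2RTen (n d : ℕ) := Lp (Ten n d) 2 (volume : Measure (RSpace d))

/-- `[L²(Y)]^n`. -/
abbrev L2Y (n d : ℕ) := Lp (Vec n) 2 (volY d)

/-- `[L²(Y)]^{n × d}`. -/
abbrev L2YTen (n d : ℕ) := Lp (Ten n d) 2 (volY d)

/-- `L²(Θ; [L²(Y)]^n)`, the constant-fibre direct integral of `[L²(Y)]^n` over `Θ`. -/
abbrev L2ΘY (n d : ℕ) := Lp (L2Y n d) 2 (volΘ d)

/-! ### Coefficients -/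

/-- The classes `M^#` (for `ι = Fin n × Fin d`) and `S^#` (for `ι = Fin n`): essentially bounded,
`ℤ^d`-periodic, operator-valued functions whose real part is bounded below by some `ν > 0`. -/
structure PeriodicCoercive {d : ℕ} {ι : Type} [Fintype ι]
    (a : RSpace d → (EuclideanSpace ℂ ι →L[ℂ] EuclideanSpace ℂ ι)) : Prop where
  memLp : MemLp a ⊤ volume
  periodic : ∀ k : Fin d → ℤ, ∀ᵐ x, a (x + intVec k) = a x
  coercive : ∃ ν : ℝ, 0 < ν ∧ ∀ᵐ x, ∀ X, ν * ‖X‖ ^ 2 ≤ (inner ℂ X (a x X)).re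

/-- The matrix entry `A_{pq}`, so that `(A X)_p = ∑_q A_{pq} X_q`. For `ι = Fin n × Fin d` this is
the entry `A_{ijkl}` with `p = (i,j)` and `q = (k,l)`. -/
def entry {ι : Type} [Fintype ι] [DecidableEq ι]
    (A : EuclideanSpace ℂ ι →L[ℂ] EuclideanSpace ℂ ι) (p q : ι) : ℂ :=
  A (EuclideanSpace.single q 1) p

/-- The operator with given matrix entries. -/
def ofEntries {ι : Type} [Fintype ι] [DecidableEq ι] (A : ι → ι → ℂ) :
    EuclideanSpace ℂ ι →L[ℂ] EuclideanSpace ℂ ι :=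
  Matrix.toEuclideanCLM (𝕜 := ℂ) (Matrix.of A)

theorem entry_ofEntries {ι : Type} [Fintype ι] [DecidableEq ι] (A : ι → ι → ℂ) (p q : ι) :
    entry (ofEntries A) p q = A p q := by
  simp [entry, ofEntries]

/-- Multiplication by an essentially bounded operator-valued function, as a bounded operator on
`L²` (see `mulOp_coeFn`; it is only used for essentially bounded functions). -/
def mulOp {α : Type} [MeasurableSpace α] (μ : Measure α) {ι : Type} [Fintype ι]
    (a : α → (EuclideanSpace ℂ ι →L[ℂ] EuclideanSpace ℂ ι)) :
    Lp (EuclideanSpace ℂ ι) 2 μ →L[ℂ] Lp (EuclideanSpace ℂ ι) 2 μ :=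
  open Classical in
  if h : MemLp a ⊤ μ then
    ContinuousLinearMap.holderL μ ⊤ 2 2
      (ContinuousLinearMap.id ℂ (EuclideanSpace ℂ ι →L[ℂ] EuclideanSpace ℂ ι)) (h.toLp a)
  else 0

theorem mulOp_coeFn {α : Type} [MeasurableSpace α] {μ : Measure α} {ι : Type} [Fintype ι]
    {a : α → (EuclideanSpace ℂ ι →L[ℂ] EuclideanSpace ℂ ι)} (h : MemLp a ⊤ μ)
    (u : Lp (EuclideanSpace ℂ ι) 2 μ) : mulOp μ a u =ᵐ[μ] fun x => a x (u x) := by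
  have h1 : mulOp μ a u = ContinuousLinearMap.holder 2
      (ContinuousLinearMap.id ℂ (EuclideanSpace ℂ ι →L[ℂ] EuclideanSpace ℂ ι)) (h.toLp a) u := by
    simp [mulOp, h]
  rw [h1]
  filter_upwards [ContinuousLinearMap.coeFn_holder (r := 2)
    (ContinuousLinearMap.id ℂ (EuclideanSpace ℂ ι →L[ℂ] EuclideanSpace ℂ ι)) (h.toLp a) u,
    h.coeFn_toLp] with x hx hx'
  rw [hx, hx']
  rfl

/-! ### Gradient operators -/

/-- `g` is the weak gradient of `u` on the open set `Ω`, where `μ` is Lebesgue measure on `Ω`: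
`∫ (∂_j φ) u_i = - ∫ φ g_{ij}` for all test functions `φ ∈ C_c^∞(Ω)`. -/
def IsWeakGrad {n d : ℕ} (Ω : Set (RSpace d)) (μ : Measure (RSpace d))
    (u : RSpace d → Vec n) (g : RSpace d → Ten n d) : Prop :=
  ∀ φ : RSpace d → ℂ, ContDiff ℝ ((⊤ : ℕ∞) : WithTop ℕ∞) φ → HasCompactSupport φ →
    tsupport φ ⊆ Ω → ∀ (i : Fin n) (j : Fin d),
      ∫ x, fderiv ℝ φ x (basisVec j) * u x i ∂μ = - ∫ x, φ x * g x (i, j) ∂μ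

theorem exists_inner_eq_integral {d : ℕ} {ι : Type} [Fintype ι] [DecidableEq ι]
    (μ : Measure (RSpace d)) [IsFiniteMeasureOnCompacts μ] (ψ : RSpace d → ℂ)
    (hψ : Continuous ψ) (hc : HasCompactSupport ψ) (i : ι) :
    ∃ w : Lp (EuclideanSpace ℂ ι) 2 μ, ∀ u : Lp (EuclideanSpace ℂ ι) 2 μ,
      ∫ x, ψ x * u x i ∂μ = inner ℂ w u := by
  have hw : MemLp (fun x => (EuclideanSpace.single i (star (ψ x)) : EuclideanSpace ℂ ι)) 2 μ := by
    refine Continuous.memLp_of_hasCompactSupport ?_ ?_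
    · have : (fun x => (EuclideanSpace.single i (star (ψ x)) : EuclideanSpace ℂ ι))
          = fun x => star (ψ x) • EuclideanSpace.single i (1 : ℂ) := by
        ext x j
        by_cases h : j = i <;> simp [h]
      rw [this]
      exact (hψ.star).smul continuous_const
    · exact hc.comp_left (g := fun z : ℂ => (EuclideanSpace.single i (star z) :
        EuclideanSpace ℂ ι)) (by simp)
  refine ⟨hw.toLp _, fun u => ?_⟩
  rw [L2.inner_def]
  refine integral_congr_ae ?_
  filter_upwards [hw.coeFn_toLp] with x hx
  rw [hx]
  simp [EuclideanSpace.inner_single_left]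

theorem isWeakGrad_iff_inner {n d : ℕ} (Ω : Set (RSpace d)) (μ : Measure (RSpace d))
    [IsFiniteMeasureOnCompacts μ] :
    ∃ S : Set (Lp (Vec n) 2 μ × Lp (Ten n d) 2 μ), ∀ (u : Lp (Vec n) 2 μ) (g : Lp (Ten n d) 2 μ),
      IsWeakGrad Ω μ u g ↔ ∀ w ∈ S, inner ℂ w.1 u + inner ℂ w.2 g = (0 : ℂ) := by
  refine ⟨{w | ∃ φ : RSpace d → ℂ, ContDiff ℝ ((⊤ : ℕ∞) : WithTop ℕ∞) φ ∧ HasCompactSupport φ ∧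
    tsupport φ ⊆ Ω ∧ ∃ (i : Fin n) (j : Fin d),
      (∀ u : Lp (Vec n) 2 μ, ∫ x, fderiv ℝ φ x (basisVec j) * u x i ∂μ = inner ℂ w.1 u) ∧
      (∀ g : Lp (Ten n d) 2 μ, ∫ x, φ x * g x (i, j) ∂μ = inner ℂ w.2 g)}, fun u g => ⟨?_, ?_⟩⟩
  · rintro h w ⟨φ, h1, h2, h3, i, j, hu, hg⟩
    rw [← hu, ← hg, h φ h1 h2 h3 i j]
    simp
  · intro h φ h1 h2 h3 i j
    obtain ⟨w1, hw1⟩ := exists_inner_eq_integral μ (fun x => fderiv ℝ φ x (basisVec j))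
      ((h1.continuous_fderiv (by simp)).clm_apply continuous_const)
      (h2.fderiv_apply (𝕜 := ℝ) (basisVec j)) i
    obtain ⟨w2, hw2⟩ := exists_inner_eq_integral μ φ h1.continuous h2 (i, j)
    have := h (w1, w2) ⟨φ, h1, h2, h3, i, j, hw1, hw2⟩
    rw [hw1 u, hw2 g]
    exact eq_neg_of_add_eq_zero_left this

/-- The graph `{(u, ∇u)}` of the weak gradient, with domain the Sobolev space `[H¹(Ω)]^n`. -/
def weakGradGraph (n : ℕ) {d : ℕ} (Ω : Set (RSpace d)) (μ : Measure (RSpace d))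
    [IsFiniteMeasureOnCompacts μ] : Submodule ℂ (Lp (Vec n) 2 μ × Lp (Ten n d) 2 μ) where
  carrier := {p | IsWeakGrad Ω μ p.1 p.2}
  zero_mem' := by
    obtain ⟨S, hS⟩ := isWeakGrad_iff_inner (n := n) Ω μ
    exact (hS 0 0).2 (by simp)
  add_mem' := by
    obtain ⟨S, hS⟩ := isWeakGrad_iff_inner (n := n) Ω μ
    rintro ⟨u, g⟩ ⟨u', g'⟩ h h'
    refine (hS (u + u') (g + g')).2 fun w hw => ?_
    have h1 := (hS u g).1 h w hw
    have h2 := (hS u' g').1 h' w hw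
    rw [inner_add_right, inner_add_right]
    linear_combination h1 + h2
  smul_mem' := by
    obtain ⟨S, hS⟩ := isWeakGrad_iff_inner (n := n) Ω μ
    rintro c ⟨u, g⟩ h
    refine (hS (c • u) (c • g)).2 fun w hw => ?_
    have h1 := (hS u g).1 h w hw
    rw [inner_smul_right, inner_smul_right]
    linear_combination c * h1

theorem isClosed_weakGradGraph (n : ℕ) {d : ℕ} (Ω : Set (RSpace d)) (μ : Measure (RSpace d))
    [IsFiniteMeasureOnCompacts μ] :
    IsClosed (weakGradGraph n Ω μ : Set (Lp (Vec n) 2 μ × Lp (Ten n d) 2 μ)) := by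
  obtain ⟨S, hS⟩ := isWeakGrad_iff_inner (n := n) Ω μ
  have : (weakGradGraph n Ω μ : Set (Lp (Vec n) 2 μ × Lp (Ten n d) 2 μ))
      = ⋂ w ∈ S, {p | inner ℂ w.1 p.1 + inner ℂ w.2 p.2 = (0 : ℂ)} := by
    ext ⟨u, g⟩
    simp only [Set.mem_iInter]
    exact hS u g
  rw [this]
  refine isClosed_biInter fun w _ => isClosed_eq ?_ continuous_const
  fun_prop

theorem weakGradGraph_single_valued (n : ℕ) {d : ℕ} {Ω : Set (RSpace d)} (hΩ : IsOpen Ω)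
    (μ : Measure (RSpace d)) [IsFiniteMeasureOnCompacts μ] (hμ : ∀ᵐ x ∂μ, x ∈ Ω)
    (p : Lp (Vec n) 2 μ × Lp (Ten n d) 2 μ) (hp : p ∈ weakGradGraph n Ω μ) (h0 : p.1 = 0) :
    p.2 = 0 := by
  obtain ⟨u, g⟩ := p
  have hw : IsWeakGrad Ω μ u g := hp
  simp only at h0
  subst h0
  have key : ∀ q : Fin n × Fin d, ∀ᵐ x ∂μ, x ∈ Ω → g x q = 0 := by
    rintro ⟨i, j⟩
    have hg : MemLp (fun x => g x (i, j)) 2 μ :=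
      (EuclideanSpace.proj (𝕜 := ℂ) (i, j)).comp_memLp' (Lp.memLp g)
    refine hΩ.ae_eq_zero_of_integral_contDiff_smul_eq_zero
      ((hg.locallyIntegrable (by norm_num)).locallyIntegrableOn Ω) ?_
    intro φ h1 h2 h3
    have hsup : tsupport (fun x => (φ x : ℂ)) ⊆ Ω := by
      refine (closure_mono ?_).trans h3
      intro x hx
      simpa using hx
    have := hw (fun x => (φ x : ℂ)) (Complex.ofRealCLM.contDiff.comp h1)
      (h2.comp_left (g := fun r : ℝ => (r : ℂ)) (by simp)) hsup i j
    have hz : ∫ x, fderiv ℝ (fun x => (φ x : ℂ)) x (basisVec j) *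
        (0 : Lp (Vec n) 2 μ) x i ∂μ = 0 := by
      rw [← integral_zero (RSpace d) ℂ (μ := μ)]
      refine integral_congr_ae ?_
      filter_upwards [Lp.coeFn_zero (Vec n) 2 μ] with x hx
      rw [hx]
      simp
    rw [hz] at this
    simp only [Complex.real_smul]
    exact (neg_eq_zero.1 this.symm)
  refine (Lp.eq_zero_iff_ae_eq_zero).2 ?_
  filter_upwards [hμ, ae_all_iff.2 key] with x hx hq
  ext q
  exact hq q hx

/-- The gradient `grad : [H¹(ℝ^d)]^n ⊆ [L²(ℝ^d)]^n → [L²(ℝ^d)]^{n × d}` in the weak sense. -/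
def grad (n d : ℕ) : L2R n d →ₗ.[ℂ] L2RTen n d :=
  (weakGradGraph n (Set.univ : Set (RSpace d)) volume).toLinearPMap

theorem grad_graph (n d : ℕ) :
    (grad n d).graph = weakGradGraph n (Set.univ : Set (RSpace d)) volume :=
  Submodule.toLinearPMap_graph_eq _
    (weakGradGraph_single_valued n isOpen_univ volume (by simp))

/-- `φ ∈ [C^∞_θ(Y)]^n`: smooth functions on `ℝ^d` with `φ(· + k) = e^{i ⟨θ, k⟩} φ`
for `k ∈ ℤ^d`. -/
def SmoothQuasiPeriodic {n d : ℕ} (θ : RSpace d) (φ : RSpace d → Vec n) : Prop :=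
  ContDiff ℝ ((⊤ : ℕ∞) : WithTop ℕ∞) φ ∧
    ∀ (k : Fin d → ℤ) (y : RSpace d), φ (y + intVec k) = planeWave θ (intVec k) • φ y

/-- The graph of the classical gradient on `[C^∞_θ(Y)]^n`, as a subspace of
`[L²(Y)]^n × [L²(Y)]^{n × d}`. -/
def smoothGraph (n : ℕ) {d : ℕ} (θ : RSpace d) : Submodule ℂ (L2Y n d × L2YTen n d) where
  carrier := {p | ∃ φ : RSpace d → Vec n, SmoothQuasiPeriodic θ φ ∧ p.1 =ᵐ[volY d] φ ∧
    ∀ᵐ y ∂volY d, ∀ (i : Fin n) (j : Fin d), p.2 y (i, j) = fderiv ℝ φ y (basisVec j) i}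
  zero_mem' := by
    refine ⟨0, ⟨contDiff_const, by simp⟩, Lp.coeFn_zero _ _ _, ?_⟩
    filter_upwards [Lp.coeFn_zero (Ten n d) 2 (volY d)] with y hy i j
    change (0 : L2YTen n d) y (i, j) = _
    rw [hy]
    simp
  add_mem' := by
    rintro ⟨u, g⟩ ⟨u', g'⟩ ⟨φ, ⟨hs, hq⟩, hu, hg⟩ ⟨φ', ⟨hs', hq'⟩, hu', hg'⟩
    refine ⟨φ + φ', ⟨hs.add hs', fun k y => by simp [hq, hq']⟩,
      (Lp.coeFn_add _ _).trans (hu.add hu'), ?_⟩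
    filter_upwards [Lp.coeFn_add g g', hg, hg'] with y hy h h' i j
    change (g + g' : L2YTen n d) y (i, j) = _
    rw [hy, fderiv_add (hs.differentiable (by simp) y) (hs'.differentiable (by simp) y)]
    simpa using congrArg₂ (· + ·) (h i j) (h' i j)
  smul_mem' := by
    rintro c ⟨u, g⟩ ⟨φ, ⟨hs, hq⟩, hu, hg⟩
    refine ⟨c • φ, ⟨contDiff_const.smul hs, fun k y => by simp [hq, smul_comm c]⟩,
      (Lp.coeFn_smul _ _).trans (hu.const_smul c), ?_⟩
    filter_upwards [Lp.coeFn_smul c g, hg] with y hy h i j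
    change (c • g : L2YTen n d) y (i, j) = _
    rw [hy, fderiv_const_smul (hs.differentiable (by simp) y)]
    simpa using congrArg (c * ·) (h i j)

/-- The graph of `grad_θ`. Its domain `[H¹_θ(Y)]^n` is the closure of `[C^∞_θ(Y)]^n` in the
`H¹(Y)` norm, which is the graph norm of the (weak) gradient. -/
def gradThetaGraph (n : ℕ) {d : ℕ} (θ : RSpace d) : Submodule ℂ (L2Y n d × L2YTen n d) :=
  (smoothGraph n θ).topologicalClosure

theorem isOpen_cellY (d : ℕ) : IsOpen (cellY d) := by
  have : cellY d = ⋂ i, (fun y : RSpace d => y i) ⁻¹' Set.Ioo 0 1 := by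
    ext y
    simp [cellY]
  rw [this]
  exact isOpen_iInter_of_finite fun i => isOpen_Ioo.preimage (by fun_prop)

/-- On `[H¹_θ(Y)]^n` the operator `grad_θ` acts as the weak gradient. -/
theorem gradThetaGraph_le (n : ℕ) {d : ℕ} (θ : RSpace d) :
    gradThetaGraph n θ ≤ weakGradGraph n (cellY d) (volY d) := by
  refine Submodule.topologicalClosure_minimal _ ?_ (isClosed_weakGradGraph n _ _)
  rintro ⟨u, g⟩ ⟨φ, ⟨hs, -⟩, hu, hg⟩ ψ h1 h2 h3 i j
  have hd : Differentiable ℝ (fun x => φ x i) := by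
    have := hs.differentiable (by simp)
    fun_prop
  have hfd : ∀ x, fderiv ℝ (fun x => φ x i) x (basisVec j) = fderiv ℝ φ x (basisVec j) i := by
    intro x
    have h := (((EuclideanSpace.proj (𝕜 := ℂ) i : Vec n →L[ℂ] ℂ).restrictScalars ℝ).hasFDerivAt
      (x := φ x)).comp x (hs.differentiable (by simp) x).hasFDerivAt
    exact congrArg (fun L : RSpace d →L[ℝ] ℂ => L (basisVec j)) h.fderiv
  have hci : Continuous (fun x => φ x i) := hd.continuous
  have hcd : Continuous (fun x => fderiv ℝ (fun x => φ x i) x (basisVec j)) := by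
    simp_rw [hfd]
    have : Continuous fun x => fderiv ℝ φ x (basisVec j) :=
      (hs.continuous_fderiv (by simp)).clm_apply continuous_const
    fun_prop
  have hψd : Continuous (fun x => fderiv ℝ ψ x (basisVec j)) :=
    (h1.continuous_fderiv (by simp)).clm_apply continuous_const
  have hψs : HasCompactSupport (fun x => fderiv ℝ ψ x (basisVec j)) :=
    h2.fderiv_apply (𝕜 := ℝ) (basisVec j)
  have e1 : ∫ x, fderiv ℝ ψ x (basisVec j) * u x i ∂volY d
      = ∫ x, fderiv ℝ ψ x (basisVec j) * φ x i := by
    refine Eq.trans ?_ (setIntegral_eq_integral_of_forall_compl_eq_zero (s := cellY d) ?_)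
    · refine integral_congr_ae ?_
      filter_upwards [hu] with x hx
      exact congrArg (fun v : Vec n => fderiv ℝ ψ x (basisVec j) * v i) hx
    · intro x hx
      have : x ∉ tsupport ψ := fun h => hx (h3 h)
      have h0 : fderiv ℝ ψ x = 0 := by
        by_contra hne
        exact this (support_fderiv_subset ℝ hne)
      simp [h0]
  have e2 : ∫ x, ψ x * g x (i, j) ∂volY d
      = ∫ x, ψ x * fderiv ℝ (fun x => φ x i) x (basisVec j) := by
    refine Eq.trans ?_ (setIntegral_eq_integral_of_forall_compl_eq_zero (s := cellY d) ?_)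
    · refine integral_congr_ae ?_
      filter_upwards [hg] with x hx
      rw [hfd]
      exact congrArg (ψ x * ·) (hx i j)
    · intro x hx
      have : x ∉ tsupport ψ := fun h => hx (h3 h)
      rw [image_eq_zero_of_notMem_tsupport this, zero_mul]
  refine e1.trans ?_
  rw [e2, integral_mul_fderiv_eq_neg_fderiv_mul_of_integrable, neg_neg]
  · exact (hψd.mul hci).integrable_of_hasCompactSupport hψs.mul_right
  · exact (h1.continuous.mul hcd).integrable_of_hasCompactSupport h2.mul_right
  · exact (h1.continuous.mul hci).integrable_of_hasCompactSupport h2.mul_right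
  · exact fun x _ => h1.differentiable (by simp) x
  · exact fun x _ => hd x

/-- The gradient `grad_θ : [H¹_θ(Y)]^n ⊆ [L²(Y)]^n → [L²(Y)]^{n × d}`. -/
def gradTheta (n : ℕ) {d : ℕ} (θ : RSpace d) : L2Y n d →ₗ.[ℂ] L2YTen n d :=
  (gradThetaGraph n θ).toLinearPMap

theorem gradTheta_graph (n : ℕ) {d : ℕ} (θ : RSpace d) :
    (gradTheta n θ).graph = gradThetaGraph n θ :=
  Submodule.toLinearPMap_graph_eq _ fun p hp =>
    weakGradGraph_single_valued n (isOpen_cellY d) (volY d)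
      (ae_restrict_mem (isOpen_cellY d).measurableSet) p (gradThetaGraph_le n θ hp)

/-! ### Second-order operators and their inverses -/

section Operators

variable {H K : Type} [NormedAddCommGroup H] [InnerProductSpace ℂ H] [CompleteSpace H]
  [NormedAddCommGroup K] [InnerProductSpace ℂ K] [CompleteSpace K]

/-- `div := - grad^*`, the negative Hilbert space adjoint of the gradient operator `G`. -/
def divOf (G : H →ₗ.[ℂ] K) : K →ₗ.[ℂ] H := -(G.adjoint)

/-- The operator `-c div A grad + S` for a gradient operator `G = grad` and `div = - grad^*`, on
its natural domain `{u ∈ dom grad : A grad u ∈ dom div}`. -/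
def ellipticOp (G : H →ₗ.[ℂ] K) (c : ℂ) (A : K →L[ℂ] K) (S : H →L[ℂ] H) : H →ₗ.[ℂ] H where
  domain :=
    { carrier := {u | ∃ h : u ∈ G.domain, A (G ⟨u, h⟩) ∈ (divOf G).domain}
      zero_mem' := ⟨G.domain.zero_mem, by
        have : G ⟨0, G.domain.zero_mem⟩ = 0 := G.map_zero
        rw [this, map_zero]
        exact (divOf G).domain.zero_mem⟩
      add_mem' := by
        rintro u v ⟨hu, hu'⟩ ⟨hv, hv'⟩
        refine ⟨G.domain.add_mem hu hv, ?_⟩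
        have : G ⟨u + v, G.domain.add_mem hu hv⟩ = G ⟨u, hu⟩ + G ⟨v, hv⟩ :=
          G.map_add ⟨u, hu⟩ ⟨v, hv⟩
        rw [this, map_add]
        exact (divOf G).domain.add_mem hu' hv'
      smul_mem' := by
        rintro c u ⟨hu, hu'⟩
        refine ⟨G.domain.smul_mem c hu, ?_⟩
        have : G ⟨c • u, G.domain.smul_mem c hu⟩ = c • G ⟨u, hu⟩ := G.map_smul c ⟨u, hu⟩
        rw [this, map_smul]
        exact (divOf G).domain.smul_mem c hu' }
  toFun :=
    { toFun := fun u => -(c • divOf G ⟨A (G ⟨u.1, u.2.1⟩), u.2.2⟩) + S u.1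
      map_add' := by
        rintro ⟨u, hu, hu'⟩ ⟨v, hv, hv'⟩
        have h1 : G ⟨u + v, G.domain.add_mem hu hv⟩ = G ⟨u, hu⟩ + G ⟨v, hv⟩ :=
          G.map_add ⟨u, hu⟩ ⟨v, hv⟩
        have h2 : ∀ h, divOf G ⟨A (G ⟨u + v, G.domain.add_mem hu hv⟩), h⟩
            = divOf G ⟨A (G ⟨u, hu⟩), hu'⟩ + divOf G ⟨A (G ⟨v, hv⟩), hv'⟩ := by
          intro h
          rw [← LinearPMap.map_add]
          congr 1
          exact Subtype.ext ((congrArg A h1).trans (map_add A _ _))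
        change -(c • divOf G ⟨A (G ⟨u + v, _⟩), _⟩) + S (u + v) = _
        rw [h2, map_add, smul_add]
        abel
      map_smul' := by
        rintro t ⟨u, hu, hu'⟩
        have h1 : G ⟨t • u, G.domain.smul_mem t hu⟩ = t • G ⟨u, hu⟩ := G.map_smul t ⟨u, hu⟩
        have h2 : ∀ h, divOf G ⟨A (G ⟨t • u, G.domain.smul_mem t hu⟩), h⟩
            = t • divOf G ⟨A (G ⟨u, hu⟩), hu'⟩ := by
          intro h
          rw [← LinearPMap.map_smul]
          congr 1
          exact Subtype.ext ((congrArg A h1).trans (map_smul A _ _))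
        change -(c • divOf G ⟨A (G ⟨t • u, _⟩), _⟩) + S (t • u) = _
        rw [h2, map_smul, smul_comm c t, RingHom.id_apply, smul_add, smul_neg] }

/-- `R` is the (everywhere defined, bounded) inverse of the unbounded operator `T`. -/
def IsBoundedInverse (T : H →ₗ.[ℂ] H) (R : H →L[ℂ] H) : Prop :=
  (∀ f : H, ∃ h : R f ∈ T.domain, T ⟨R f, h⟩ = f) ∧ ∀ u : T.domain, R (T u) = u

end Operators

theorem IsBoundedInverse.unique {H : Type} [NormedAddCommGroup H]
    [InnerProductSpace ℂ H] {T : H →ₗ.[ℂ] H} {R R' : H →L[ℂ] H}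
    (h : IsBoundedInverse T R) (h' : IsBoundedInverse T R') : R = R' := by
  ext f
  obtain ⟨hd, hf⟩ := h'.1 f
  have := h.2 ⟨R' f, hd⟩
  rwa [hf] at this

/-- The operator `-div a(·/ε) grad + s(·/ε)` on `[L²(ℝ^d)]^n`. -/
def oscOp {n d : ℕ} (a : RSpace d → (Ten n d →L[ℂ] Ten n d)) (s : RSpace d → (Vec n →L[ℂ] Vec n))
    (ε : ℝ) : L2R n d →ₗ.[ℂ] L2R n d :=
  ellipticOp (grad n d) 1 (mulOp volume fun x => a (ε⁻¹ • x)) (mulOp volume fun x => s (ε⁻¹ • x))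

/-- The operator `-ε⁻² div_θ A grad_θ + S` on `[L²(Y)]^n` for constant `A` and `S`. -/
def fibreOp {n d : ℕ} (A : Ten n d →L[ℂ] Ten n d) (S : Vec n →L[ℂ] Vec n) (ε : ℝ)
    (θ : RSpace d) : L2Y n d →ₗ.[ℂ] L2Y n d :=
  ellipticOp (gradTheta n θ) (((ε ^ 2)⁻¹ : ℝ) : ℂ) (A.compLpL 2 (volY d)) (S.compLpL 2 (volY d))

/-! ### Homogenised coefficients -/

/-- `u ∈ [L²(Y) ⊥ e^{i ⟨θ, ·⟩}]^n`: every component is orthogonal to the plane wave. -/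
def PerpWave {n d : ℕ} (θ : RSpace d) (u : L2Y n d) : Prop :=
  ∀ i : Fin n, ∫ y in cellY d, u y i * starRingEnd ℂ (planeWave θ y) = 0

/-- `N ∈ [H¹_θ(Y) ⊥ e^{i ⟨θ, ·⟩}]^n` solves the cell problem with datum `e_r ⊗ e_q`:
`⟨a [∇N + e^{i ⟨θ, ·⟩} e_r ⊗ e_q], ∇φ⟩ = 0` for all `φ ∈ [H¹_θ(Y) ⊥ e^{i ⟨θ, ·⟩}]^n`. -/
def IsCellSolution {n d : ℕ} (a : RSpace d → (Ten n d →L[ℂ] Ten n d)) (θ : RSpace d)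
    (r : Fin n) (q : Fin d) (N : (gradTheta n θ).domain) : Prop :=
  PerpWave θ (N : L2Y n d) ∧
    ∀ φ : (gradTheta n θ).domain, PerpWave θ (φ : L2Y n d) →
      ∫ y in cellY d, inner ℂ (gradTheta n θ φ y)
        (a y (gradTheta n θ N y + planeWave θ y • EuclideanSpace.single (r, q) 1)) = 0

/-- The solution `N_θ^{(rq)}` of the cell problem (arbitrary if there is none). -/
def cellSolution {n d : ℕ} (a : RSpace d → (Ten n d →L[ℂ] Ten n d)) (θ : RSpace d)
    (r : Fin n) (q : Fin d) : (gradTheta n θ).domain :=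
  Classical.epsilon (IsCellSolution a θ r q)

/-- The `θ`-dependent homogenised tensor: `a^hom_{ijrq}(θ)` is
`∑_k ∑_l ∫_Y a_{ijkl} (∂_l N^{(rq)}_{θ,k} + e^{i ⟨θ, y⟩} δ_{kr} δ_{lq}) e^{-i ⟨θ, y⟩} dy`. -/
def aHom {n d : ℕ} (a : RSpace d → (Ten n d →L[ℂ] Ten n d)) (θ : RSpace d) :
    Ten n d →L[ℂ] Ten n d :=
  ofEntries fun (p p' : Fin n × Fin d) => ∑ k : Fin n, ∑ l : Fin d, ∫ y in cellY d,
    entry (a y) p (k, l) *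
      (gradTheta n θ (cellSolution a θ p'.1 p'.2) y (k, l) +
        planeWave θ y * (if k = p'.1 then 1 else 0) * (if l = p'.2 then 1 else 0)) *
      planeWave (-θ) y

/-- The mean value `m(s)_{ij} = ∫_Y s_{ij}`. -/
def meanCoeff {n d : ℕ} (s : RSpace d → (Vec n →L[ℂ] Vec n)) : Vec n →L[ℂ] Vec n :=
  ofEntries fun i j => ∫ y in cellY d, entry (s y) i j

/-! ### Gelfand transform and direct integrals -/

/-- `U` is the Gelfand transform `U_ε`: the unitary operator from `[L²(ℝ^d)]^n` onto
`L²(Θ; [L²(Y)]^n)` which for `f ∈ [C_c(ℝ^d)]^n` is given by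
`(U_ε f)(θ, y) = (ε / 2π)^{d/2} ∑_{k ∈ ℤ^d} f(ε (y + k)) e^{-i ⟨θ, k⟩}`. -/
def IsGelfandTransform {n d : ℕ} (ε : ℝ) (U : L2R n d ≃ₗᵢ[ℂ] L2ΘY n d) : Prop :=
  ∀ (f : RSpace d → Vec n), Continuous f → HasCompactSupport f →
    ∀ F : L2R n d, F =ᵐ[volume] f →
      ∀ᵐ θ ∂volΘ d, (U F θ : L2Y n d) =ᵐ[volY d] fun y =>
        ((ε / (2 * Real.pi)) ^ ((d : ℝ) / 2) : ℝ) •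
          ∑' k : Fin d → ℤ, planeWave (-θ) (intVec k) • f (ε • (y + intVec k))

/-- `D = ∫^⊕_Θ T(θ) dθ`: the bounded operator on `L²(Θ; [L²(Y)]^n)` acting fibrewise. -/
def IsDirectIntegral {n d : ℕ} (T : RSpace d → (L2Y n d →L[ℂ] L2Y n d))
    (D : L2ΘY n d →L[ℂ] L2ΘY n d) : Prop :=
  ∀ g : L2ΘY n d, ∀ᵐ θ ∂volΘ d, D g θ = T θ (g θ)

end FibreHom

end

noncomputable section

namespace FibreHom

open MeasureTheory ContinuousLinearMap

/-! ### Coercive operators and form inverses -/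

/-! The coefficients repeat on all cells `ε(Y + m)`, so the Gelfand transform turns the oscillating
resolvent into the direct integral over `θ` of the resolvents of `-ε⁻² div_θ a ∇_θ + s` on `Y`. The
transform is unitary, and a fibrewise operator is bounded by the essential supremum of its fibre
norms. Everything thus reduces to an `O(ε)` comparison on one cell, uniform in `θ`
(`norm_fibreRes_sub_le`).

The comparison on the cell is `homogenisation_estimate`. Split the solution as `u = e^{iθ·y}c + w`
with `w` orthogonal to the plane waves. For `k ≠ 0` some component of `θ + 2πk` has modulus at least
`π`, so the Poincaré inequality `‖w‖ ≤ ‖∇w‖` holds with constant 1 for all `θ ∈ Θ`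
(`norm_le_norm_grad`). The energy estimate gives `‖∇u‖ = O(ε)`, hence `w = O(ε)`. The large factor
`ε⁻²` forces `∇w` to agree with the gradient of the corrector belonging to `c ⊗ iθ` up to `O(ε²)`.
Testing with plane waves then leaves an equation for `c` with the coefficients `a^hom(θ)` and
`m(s)`, up to an error of order `ε`. For the homogenised problem the same equation is exact, because
constant coefficients preserve orthogonality to the plane waves. Coercivity bounds the difference of
the two means, and the constant depends only on the coercivity constant and the norms of the
coefficients.

To treat all `θ` at once, multiplication by `e^{-iθ·y}` carries `H¹_θ` to the fixed space `PerSpace`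
of periodic functions and `∇_θ` to `∇ + iθ`, which is norm continuous in `θ`. Inverses of coercive
forms are then continuous in `θ`, which gives the measurability needed for the direct integrals.

The Gelfand transform is built from two Hilbert sums indexed by `ℤ^d`: `L²(ℝ^d)` splits into the
cells, and `L²(Θ; L²(Y))` into the Fourier modes `e^{-iθ·m}`. Its relation to the gradient rests on
the Fourier description of the graph of `∇_θ` (`mem_gradThetaGraph_iff`). Compactly supported
Sobolev functions are mapped into the fibre graphs by testing with truncated plane waves
(`ae_mem_gradThetaGraph_gelfand`); a field whose fibres lie in these graphs is a Sobolev function by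
fibrewise integration by parts (`mem_weakGradGraph_of_gelfand`). Finally,
`isBoundedInverse_ellipticOp` turns weak solution operators into inverses of the unbounded
operators. -/

/-- Lax–Milgram: coercivity bounds `B` from below, so `B` is injective with closed range, and a
vector `w` orthogonal to the range satisfies `⟨w, B w⟩ = 0`, hence vanishes. -/
theorem isUnit_of_coercive {V : Type*} [NormedAddCommGroup V] [InnerProductSpace ℂ V]
    [CompleteSpace V] (B : V →L[ℂ] V) {c : ℝ} (hc : 0 < c)
    (hB : ∀ v, c * ‖v‖ ^ 2 ≤ (inner ℂ v (B v)).re) : IsUnit B := by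
  have hb : ∀ v, c * ‖v‖ ≤ ‖B v‖ := by
    intro v
    rcases (norm_nonneg v).eq_or_lt with h | h
    · rw [← h]; simp
    · have h1 := hB v
      have h2 : (inner ℂ v (B v)).re ≤ ‖v‖ * ‖B v‖ :=
        (Complex.re_le_norm _).trans (norm_inner_le_norm v (B v))
      nlinarith
  have hanti : AntilipschitzWith (c⁻¹.toNNReal) B := by
    refine ContinuousLinearMap.antilipschitz_of_bound B fun v => ?_
    rw [Real.coe_toNNReal _ (inv_nonneg.2 hc.le), inv_mul_eq_div, le_div_iff₀ hc, mul_comm]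
    exact hb v
  have hcl : IsClosed (LinearMap.range B.toLinearMap : Set V) := by
    exact hanti.isClosed_range B.uniformContinuous
  rw [ContinuousLinearMap.isUnit_iff_bijective]
  refine ⟨hanti.injective, ?_⟩
  have : CompleteSpace (LinearMap.range B.toLinearMap) := hcl.completeSpace_coe
  have htop : LinearMap.range B.toLinearMap = ⊤ := by
    rw [← Submodule.orthogonal_eq_bot_iff, Submodule.eq_bot_iff]
    intro w hw
    have h0 : inner ℂ (B w) w = 0 := hw (B w) ⟨w, rfl⟩
    have h1 := hB w
    rw [← inner_conj_symm, h0] at h1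
    simp only [map_zero, Complex.zero_re] at h1
    have : ‖w‖ ^ 2 ≤ 0 := by nlinarith
    simpa using this
  intro v
  have : v ∈ LinearMap.range B.toLinearMap := htop ▸ Submodule.mem_top
  exact this

/-- The weak identity says exactly that `A (RG f)` lies in the domain of `G*` with value `c⁻¹(f - S
R f)`, which makes `R` a right inverse. It is also a left inverse because the operator has trivial
kernel; strict coercivity is needed only of `S`. -/
theorem isBoundedInverse_ellipticOp {H K : Type} [NormedAddCommGroup H] [InnerProductSpace ℂ H]
    [CompleteSpace H] [NormedAddCommGroup K] [InnerProductSpace ℂ K] [CompleteSpace K]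
    {G : H →ₗ.[ℂ] K} (hG : Dense (G.domain : Set H)) {c : ℝ} (hc : 0 < c)
    {A : K →L[ℂ] K} {S : H →L[ℂ] H} {m : ℝ} (hm : 0 < m)
    (hA : ∀ X, 0 ≤ (inner ℂ X (A X)).re) (hS : ∀ u, m * ‖u‖ ^ 2 ≤ (inner ℂ u (S u)).re)
    {R : H →L[ℂ] H} {RG : H → K} (hR : ∀ f, (R f, RG f) ∈ G.graph)
    (hw : ∀ f w q, (w, q) ∈ G.graph →
      (c : ℂ) * inner ℂ q (A (RG f)) + inner ℂ w (S (R f)) = inner ℂ w f) :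
    IsBoundedInverse (ellipticOp G (c : ℂ) A S) R := by
  have hc' : (c : ℂ) ≠ 0 := by exact_mod_cast hc.ne'
  have hfst : ∀ f : H, ∃ h : R f ∈ (ellipticOp G (c : ℂ) A S).domain,
      ellipticOp G (c : ℂ) A S ⟨R f, h⟩ = f := by
    intro f
    obtain ⟨u, hu1, hu2⟩ := (LinearPMap.mem_graph_iff G).1 (hR f)
    have hd : R f ∈ G.domain := by simp only at hu1; rw [← hu1]; exact u.2
    have hGR : G ⟨R f, hd⟩ = RG f := by
      simp only at hu1 hu2; rw [← hu2]; congr 1; exact Subtype.ext hu1.symm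
    have hadj : ∀ x : G.domain, inner ℂ ((c : ℂ)⁻¹ • (f - S (R f))) (x : H)
        = inner ℂ (A (G ⟨R f, hd⟩)) (G x) := by
      intro x
      have h1 := hw f x (G x) (LinearPMap.mem_graph G x)
      rw [← inner_conj_symm, ← inner_conj_symm (A _), hGR]
      congr 1
      rw [inner_smul_right, inner_sub_right, ← h1]
      field_simp
      ring
    have hmem : A (G ⟨R f, hd⟩) ∈ (G.adjoint).domain :=
      LinearPMap.mem_adjoint_domain_of_exists _ ⟨_, hadj⟩
    have hval : G.adjoint ⟨A (G ⟨R f, hd⟩), hmem⟩ = (c : ℂ)⁻¹ • (f - S (R f)) :=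
      LinearPMap.adjoint_apply_eq hG _ hadj
    refine ⟨⟨hd, hmem⟩, ?_⟩
    change -((c : ℂ) • -(G.adjoint ⟨A (G ⟨R f, hd⟩), hmem⟩)) + S (R f) = f
    rw [hval, smul_neg, neg_neg, smul_smul, mul_inv_cancel₀ hc', one_smul, sub_add_cancel]
  refine ⟨hfst, fun u => ?_⟩
  obtain ⟨h, hf⟩ := hfst (ellipticOp G (c : ℂ) A S u)
  -- The error `u - R T u` lies in the kernel of the operator `T`; pairing the equation with the
  -- error itself forces it to vanish.
  set v : (ellipticOp G (c : ℂ) A S).domain := u - ⟨_, h⟩ with hv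
  have h0 : ellipticOp G (c : ℂ) A S v = 0 := by rw [hv, LinearPMap.map_sub, hf, sub_self]
  obtain ⟨hv1, hv2⟩ := v.2
  have h1 : -((c : ℂ) • -(G.adjoint ⟨A (G ⟨v.1, hv1⟩), hv2⟩)) + S v.1 = 0 := h0
  have h2 : (c : ℂ) * inner ℂ (G ⟨v.1, hv1⟩) (A (G ⟨v.1, hv1⟩)) + inner ℂ v.1 (S v.1) = 0 := by
    have h3 := LinearPMap.adjoint_isFormalAdjoint hG ⟨A (G ⟨v.1, hv1⟩), hv2⟩ ⟨v.1, hv1⟩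
    have h4 : inner ℂ (G ⟨v.1, hv1⟩) (A (G ⟨v.1, hv1⟩))
        = inner ℂ v.1 (G.adjoint ⟨A (G ⟨v.1, hv1⟩), hv2⟩) := by
      rw [← inner_conj_symm, ← h3, inner_conj_symm]
    rw [h4, ← inner_smul_right, ← inner_add_right]
    rw [smul_neg, neg_neg] at h1
    rw [h1, inner_zero_right]
  have h3 := congrArg Complex.re h2
  rw [Complex.add_re, Complex.re_ofReal_mul, Complex.zero_re] at h3
  have h5 : ‖v.1‖ ^ 2 ≤ 0 := by
    have := hS v.1
    have := mul_nonneg hc.le (hA (G ⟨v.1, hv1⟩))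
    nlinarith
  have h6 : v.1 = 0 := by simpa using h5
  have h7 : (u : H) - R (ellipticOp G (c : ℂ) A S u) = 0 := h6
  exact (sub_eq_zero.1 h7).symm

/-- The constant in the homogenisation estimate. -/
def homConst (m α σ : ℝ) : ℝ := 2 * (α * (1 + σ / m) / m + σ / m + 1) / m

/-! ### The abstract homogenisation estimate -/

section Estimate

variable {V X K C T : Type*} [AddCommGroup V] [Module ℂ V]
  [NormedAddCommGroup X] [InnerProductSpace ℂ X] [NormedAddCommGroup K] [InnerProductSpace ℂ K]
  [NormedAddCommGroup C] [InnerProductSpace ℂ C] [NormedAddCommGroup T] [InnerProductSpace ℂ T]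

/-- The equation tested with `u` itself. With the weight `y = ε⁻¹‖G u‖` both terms have the same
size, and coercivity reads `m (x² + y²) ≤ x ‖f‖` for `x = ‖J u‖`. -/
theorem energy_bound {J : V →ₗ[ℂ] X} {G : V →ₗ[ℂ] K} {A : K → K} {S : X → X} {m ε : ℝ}
    (hm : 0 < m) (hε : 0 < ε) (hA : ∀ Y, m * ‖Y‖ ^ 2 ≤ (inner ℂ Y (A Y)).re)
    (hS : ∀ u, m * ‖u‖ ^ 2 ≤ (inner ℂ u (S u)).re) {f : X} {u : V}
    (hu : (((ε ^ 2)⁻¹ : ℝ) : ℂ) * inner ℂ (G u) (A (G u)) + inner ℂ (J u) (S (J u))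
      = inner ℂ (J u) f) : ‖J u‖ ≤ ‖f‖ / m ∧ ‖G u‖ ≤ ε * ‖f‖ / m := by
  have h := congrArg Complex.re hu
  rw [Complex.add_re, Complex.re_ofReal_mul] at h
  have h1 : (inner ℂ (J u) f).re ≤ ‖J u‖ * ‖f‖ :=
    (Complex.re_le_norm _).trans (norm_inner_le_norm _ _)
  have hS' := hS (J u)
  have hA' := mul_le_mul_of_nonneg_left (hA (G u)) (inv_nonneg.2 (sq_nonneg ε))
  set x := ‖J u‖
  set y := ε⁻¹ * ‖G u‖ with hy
  have hx0 : 0 ≤ x := norm_nonneg _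
  have hy0 : 0 ≤ y := by positivity
  have hyy : (ε ^ 2)⁻¹ * (m * ‖G u‖ ^ 2) = m * y ^ 2 := by rw [hy]; field_simp
  rw [hyy] at hA'
  have key : m * (x ^ 2 + y ^ 2) ≤ x * ‖f‖ := by linarith
  have hxb : m * x ≤ ‖f‖ := by
    rcases hx0.eq_or_lt with h0 | h0
    · rw [← h0]; simp
    · have : m * x * x ≤ ‖f‖ * x := by nlinarith [sq_nonneg y]
      exact le_of_mul_le_mul_right this h0
  have hyb : m * y ≤ ‖f‖ := by
    -- Multiplying `key` by `m` and using `m x ≤ ‖f‖` gives `(m y)² ≤ ‖f‖²`.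
    refine abs_le_of_sq_le_sq' ?_ (norm_nonneg f) |>.2
    have : m * (m * (x ^ 2 + y ^ 2)) ≤ m * (x * ‖f‖) := mul_le_mul_of_nonneg_left key hm.le
    nlinarith [sq_nonneg (m * x), mul_le_mul_of_nonneg_right hxb (norm_nonneg f)]
  refine ⟨by rw [le_div_iff₀ hm]; linarith, ?_⟩
  have : ‖G u‖ = ε * y := by rw [hy]; field_simp
  rw [this, le_div_iff₀ hm]
  nlinarith

/-- The abstract homogenisation estimate: `u` solves the problem with coefficients `(A, S)` and
`v` the one with the effective coefficients `(A', S')`; `e₀` embeds the constants and `E` the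
constant gradients, and `P v` means that `v` is orthogonal to the constants. -/
theorem homogenisation_estimate (J : V →ₗ[ℂ] X) (G : V →ₗ[ℂ] K) (e₀ : C →ₗ[ℂ] V)
    (E : T →ₗᵢ[ℂ] K) (τ : C →ₗ[ℂ] T) (P : V → Prop)
    (hGe : ∀ c, G (e₀ c) = E (τ c))
    (hdec : ∀ v, ∃ c, P (v - e₀ c)) (hPsub : ∀ v w, P v → P w → P (v - w))
    (hEG : ∀ v, P v → ∀ ξ, inner ℂ (E ξ) (G v) = 0)
    (hP : ∀ v, P v → ‖J v‖ ≤ ‖G v‖)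
    (A A' : K →ₗ[ℂ] K) (S S' : X →ₗ[ℂ] X) {m α σ : ℝ} (hm : 0 < m) (hα : 0 ≤ α) (hσ : 0 ≤ σ)
    (hA : ∀ Y, m * ‖Y‖ ^ 2 ≤ (inner ℂ Y (A Y)).re)
    (hA' : ∀ Y, m * ‖Y‖ ^ 2 ≤ (inner ℂ Y (A' Y)).re)
    (hS : ∀ u, m * ‖u‖ ^ 2 ≤ (inner ℂ u (S u)).re)
    (hS' : ∀ u, m * ‖u‖ ^ 2 ≤ (inner ℂ u (S' u)).re)
    (hAα : ∀ Y, ‖A Y‖ ≤ α * ‖Y‖) (hSσ : ∀ u, ‖S u‖ ≤ σ * ‖u‖)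
    (hA'P : ∀ v, P v → ∀ ξ, inner ℂ (E ξ) (A' (G v)) = 0)
    (hS'P : ∀ v, P v → ∀ c, inner ℂ (J (e₀ c)) (S' (J v)) = 0)
    (hSS' : ∀ c c', inner ℂ (J (e₀ c)) (S (J (e₀ c'))) = inner ℂ (J (e₀ c)) (S' (J (e₀ c'))))
    (hcell : ∀ ξ, ∃ N, P N ∧ (∀ φ, P φ → inner ℂ (G φ) (A (G N + E ξ)) = 0) ∧
      ∀ ζ, inner ℂ (E ζ) (A' (E ξ)) = inner ℂ (E ζ) (A (G N + E ξ)))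
    {ε : ℝ} (hε : 0 < ε) {f : X} {u v : V}
    (hu : ∀ φ, (((ε ^ 2)⁻¹ : ℝ) : ℂ) * inner ℂ (G φ) (A (G u)) + inner ℂ (J φ) (S (J u))
      = inner ℂ (J φ) f)
    (hv : ∀ φ, (((ε ^ 2)⁻¹ : ℝ) : ℂ) * inner ℂ (G φ) (A' (G v)) + inner ℂ (J φ) (S' (J v))
      = inner ℂ (J φ) f) :
    ‖J u - J v‖ ≤ homConst m α σ * ε * ‖f‖ := by
  obtain ⟨hJu, hGu⟩ := energy_bound hm hε hA hS (hu u)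
  obtain ⟨hJv, hGv⟩ := energy_bound hm hε hA' hS' (hv v)
  -- Removing the constant part does not increase the gradient, since the two parts of `G x` are
  -- orthogonal. With the Poincaré inequality this makes `w` and `w'` of order `ε`.
  have hpyth : ∀ x c, P (x - e₀ c) → ‖G (x - e₀ c)‖ ≤ ‖G x‖ := by
    intro x c hx
    have h1 : G x = E (τ c) + G (x - e₀ c) := by rw [map_sub, hGe]; abel
    have h2 := norm_add_sq_eq_norm_sq_add_norm_sq_of_inner_eq_zero _ _ (hEG _ hx (τ c))
    rw [← h1] at h2
    refine abs_le_of_sq_le_sq' ?_ (norm_nonneg _) |>.2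
    nlinarith [norm_nonneg (E (τ c))]
  obtain ⟨c, hc⟩ := hdec u
  obtain ⟨c', hc'⟩ := hdec v
  set w := u - e₀ c with hw
  set w' := v - e₀ c' with hw'
  have hJw : ‖J w‖ ≤ ε * ‖f‖ / m := (hP _ hc).trans ((hpyth _ _ hc).trans hGu)
  have hJw' : ‖J w'‖ ≤ ε * ‖f‖ / m := (hP _ hc').trans ((hpyth _ _ hc').trans hGv)
  -- `N` is the corrector of the gradient of the constant part, and `r = w - N` measures how far `w`
  -- is from it.
  obtain ⟨N, hN, hNc, hNh⟩ := hcell (τ c)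
  set r := w - N with hr
  have hrP : P r := hPsub _ _ hc hN
  have hGu' : G u = (G N + E (τ c)) + G r := by
    rw [hr, hw, map_sub, map_sub, hGe]; abel
  have hGv' : G v = E (τ c') + G w' := by rw [hw', map_sub, hGe]; abel
  have hJu' : J u = J (e₀ c) + J w := by rw [hw, map_sub]; abel
  have hJv' : J v = J (e₀ c') + J w' := by rw [hw', map_sub]; abel
  -- bound for the remainder
  have hGr : ‖G r‖ ≤ ε ^ 2 * ‖f‖ * (1 + σ / m) / m := by
    -- Tested with `r`, the cell equation removes the leading part `G N + E (τ c)`. What remains is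
    -- `ε⁻²⟨G r, A G r⟩ = ⟨J r, f - S J u⟩`, whose right-hand side is `O(‖G r‖)`, so `‖G r‖` is of
    -- order `ε²`.
    have h1 := hu r
    rw [hGu', map_add, inner_add_right, hNc r hrP, zero_add] at h1
    have h2 : (((ε ^ 2)⁻¹ : ℝ) : ℂ) * inner ℂ (G r) (A (G r)) = inner ℂ (J r) (f - S (J u)) := by
      rw [inner_sub_right, ← h1]; ring
    have h3 := congrArg Complex.re h2
    rw [Complex.re_ofReal_mul] at h3
    have h4 : (inner ℂ (J r) (f - S (J u))).re ≤ ‖J r‖ * ‖f - S (J u)‖ :=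
      (Complex.re_le_norm _).trans (norm_inner_le_norm _ _)
    have h5 : ‖f - S (J u)‖ ≤ ‖f‖ * (1 + σ / m) := by
      refine (norm_sub_le _ _).trans ?_
      have := (hSσ (J u)).trans (mul_le_mul_of_nonneg_left hJu hσ)
      have e : σ * (‖f‖ / m) = ‖f‖ * (σ / m) := by ring
      rw [e] at this
      linarith
    have h6 : ‖J r‖ * ‖f - S (J u)‖ ≤ ‖G r‖ * (‖f‖ * (1 + σ / m)) :=
      mul_le_mul (hP r hrP) h5 (norm_nonneg _) (norm_nonneg _)
    have h7 := mul_le_mul_of_nonneg_left (hA (G r)) (inv_nonneg.2 (sq_nonneg ε))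
    have h8 : (ε ^ 2)⁻¹ * (m * ‖G r‖ ^ 2) ≤ ‖G r‖ * (‖f‖ * (1 + σ / m)) := by linarith
    rcases (norm_nonneg (G r)).eq_or_lt with h0 | h0
    · rw [← h0]; positivity
    · rw [le_div_iff₀ hm]
      rw [inv_mul_le_iff₀ (by positivity)] at h8
      refine le_of_mul_le_mul_right ?_ h0
      nlinarith
  -- the equation for the difference of the means
  set z := c - c' with hz
  have hmain : (((ε ^ 2)⁻¹ : ℝ) : ℂ) * inner ℂ (E (τ z)) (A' (E (τ z)))
      + inner ℂ (J (e₀ z)) (S' (J (e₀ z)))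
      = -((((ε ^ 2)⁻¹ : ℝ) : ℂ) * inner ℂ (E (τ z)) (A (G r)) + inner ℂ (J (e₀ z)) (S (J w))) := by
    have h1 := hu (e₀ z)
    have h2 := hv (e₀ z)
    -- For `u`, the corrector identity replaces `A` by `A'` on the leading term and leaves the
    -- errors in `G r` and `J w`. For `v`, the terms in `w'` drop out altogether by orthogonality.
    rw [hGu', hJu', hGe, map_add A, inner_add_right, ← hNh, map_add S, inner_add_right, hSS'] at h1
    rw [hGv', hJv', hGe, map_add A', inner_add_right, hA'P _ hc', map_add S', inner_add_right,
      hS'P _ hc'] at h2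
    have e1 : E (τ z) = E (τ c) - E (τ c') := by rw [hz, map_sub, map_sub]
    have e2 : J (e₀ z) = J (e₀ c) - J (e₀ c') := by rw [hz, map_sub, map_sub]
    have e3 : inner ℂ (E (τ z)) (A' (E (τ z))) = inner ℂ (E (τ z)) (A' (E (τ c)))
        - inner ℂ (E (τ z)) (A' (E (τ c'))) := by
      conv_lhs => rw [e1, map_sub A', inner_sub_right, ← e1]
    have e4 : inner ℂ (J (e₀ z)) (S' (J (e₀ z))) = inner ℂ (J (e₀ z)) (S' (J (e₀ c)))
        - inner ℂ (J (e₀ z)) (S' (J (e₀ c'))) := by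
      conv_lhs => rw [e2, map_sub S', inner_sub_right, ← e2]
    rw [e3, e4]
    linear_combination h1 - h2
  have hre := congrArg Complex.re hmain
  rw [Complex.neg_re, Complex.add_re, Complex.add_re, Complex.re_ofReal_mul,
    Complex.re_ofReal_mul] at hre
  have hb1 := mul_le_mul_of_nonneg_left (hA' (E (τ z))) (inv_nonneg.2 (sq_nonneg ε))
  have hb2 := hS' (J (e₀ z))
  have hb3 : -(inner ℂ (E (τ z)) (A (G r))).re
      ≤ ‖E (τ z)‖ * (α * (ε ^ 2 * ‖f‖ * (1 + σ / m) / m)) := by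
    refine (neg_le_abs _).trans ((Complex.abs_re_le_norm _).trans
      ((norm_inner_le_norm _ _).trans ?_))
    exact mul_le_mul_of_nonneg_left ((hAα _).trans (mul_le_mul_of_nonneg_left hGr hα))
      (norm_nonneg _)
  have hb4 : -(inner ℂ (J (e₀ z)) (S (J w))).re ≤ ‖J (e₀ z)‖ * (σ * (ε * ‖f‖ / m)) := by
    refine (neg_le_abs _).trans ((Complex.abs_re_le_norm _).trans
      ((norm_inner_le_norm _ _).trans ?_))
    exact mul_le_mul_of_nonneg_left ((hSσ _).trans (mul_le_mul_of_nonneg_left hJw hσ))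
      (norm_nonneg _)
  have hb3' := mul_le_mul_of_nonneg_left hb3 (inv_nonneg.2 (sq_nonneg ε))
  -- The weights of the energy estimate again: the difference equation becomes `m (p² + q²) ≤ ε‖f‖(β
  -- p + γ q)`, where the `ε²` in the bound for `G r` has cancelled the factor `ε⁻²`.
  set p := ε⁻¹ * ‖E (τ z)‖ with hp
  set q := ‖J (e₀ z)‖ with hq
  have hp0 : 0 ≤ p := by positivity
  have hq0 : 0 ≤ q := norm_nonneg _
  set β := α * (1 + σ / m) / m with hβ
  set γ := σ / m with hγ
  have hβ0 : 0 ≤ β := by positivity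
  have hγ0 : 0 ≤ γ := by positivity
  have e5 : (ε ^ 2)⁻¹ * (m * ‖E (τ z)‖ ^ 2) = m * p ^ 2 := by rw [hp]; field_simp
  have e6 : (ε ^ 2)⁻¹ * (‖E (τ z)‖ * (α * (ε ^ 2 * ‖f‖ * (1 + σ / m) / m)))
      = ε * ‖f‖ * β * p := by rw [hp, hβ, hγ]; field_simp
  have e7 : q * (σ * (ε * ‖f‖ / m)) = ε * ‖f‖ * γ * q := by rw [hγ]; ring
  rw [e5] at hb1
  rw [e6] at hb3'
  rw [e7] at hb4
  have hF : 0 ≤ ε * ‖f‖ := by positivity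
  have key : m * (p ^ 2 + q ^ 2) ≤ ε * ‖f‖ * (β * p + γ * q) := by linarith
  have key2 : m * (p + q) ≤ 2 * (ε * ‖f‖) * (β + γ) := by
    rcases (add_nonneg hp0 hq0).eq_or_lt with h0 | h0
    · rw [← h0]; simp; positivity
    · refine le_of_mul_le_mul_right ?_ h0
      have h1 : β * p + γ * q ≤ (β + γ) * (p + q) := by
        nlinarith [mul_nonneg hβ0 hq0, mul_nonneg hγ0 hp0]
      have h2 := mul_le_mul_of_nonneg_left h1 hF
      have h3 : m * (p + q) ^ 2 ≤ 2 * (m * (p ^ 2 + q ^ 2)) := by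
        have : 0 ≤ m * (p - q) ^ 2 := by positivity
        linarith
      linarith
  have hqb : q ≤ 2 * (ε * ‖f‖) * (β + γ) / m := by
    rw [le_div_iff₀ hm]
    have := mul_nonneg hm.le hp0
    linarith
  -- The difference of the means contributes `2(β + γ)/m`, and the two oscillating parts contribute
  -- `1/m` each; together these give `homConst`.
  have hfin : J u - J v = J (e₀ z) + (J w - J w') := by
    have h1 : J u - J v = (J (e₀ c) + J w) - (J (e₀ c') + J w') := by rw [← hJu', ← hJv']
    rw [h1, hz, map_sub e₀ c c', map_sub J (e₀ c) (e₀ c')]; abel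
  rw [hfin]
  refine (norm_add_le _ _).trans ((add_le_add hqb ((norm_sub_le _ _).trans
    (add_le_add hJw hJw'))).trans (le_of_eq ?_))
  rw [homConst, ← hγ, ← hβ]
  ring

end Estimate

/-! ### Plane waves -/

section PlaneWave

variable {d : ℕ}

theorem planeWave_add_left (θ η y : RSpace d) :
    planeWave (θ + η) y = planeWave θ y * planeWave η y := by
  rw [planeWave, planeWave, planeWave, ← Complex.exp_add, inner_add_left]
  push_cast; ring_nf

theorem planeWave_add_right (θ y z : RSpace d) :
    planeWave θ (y + z) = planeWave θ y * planeWave θ z := by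
  rw [planeWave, planeWave, planeWave, ← Complex.exp_add, inner_add_right]
  push_cast; ring_nf

@[simp] theorem planeWave_zero_left (y : RSpace d) : planeWave 0 y = 1 := by simp [planeWave]

@[simp] theorem norm_planeWave (θ y : RSpace d) : ‖planeWave θ y‖ = 1 := by
  rw [planeWave, mul_comm]; exact Complex.norm_exp_ofReal_mul_I _

theorem planeWave_neg_left (θ y : RSpace d) : planeWave (-θ) y = starRingEnd ℂ (planeWave θ y) := by
  rw [planeWave, planeWave, ← Complex.exp_conj]
  simp

theorem planeWave_neg_right (θ y : RSpace d) : planeWave θ (-y) = planeWave (-θ) y := by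
  rw [planeWave, planeWave, inner_neg_left, inner_neg_right]

theorem planeWave_smul_comm (c : ℝ) (θ y : RSpace d) :
    planeWave θ (c • y) = planeWave (c • θ) y := by
  rw [planeWave, planeWave, inner_smul_left, inner_smul_right]
  simp

theorem planeWave_mul_neg (θ y : RSpace d) : planeWave θ y * planeWave (-θ) y = 1 := by
  rw [← planeWave_add_left, add_neg_cancel, planeWave_zero_left]

theorem planeWave_comm (θ y : RSpace d) : planeWave θ y = planeWave y θ := by
  rw [planeWave, planeWave, real_inner_comm]

theorem contDiff_planeWave (θ : RSpace d) {n : WithTop ℕ∞} : ContDiff ℝ n (planeWave θ) := by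
  unfold planeWave
  refine ContDiff.cexp (contDiff_const.mul (Complex.ofRealCLM.contDiff.comp ?_))
  exact contDiff_const.inner ℝ contDiff_id

theorem continuous_planeWave (θ : RSpace d) : Continuous (planeWave θ) :=
  (contDiff_planeWave (n := 0) θ).continuous

theorem continuous_planeWave_left (y : RSpace d) : Continuous (fun θ => planeWave θ y) := by
  simp_rw [planeWave_comm _ y]
  exact continuous_planeWave y

theorem fderiv_planeWave (θ y : RSpace d) (j : Fin d) :
    fderiv ℝ (planeWave θ) y (basisVec j) = Complex.I * θ j * planeWave θ y := by
  have h1 : HasFDerivAt (fun y : RSpace d => (inner ℝ θ y : ℝ)) (innerSL ℝ θ) y :=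
    (innerSL ℝ θ).hasFDerivAt
  have h2 := ((Complex.ofRealCLM.hasFDerivAt.comp y h1).const_mul Complex.I).cexp
  have h3 : fderiv ℝ (planeWave θ) y = _ := h2.fderiv
  rw [h3]
  simp [basisVec, planeWave, EuclideanSpace.inner_single_right]
  ring

theorem inner_intVec_intVec (k m : Fin d → ℤ) :
    (inner ℝ (intVec k) (intVec m) : ℝ) = ((∑ i, k i * m i : ℤ) : ℝ) := by
  simp [intVec, PiLp.inner_apply, mul_comm]

theorem planeWave_two_pi_intVec (k m : Fin d → ℤ) :
    planeWave ((2 * Real.pi) • intVec k) (intVec m) = 1 := by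
  rw [planeWave, inner_smul_left, inner_intVec_intVec, Complex.exp_eq_one_iff]
  refine ⟨∑ i, k i * m i, ?_⟩
  push_cast
  simp
  ring

/-- The shifted frequency `θ + 2πk`. -/
def freq (θ : RSpace d) (k : Fin d → ℤ) : RSpace d := θ + (2 * Real.pi) • intVec k

theorem freq_apply (θ : RSpace d) (k : Fin d → ℤ) (j : Fin d) :
    freq θ k j = θ j + 2 * Real.pi * k j := by
  simp [freq, intVec]

theorem planeWave_freq_intVec (θ : RSpace d) (k m : Fin d → ℤ) :
    planeWave (freq θ k) (intVec m) = planeWave θ (intVec m) := by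
  rw [freq, planeWave_add_left, planeWave_two_pi_intVec, mul_one]

end PlaneWave

/-! ### Integration over the cell -/

section Cell

theorem toLp_preimage_cellY (d : ℕ) : (WithLp.toLp 2 : (Fin d → ℝ) → RSpace d) ⁻¹' cellY d
    = Set.univ.pi fun _ => Set.Ioo (0 : ℝ) 1 := by
  ext x; simp [cellY, Set.mem_pi]

/-- The set is free up to null sets because the divergence theorem needs the closed cube, while the
torus is parametrised by a half-open one. -/
theorem measurePreserving_toLp_cell (d : ℕ) {s : Set (Fin d → ℝ)}
    (hs : s =ᵐ[volume] Set.Icc (0 : Fin d → ℝ) 1) :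
    MeasurePreserving (WithLp.toLp 2 : (Fin d → ℝ) → RSpace d) (volume.restrict s) (volY d) := by
  have h := (PiLp.volume_preserving_toLp (Fin d)).restrict_preimage (isOpen_cellY d).measurableSet
  rw [toLp_preimage_cellY] at h
  have e : (Set.univ.pi fun _ : Fin d => Set.Ioo (0 : ℝ) 1) =ᵐ[volume] s :=
    (Measure.univ_pi_Ioo_ae_eq_Icc (μ := fun _ : Fin d => (volume : Measure ℝ))
      (f := 0) (g := 1)).trans hs.symm
  rwa [Measure.restrict_congr_set e] at h

theorem setIntegral_cellY {d : ℕ} {E : Type*} [NormedAddCommGroup E] [NormedSpace ℝ E]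
    (g : RSpace d → E) :
    ∫ y in cellY d, g y = ∫ x in Set.Icc (0 : Fin d → ℝ) 1, g (WithLp.toLp 2 x) :=
  ((measurePreserving_toLp_cell d (Filter.EventuallyEq.refl _ _)).integral_comp
    (MeasurableEquiv.toLp 2 (Fin d → ℝ)).measurableEmbedding g).symm

instance isProbabilityMeasure_volY (d : ℕ) : IsProbabilityMeasure (volY d) := by
  constructor
  rw [← (measurePreserving_toLp_cell d (Filter.EventuallyEq.refl _ _)).map_eq,
    Measure.map_apply (by fun_prop) MeasurableSet.univ]
  simp [Real.volume_Icc_pi]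

/-- The divergence theorem for the field whose only component is `ζ` in direction `j`: the
contributions of opposite faces cancel by periodicity. -/
theorem integral_cellY_fderiv_periodic {d : ℕ} {ζ : RSpace d → ℂ} (hζ : ContDiff ℝ 1 ζ)
    (hp : ∀ (k : Fin d → ℤ) y, ζ (y + intVec k) = ζ y) (j : Fin d) :
    ∫ y in cellY d, fderiv ℝ ζ y (basisVec j) = 0 := by
  rw [setIntegral_cellY]
  rcases d with _ | d
  · exact j.elim0
  set L : (Fin (d + 1) → ℝ) →L[ℝ] RSpace (d + 1) :=
    ((PiLp.continuousLinearEquiv 2 ℝ (fun _ : Fin (d + 1) => ℝ)).symm :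
      (Fin (d + 1) → ℝ) →L[ℝ] RSpace (d + 1)) with hL
  have hLx : ∀ x, L x = WithLp.toLp 2 x := fun x => rfl
  have hdiff : ∀ y, HasFDerivAt ζ (fderiv ℝ ζ y) y := fun y =>
    (hζ.differentiable one_ne_zero y).hasFDerivAt
  have hcont : Continuous (fun y => fderiv ℝ ζ y) := hζ.continuous_fderiv one_ne_zero
  have h := integral_divergence_of_hasFDerivAt_off_countable' (E := ℂ) (0 : Fin (d + 1) → ℝ) 1
    (fun _ => zero_le_one)
    (fun i x => if i = j then ζ (L x) else 0)
    (fun i x => if i = j then (fderiv ℝ ζ (L x)).comp L else 0) ∅ Set.countable_empty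
    (by
      intro i
      by_cases hi : i = j
      · simp only [hi, if_true]
        exact (hζ.continuous.comp L.continuous).continuousOn
      · simp only [hi, if_false]
        exact continuousOn_const)
    (by
      intro x _ i
      by_cases hi : i = j
      · simp only [hi, if_true]
        exact (hdiff (L x)).comp x L.hasFDerivAt
      · simp only [hi, if_false]
        exact hasFDerivAt_const _ _)
    (by
      refine Continuous.integrableOn_Icc ?_
      refine continuous_finsetSum _ fun i _ => ?_
      by_cases hi : i = j
      · simp only [hi, if_true]
        exact ((hcont.comp L.continuous).clm_comp continuous_const).clm_apply continuous_const
      · simp only [hi, if_false]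
        exact continuous_const)
  have hlhs : ∀ x : Fin (d + 1) → ℝ, fderiv ℝ ζ (WithLp.toLp 2 x) (basisVec j)
      = ∑ i, (if i = j then (fderiv ℝ ζ (L x)).comp L else 0) (Pi.single i 1) := by
    intro x
    rw [Finset.sum_eq_single j]
    · simp only [if_true, ContinuousLinearMap.comp_apply, hLx]
      rfl
    · intro i _ hi
      simp [hi]
    · simp
  simp_rw [hlhs]
  rw [h]
  refine Finset.sum_eq_zero fun i _ => ?_
  rw [sub_eq_zero]
  by_cases hi : i = j
  · subst hi
    simp only [if_true]
    refine integral_congr_ae (Filter.Eventually.of_forall fun x => ?_)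
    -- The two opposite faces differ by the lattice vector in direction `i`.
    have : L (i.insertNth ((1 : Fin (d + 1) → ℝ) i) x)
        = L (i.insertNth ((0 : Fin (d + 1) → ℝ) i) x) + intVec (Pi.single i 1) := by
      rw [hLx, hLx]
      ext l
      simp only [intVec, PiLp.add_apply]
      refine Fin.succAboveCases i ?_ (fun l => ?_) l
      · simp
      · simp [Fin.succAbove_ne]
    simp only [this, hp]
  · simp [hi]

/-- If `k j ≠ 0`, the wave is a non-zero multiple of its own `j`-th derivative, whose integral
vanishes by periodicity. -/
theorem integral_cellY_planeWave_two_pi {d : ℕ} (k : Fin d → ℤ) :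
    ∫ y in cellY d, planeWave ((2 * Real.pi) • intVec k) y = if k = 0 then 1 else 0 := by
  split_ifs with hk
  · have : (2 * Real.pi) • intVec k = (0 : RSpace d) := by
      ext i; simp [intVec, hk]
    simp [this]
  · obtain ⟨j, hj⟩ := Function.ne_iff.1 hk
    have h := integral_cellY_fderiv_periodic (contDiff_planeWave ((2 * Real.pi) • intVec k))
      (fun m y => by rw [planeWave_add_right, planeWave_two_pi_intVec, mul_one]) j
    simp_rw [fderiv_planeWave, integral_const_mul] at h
    have hne : Complex.I * (((2 * Real.pi) • intVec k : RSpace d) j : ℝ) ≠ 0 := by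
      simp only [intVec, PiLp.smul_apply, smul_eq_mul]
      have : (2 * Real.pi * (k j : ℝ)) ≠ 0 := by
        have : (k j : ℝ) ≠ 0 := by exact_mod_cast hj
        have := Real.pi_ne_zero
        positivity
      simpa using this
    exact (mul_eq_zero.1 h).resolve_left hne

/-- The Haar probability measure of the torus. -/
abbrev torusVol {d : ℕ} : Measure (UnitAddTorus (Fin d)) :=
  @volume _ (@MeasureSpace.pi (Fin d) _ (fun _ => UnitAddCircle)
    fun _ => instMeasureSpaceUnitAddCircle)

/-- A square-integrable function on the cell whose Fourier coefficients vanish is zero. -/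
theorem ae_eq_zero_of_fourier_cellY {d : ℕ} {f : RSpace d → ℂ} (hf : MemLp f 2 (volY d))
    (h : ∀ k : Fin d → ℤ, ∫ y in cellY d, planeWave (-((2 * Real.pi) • intVec k)) y * f y = 0) :
    f =ᵐ[volY d] 0 := by
  -- `r` sends a point of the torus to its representative in `(0,1]^d`. It preserves the measure, so
  -- completeness of the characters on the torus can be transported to the cell.
  set r : UnitAddTorus (Fin d) → RSpace d := fun t =>
    WithLp.toLp 2 ((UnitAddTorus.measurableEquivPiIoc (0 : Fin d → ℝ) t : Fin d → ℝ)) with hr_def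
  have hset : {x : Fin d → ℝ | ∀ i, x i ∈ Set.Ioc ((0 : Fin d → ℝ) i) ((0 : Fin d → ℝ) i + 1)}
      = Set.univ.pi fun _ => Set.Ioc (0 : ℝ) 1 := by
    ext x; simp [Set.mem_pi]
  have hr : MeasurePreserving r torusVol (volY d) := by
    have h1 := UnitAddTorus.measurePreserving_equivPiIoc (0 : Fin d → ℝ)
    have h2 := measurePreserving_subtype_coe (μa := (volume : Measure (Fin d → ℝ)))
      (MeasurableSet.univ_pi' (fun i => measurableSet_Ioc (a := (0 : Fin d → ℝ) i)
        (b := (0 : Fin d → ℝ) i + 1)))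
    have h3 := measurePreserving_toLp_cell d
      (s := {x : Fin d → ℝ | ∀ i, x i ∈ Set.Ioc ((0 : Fin d → ℝ) i) ((0 : Fin d → ℝ) i + 1)}) (by
        rw [hset]
        exact Measure.univ_pi_Ioc_ae_eq_Icc (μ := fun _ : Fin d => (volume : Measure ℝ))
          (f := 0) (g := 1))
    exact h3.comp (h2.comp h1)
  have hF : MemLp (f ∘ r) 2 torusVol := hf.comp_measurePreserving hr
  have hcoef : ∀ k : Fin d → ℤ, UnitAddTorus.mFourierCoeff (f ∘ r) k = 0 := by
    intro k
    rw [← h k]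
    have hm : AEStronglyMeasurable
        (fun y => planeWave (-((2 * Real.pi) • intVec k)) y * f y) (volY d) :=
      (continuous_planeWave _).aestronglyMeasurable.mul hf.aestronglyMeasurable
    have h1 := integral_map (φ := r) (μ := torusVol) hr.aemeasurable (hr.map_eq.symm ▸ hm)
    rw [hr.map_eq] at h1
    rw [h1, UnitAddTorus.mFourierCoeff]
    refine integral_congr_ae (Filter.Eventually.of_forall fun t => ?_)
    simp only [Function.comp_apply, smul_eq_mul]
    congr 1
    have ht : ∀ i, t i = ((r t i : ℝ) : UnitAddCircle) := by
      intro i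
      have := congrFun ((UnitAddTorus.measurableEquivPiIoc (0 : Fin d → ℝ)).symm_apply_apply t) i
      rw [UnitAddTorus.coe_symm_measurableEquivPiIoc_apply] at this
      exact this.symm
    rw [UnitAddTorus.mFourier, ContinuousMap.coe_mk, planeWave, PiLp.inner_apply]
    simp_rw [ht]
    simp only [fourier_coe_apply]
    rw [← Complex.exp_sum]
    congr 1
    push_cast
    rw [Finset.mul_sum]
    refine Finset.sum_congr rfl fun i _ => ?_
    simp [intVec]
    ring
  have hz : hF.toLp (f ∘ r) = 0 := by
    have := UnitAddTorus.hasSum_mFourier_series_L2 (hF.toLp (f ∘ r))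
    have e : ∀ k, UnitAddTorus.mFourierCoeff (hF.toLp (f ∘ r)) k = 0 := by
      intro k
      rw [← hcoef k]
      refine integral_congr_ae ?_
      filter_upwards [hF.coeFn_toLp] with t ht
      rw [ht]
    simp_rw [e, zero_smul] at this
    exact this.unique hasSum_zero
  have hn : eLpNorm f 2 (volY d) = 0 := by
    rw [← eLpNorm_comp_measurePreserving hf.aestronglyMeasurable hr,
      eLpNorm_eq_zero_iff hF.aestronglyMeasurable (by norm_num)]
    rw [← MemLp.toLp_eq_toLp_iff hF MemLp.zero] 
    rw [hz]; rfl
  exact (eLpNorm_eq_zero_iff hf.aestronglyMeasurable (by norm_num)).1 hn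

end Cell

/-! ### Plane waves in `L²(Y)` -/

section Waves

variable {ι : Type} [Fintype ι] {d : ℕ}

theorem memLp_wave (θ : RSpace d) (v : EuclideanSpace ℂ ι) :
    MemLp (fun y => planeWave θ y • v) 2 (volY d) := by
  refine MemLp.of_bound ((continuous_planeWave θ).smul continuous_const).aestronglyMeasurable ‖v‖
    (Filter.Eventually.of_forall fun y => ?_)
  rw [norm_smul, norm_planeWave, one_mul]

/-- The plane wave `y ↦ e^{i ⟨θ, y⟩} v` as an element of `L²(Y)`. -/
def waveLp (θ : RSpace d) (v : EuclideanSpace ℂ ι) : Lp (EuclideanSpace ℂ ι) 2 (volY d) :=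
  (memLp_wave θ v).toLp _

theorem waveLp_coeFn (θ : RSpace d) (v : EuclideanSpace ℂ ι) :
    waveLp θ v =ᵐ[volY d] fun y => planeWave θ y • v := (memLp_wave θ v).coeFn_toLp

theorem inner_waveLp (θ : RSpace d) (v : EuclideanSpace ℂ ι)
    (u : Lp (EuclideanSpace ℂ ι) 2 (volY d)) :
    inner ℂ (waveLp θ v) u = ∫ y in cellY d, planeWave (-θ) y * inner ℂ v (u y) := by
  rw [L2.inner_def]
  refine integral_congr_ae ?_
  filter_upwards [waveLp_coeFn θ v] with y hy
  rw [hy, inner_smul_left, planeWave_neg_left]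

theorem inner_waveLp_waveLp (θ η : RSpace d) (v w : EuclideanSpace ℂ ι) :
    inner ℂ (waveLp θ v) (waveLp η w) = (∫ y in cellY d, planeWave (η - θ) y) * inner ℂ v w := by
  rw [inner_waveLp, ← integral_mul_const]
  refine integral_congr_ae ?_
  filter_upwards [waveLp_coeFn η w] with y hy
  rw [hy, inner_smul_right, ← mul_assoc, ← planeWave_add_left, neg_add_eq_sub]

theorem inner_waveLp_self (θ : RSpace d) (v w : EuclideanSpace ℂ ι) :
    inner ℂ (waveLp θ v) (waveLp θ w) = inner ℂ v w := by
  rw [inner_waveLp_waveLp]; simp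

/-- The embedding `v ↦ e^{i ⟨θ, ·⟩} v` of the constants. -/
def waveEmb (θ : RSpace d) : EuclideanSpace ℂ ι →ₗᵢ[ℂ] Lp (EuclideanSpace ℂ ι) 2 (volY d) where
  toFun := waveLp θ
  map_add' v w := by
    rw [waveLp, waveLp, waveLp, ← MemLp.toLp_add]
    congr 1; ext1 y; simp
  map_smul' c v := by
    rw [waveLp, waveLp, RingHom.id_apply, ← MemLp.toLp_const_smul]
    congr 1; ext1 y; simp [smul_comm c]
  norm_map' v := by
    rw [@norm_eq_sqrt_re_inner ℂ, @norm_eq_sqrt_re_inner ℂ _ _ _ _ v]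
    exact congrArg (fun z => Real.sqrt (RCLike.re z)) (inner_waveLp_self θ v v)

@[simp] theorem waveEmb_apply (θ : RSpace d) (v : EuclideanSpace ℂ ι) :
    waveEmb θ v = waveLp θ v := rfl

theorem freq_sub_freq (θ : RSpace d) (k l : Fin d → ℤ) :
    freq θ l - freq θ k = (2 * Real.pi) • intVec (l - k) := by
  ext i; simp [freq, intVec]; ring

theorem orthonormal_wave [DecidableEq ι] (θ : RSpace d) :
    Orthonormal ℂ fun p : (Fin d → ℤ) × ι =>
      waveLp (freq θ p.1) (EuclideanSpace.single p.2 (1 : ℂ)) := by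
  classical
  rw [orthonormal_iff_ite]
  rintro ⟨k, i⟩ ⟨l, j⟩
  rw [inner_waveLp_waveLp, freq_sub_freq, integral_cellY_planeWave_two_pi]
  simp only [sub_eq_zero, Prod.mk.injEq, EuclideanSpace.inner_single_left, map_one, one_mul,
    PiLp.single_apply]
  by_cases h1 : l = k <;> by_cases h2 : i = j <;> simp [h1, h2]
  exact fun h => absurd h.symm h1

/-- An element of `L²(Y)` that is orthogonal to all plane waves `e^{i ⟨θ + 2πk, ·⟩}` is zero. -/
theorem eq_zero_of_inner_wave [DecidableEq ι] (θ : RSpace d)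
    (u : Lp (EuclideanSpace ℂ ι) 2 (volY d))
    (h : ∀ k i, inner ℂ (waveLp (freq θ k) (EuclideanSpace.single i (1 : ℂ))) u = 0) : u = 0 := by
  have key : ∀ i, ∀ᵐ y ∂volY d, u y i = 0 := by
    intro i
    -- Multiplication by `e^{-iθ·y}` reduces quasi-momentum `θ` to the periodic case.
    have hm : MemLp (fun y => planeWave (-θ) y * u y i) 2 (volY d) := by
      have h1 : MemLp (fun y => u y i) 2 (volY d) :=
        (EuclideanSpace.proj (𝕜 := ℂ) i).comp_memLp' (Lp.memLp u)
      refine h1.of_le ((continuous_planeWave _).aestronglyMeasurable.mul h1.aestronglyMeasurable) ?_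
      filter_upwards with y
      rw [norm_mul, norm_planeWave, one_mul]
    have := ae_eq_zero_of_fourier_cellY hm fun k => by
      rw [← h k i, inner_waveLp]
      refine integral_congr_ae (Filter.Eventually.of_forall fun y => ?_)
      simp only [EuclideanSpace.inner_single_left, map_one, one_mul]
      rw [← mul_assoc, ← planeWave_add_left]
      congr 2
      rw [freq]; abel
    filter_upwards [this] with y hy
    have h0 := norm_planeWave (-θ) y
    have : planeWave (-θ) y ≠ 0 := by intro h; rw [h] at h0; simp at h0
    exact (mul_eq_zero.1 hy).resolve_left this
  refine (Lp.eq_zero_iff_ae_eq_zero).2 ?_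
  filter_upwards [ae_all_iff.2 key] with y hy
  ext i
  exact hy i

/-- The Hilbert basis of plane waves with quasi-momentum `θ`. -/
def waveBasis [DecidableEq ι] (θ : RSpace d) :
    HilbertBasis ((Fin d → ℤ) × ι) ℂ (Lp (EuclideanSpace ℂ ι) 2 (volY d)) :=
  HilbertBasis.mkOfOrthogonalEqBot (orthonormal_wave θ) (by
    rw [Submodule.eq_bot_iff]
    intro u hu
    exact eq_zero_of_inner_wave θ u fun k i => hu _ (Submodule.subset_span ⟨(k, i), rfl⟩))

theorem waveBasis_apply [DecidableEq ι] (θ : RSpace d) (p : (Fin d → ℤ) × ι) :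
    waveBasis θ p = waveLp (freq θ p.1) (EuclideanSpace.single p.2 (1 : ℂ)) := by
  rw [waveBasis, HilbertBasis.coe_mkOfOrthogonalEqBot]

end Waves

/-! ### Columns of tensor fields -/

section Columns

variable {n d : ℕ}

/-- The `j`-th column of a tensor. -/
def colCLM (n : ℕ) {d : ℕ} (j : Fin d) : Ten n d →L[ℂ] Vec n :=
  LinearMap.toContinuousLinearMap
    { toFun := fun X => WithLp.toLp 2 fun i => X (i, j)
      map_add' := fun _ _ => rfl
      map_smul' := fun _ _ => rfl }

/-- The tensor with given `j`-th column and zeros elsewhere. -/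
def insCLM (n : ℕ) {d : ℕ} (j : Fin d) : Vec n →L[ℂ] Ten n d :=
  LinearMap.toContinuousLinearMap
    { toFun := fun v => WithLp.toLp 2 fun p => if p.2 = j then v p.1 else 0
      map_add' := fun v w => by ext p; by_cases h : p.2 = j <;> simp [h]
      map_smul' := fun c v => by ext p; by_cases h : p.2 = j <;> simp [h] }

@[simp] theorem colCLM_apply (j : Fin d) (X : Ten n d) (i : Fin n) : colCLM n j X i = X (i, j) :=
  rfl

@[simp] theorem insCLM_apply (j : Fin d) (v : Vec n) (p : Fin n × Fin d) :
    insCLM n j v p = if p.2 = j then v p.1 else 0 := rfl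

theorem colCLM_insCLM (j l : Fin d) (v : Vec n) :
    colCLM n j (insCLM n l v) = if j = l then v else 0 := by
  ext i
  by_cases h : j = l <;> simp [h]

theorem inner_eq_sum_colCLM (X Y : Ten n d) :
    inner ℂ X Y = ∑ j, inner ℂ (colCLM n j X) (colCLM n j Y) := by
  simp only [PiLp.inner_apply, Fintype.sum_prod_type, colCLM_apply]
  exact Finset.sum_comm

variable (n) in
/-- The `j`-th column of a tensor field. -/
def col (μ : Measure (RSpace d)) (j : Fin d) : Lp (Ten n d) 2 μ →L[ℂ] Lp (Vec n) 2 μ :=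
  (colCLM n j).compLpL 2 μ

variable (n) in
/-- The tensor field with given `j`-th column and zeros elsewhere. -/
def ins (μ : Measure (RSpace d)) (j : Fin d) : Lp (Vec n) 2 μ →L[ℂ] Lp (Ten n d) 2 μ :=
  (insCLM n j).compLpL 2 μ

theorem col_coeFn (μ : Measure (RSpace d)) (j : Fin d) (g : Lp (Ten n d) 2 μ) :
    col n μ j g =ᵐ[μ] fun y => colCLM n j (g y) := ContinuousLinearMap.coeFn_compLpL _ _

theorem ins_coeFn (μ : Measure (RSpace d)) (j : Fin d) (u : Lp (Vec n) 2 μ) :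
    ins n μ j u =ᵐ[μ] fun y => insCLM n j (u y) := ContinuousLinearMap.coeFn_compLpL _ _

theorem col_ins (μ : Measure (RSpace d)) (j l : Fin d) (u : Lp (Vec n) 2 μ) :
    col n μ j (ins n μ l u) = if j = l then u else 0 := by
  refine Lp.ext ?_
  have h0 : (if j = l then u else 0 : Lp (Vec n) 2 μ) =ᵐ[μ] fun y => if j = l then u y else 0 := by
    split_ifs
    · rfl
    · exact Lp.coeFn_zero _ _ _
  filter_upwards [col_coeFn μ j (ins n μ l u), ins_coeFn μ l u, h0] with y h1 h2 h3
  rw [h1, h2, h3, colCLM_insCLM]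

/-- Splitting into columns lets every partial derivative be treated as a vector field. The measure
is arbitrary since this is used on both `Y` and `ℝ^d`. -/
theorem inner_eq_sum_col (μ : Measure (RSpace d)) (g h : Lp (Ten n d) 2 μ) :
    inner ℂ g h = ∑ j, inner ℂ (col n μ j g) (col n μ j h) := by
  simp_rw [L2.inner_def]
  rw [← integral_finsetSum _ fun j _ => L2.integrable_inner (𝕜 := ℂ) _ _]
  refine integral_congr_ae ?_
  filter_upwards [ae_all_iff.2 fun j => col_coeFn μ j g, ae_all_iff.2 fun j => col_coeFn μ j h]
    with y h1 h2
  rw [inner_eq_sum_colCLM]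
  simp_rw [h1, h2]

theorem norm_sq_eq_sum_col (μ : Measure (RSpace d)) (g : Lp (Ten n d) 2 μ) :
    ‖g‖ ^ 2 = ∑ j, ‖col n μ j g‖ ^ 2 := by
  have h := congrArg Complex.re (inner_eq_sum_col μ g g)
  rw [Complex.re_sum] at h
  rw [@norm_sq_eq_re_inner ℂ]
  simp_rw [@norm_sq_eq_re_inner ℂ _ _ _ _ (col n μ _ g)]
  exact h

theorem ten_ext {μ : Measure (RSpace d)} {g h : Lp (Ten n d) 2 μ}
    (H : ∀ j, col n μ j g = col n μ j h) : g = h := by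
  rw [← sub_eq_zero, ← norm_eq_zero, ← sq_eq_zero_iff, norm_sq_eq_sum_col]
  refine Finset.sum_eq_zero fun j _ => ?_
  rw [map_sub, H, sub_self, norm_zero]
  simp

theorem sum_ins_col (μ : Measure (RSpace d)) (g : Lp (Ten n d) 2 μ) :
    ∑ j, ins n μ j (col n μ j g) = g := by
  refine ten_ext fun l => ?_
  rw [map_sum]
  simp [col_ins]

theorem col_waveLp (θ : RSpace d) (ξ : Ten n d) (j : Fin d) :
    col n (volY d) j (waveLp θ ξ) = waveLp θ (colCLM n j ξ) := by
  refine Lp.ext ?_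
  filter_upwards [col_coeFn (volY d) j (waveLp θ ξ), waveLp_coeFn θ ξ,
    waveLp_coeFn θ (colCLM n j ξ)] with y h1 h2 h3
  rw [h1, h2, h3, map_smul]

end Columns

/-! ### Fourier description of the quasi-periodic gradient -/

section GradTheta

variable {n d : ℕ}

/-- The tensor `v ⊗ iζ`, the gradient of `e^{i ⟨ζ, ·⟩} v` up to the phase. -/
def tensI (ζ : RSpace d) (v : Vec n) : Ten n d :=
  WithLp.toLp 2 fun p => Complex.I * ζ p.2 * v p.1

theorem colCLM_tensI (ζ : RSpace d) (v : Vec n) (j : Fin d) :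
    colCLM n j (tensI ζ v) = (Complex.I * ζ j) • v := by
  ext i; simp [tensI]

theorem fderiv_wave (ζ y : RSpace d) (v : Vec n) (j : Fin d) :
    fderiv ℝ (fun y => planeWave ζ y • v) y (basisVec j)
      = (Complex.I * ζ j * planeWave ζ y) • v := by
  have h := ((contDiff_planeWave (n := 1) ζ).differentiable one_ne_zero y).hasFDerivAt.smul_const v
  rw [h.fderiv, ContinuousLinearMap.smulRight_apply, fderiv_planeWave]

/-- A shift of the frequency by `2πk` is invisible on the lattice, so all waves with frequency `θ +
2πk` have quasi-momentum `θ`. -/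
theorem wave_mem_smoothGraph (θ : RSpace d) (k : Fin d → ℤ) (v : Vec n) :
    (waveLp (freq θ k) v, waveLp (freq θ k) (tensI (freq θ k) v)) ∈ smoothGraph n θ := by
  refine ⟨fun y => planeWave (freq θ k) y • v,
    ⟨(contDiff_planeWave _).smul contDiff_const, fun m y => ?_⟩, waveLp_coeFn _ _, ?_⟩
  · simp only [planeWave_add_right, planeWave_freq_intVec, smul_smul, mul_comm]
  · filter_upwards [waveLp_coeFn (freq θ k) (tensI (freq θ k) v)] with y hy i j
    change (waveLp (freq θ k) (tensI (freq θ k) v) : L2YTen n d) y (i, j) = _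
    rw [hy, fderiv_wave]
    simp [tensI]
    ring

theorem isClosed_gradThetaGraph (θ : RSpace d) :
    IsClosed (gradThetaGraph n θ : Set (L2Y n d × L2YTen n d)) :=
  Submodule.isClosed_topologicalClosure _

/-- The function `e^{-iζ·y}⟨v, φ(y)⟩` is genuinely periodic, because the phases of the wave and of
`φ` cancel on lattice vectors. Its derivatives therefore integrate to zero over the cell, which is
the claimed integration by parts. -/
theorem inner_wave_col_of_smooth (θ : RSpace d) {u : L2Y n d} {g : L2YTen n d}
    (h : (u, g) ∈ smoothGraph n θ) (k : Fin d → ℤ) (v : Vec n) (j : Fin d) :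
    inner ℂ (waveLp (freq θ k) v) (col n (volY d) j g)
      = Complex.I * freq θ k j * inner ℂ (waveLp (freq θ k) v) u := by
  obtain ⟨φ, ⟨hs, hq⟩, hu, hg⟩ := h
  simp only at hu hg
  set ζ := freq θ k with hζ
  set L : Vec n →L[ℝ] ℂ := (innerSL ℂ v).restrictScalars ℝ with hL
  have hLa : ∀ w, L w = inner ℂ v w := fun w => rfl
  set ψ : RSpace d → ℂ := fun y => planeWave (-ζ) y * L (φ y) with hψ
  have hLφ : ContDiff ℝ 1 fun y => L (φ y) := L.contDiff.comp (hs.of_le (by exact_mod_cast le_top))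
  have hψd : ContDiff ℝ 1 ψ := (contDiff_planeWave _).mul hLφ
  have hφd : ∀ y, HasFDerivAt φ (fderiv ℝ φ y) y :=
    fun y => (hs.differentiable (by simp) y).hasFDerivAt
  have hfd : ∀ y, fderiv ℝ ψ y (basisVec j)
      = -(Complex.I * ζ j) * (planeWave (-ζ) y * inner ℂ v (φ y))
        + planeWave (-ζ) y * inner ℂ v (fderiv ℝ φ y (basisVec j)) := by
    intro y
    have h1 := ((contDiff_planeWave (n := 1) (-ζ)).differentiable one_ne_zero y).hasFDerivAt.mul
      (L.hasFDerivAt.comp y (hφd y))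
    have h2 : fderiv ℝ ψ y = _ := h1.fderiv
    rw [h2]
    simp [fderiv_planeWave, hLa]
    ring
  have h0 := integral_cellY_fderiv_periodic hψd (fun m y => by
    simp only [hψ, hq, planeWave_add_right, hLa, inner_smul_right]
    have : planeWave (-ζ) (intVec m) * planeWave θ (intVec m) = 1 := by
      rw [← planeWave_freq_intVec θ k m, mul_comm]
      exact planeWave_mul_neg _ _
    linear_combination (planeWave (-ζ) y * inner ℂ v (φ y)) * this) j
  have hi1 : inner ℂ (waveLp ζ v) u = ∫ y in cellY d, planeWave (-ζ) y * inner ℂ v (φ y) := by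
    rw [inner_waveLp]
    refine integral_congr_ae ?_
    filter_upwards [hu] with y hy
    rw [hy]
  have hi2 : inner ℂ (waveLp ζ v) (col n (volY d) j g)
      = ∫ y in cellY d, planeWave (-ζ) y * inner ℂ v (fderiv ℝ φ y (basisVec j)) := by
    rw [inner_waveLp]
    refine integral_congr_ae ?_
    filter_upwards [hg, col_coeFn (volY d) j g] with y hy hc
    have : (col n (volY d) j g : L2Y n d) y = fderiv ℝ φ y (basisVec j) := by
      rw [hc]; ext i; exact hy i j
    rw [this]
  have int1 : Integrable (fun y => planeWave (-ζ) y * inner ℂ v (φ y)) (volY d) := by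
    have := L2.integrable_inner (𝕜 := ℂ) (waveLp ζ v) u
    refine this.congr ?_
    filter_upwards [hu, waveLp_coeFn ζ v] with y hy h'
    rw [hy, h', inner_smul_left, planeWave_neg_left]
  have int2 : Integrable (fun y => planeWave (-ζ) y * inner ℂ v (fderiv ℝ φ y (basisVec j)))
      (volY d) := by
    have := L2.integrable_inner (𝕜 := ℂ) (waveLp ζ v) (col n (volY d) j g)
    refine this.congr ?_
    filter_upwards [hg, col_coeFn (volY d) j g, waveLp_coeFn ζ v] with y hy hc h'
    have : (col n (volY d) j g : L2Y n d) y = fderiv ℝ φ y (basisVec j) := by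
      rw [hc]; ext i; exact hy i j
    rw [this, h', inner_smul_left, planeWave_neg_left]
  simp_rw [hfd] at h0
  rw [integral_add (int1.const_mul _) int2, integral_const_mul, ← hi1, ← hi2] at h0
  linear_combination h0

theorem inner_eq_mul_of_mem_closure {H K L : Type*} [NormedAddCommGroup H]
    [InnerProductSpace ℂ H] [NormedAddCommGroup K] [InnerProductSpace ℂ K] [NormedAddCommGroup L]
    [InnerProductSpace ℂ L] {p : Submodule ℂ (H × K)} {w : H} {w' : L} {T : K →L[ℂ] L} {c : ℂ}
    (h : ∀ x ∈ p, inner ℂ w' (T x.2) = c * inner ℂ w x.1) {x : H × K}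
    (hx : x ∈ p.topologicalClosure) : inner ℂ w' (T x.2) = c * inner ℂ w x.1 := by
  have hcl : IsClosed {x : H × K | inner ℂ w' (T x.2) = c * inner ℂ w x.1} :=
    isClosed_eq (by fun_prop) (by fun_prop)
  exact closure_minimal (s := (p : Set (H × K))) h hcl hx

/-- `(u, g)` belongs to the graph of `grad_θ` iff the Fourier coefficients satisfy
`ĝ = û ⊗ i(θ + 2πk)`. -/
theorem mem_gradThetaGraph_iff (θ : RSpace d) (u : L2Y n d) (g : L2YTen n d) :
    (u, g) ∈ gradThetaGraph n θ ↔ ∀ (k : Fin d → ℤ) (v : Vec n) (j : Fin d),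
      inner ℂ (waveLp (freq θ k) v) (col n (volY d) j g)
        = Complex.I * freq θ k j * inner ℂ (waveLp (freq θ k) v) u := by
  constructor
  · intro h k v j
    have hs : ∀ x ∈ smoothGraph n θ, inner ℂ (waveLp (freq θ k) v) (col n (volY d) j x.2)
        = Complex.I * freq θ k j * inner ℂ (waveLp (freq θ k) v) x.1 :=
      fun p hp => inner_wave_col_of_smooth θ hp k v j
    have hx : (u, g) ∈ (smoothGraph n θ).topologicalClosure := h
    exact inner_eq_mul_of_mem_closure (p := smoothGraph n θ) (x := (u, g)) hs hx
  · intro h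
    -- For the converse, expand `u` and `g` in plane waves with common coefficients. The partial
    -- sums are pairs in the smooth graph, and the closed graph contains their limit.
    set b := waveBasis (ι := Fin n) θ with hb
    have hb' : ∀ p, b p = waveLp (freq θ p.1) (EuclideanSpace.single p.2 (1 : ℂ)) :=
      waveBasis_apply θ
    have hu : HasSum (fun p => b.repr u p • b p) u := b.hasSum_repr u
    have hg : HasSum (fun p => b.repr u p •
        waveLp (freq θ p.1) (tensI (freq θ p.1) (EuclideanSpace.single p.2 (1 : ℂ)))) g := by
      have h1 : ∀ j, HasSum (fun p => ins n (volY d) j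
          ((Complex.I * freq θ p.1 j * b.repr u p) • b p))
          (ins n (volY d) j (col n (volY d) j g)) := by
        intro j
        refine ContinuousLinearMap.hasSum (ins n (volY d) j) ?_
        have := b.hasSum_repr (col n (volY d) j g)
        refine this.congr_fun ?_ |> fun h => h
        intro p
        rw [b.repr_apply_apply, b.repr_apply_apply, hb', h]
      have h2 := hasSum_sum fun j (_ : j ∈ Finset.univ) => h1 j
      rw [sum_ins_col] at h2
      refine h2.congr_fun ?_ |> fun h => h
      intro p
      refine ten_ext fun l => ?_
      rw [map_smul, col_waveLp, colCLM_tensI, map_sum]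
      simp only [col_ins, Finset.sum_ite_eq, Finset.mem_univ, if_true]
      rw [hb', ← waveEmb_apply, ← waveEmb_apply, map_smul, smul_smul]
      congr 1
      ring
    have hsum := hu.prodMk hg
    refine (isClosed_gradThetaGraph θ).mem_of_tendsto hsum
      (Filter.Eventually.of_forall fun s => ?_)
    refine Submodule.sum_mem _ fun p _ => ?_
    rw [← Prod.smul_mk, hb']
    exact Submodule.smul_mem _ _
      (Submodule.le_topologicalClosure _ (wave_mem_smoothGraph θ p.1 _))

theorem wave_mem_gradThetaGraph (θ : RSpace d) (k : Fin d → ℤ) (v : Vec n) :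
    (waveLp (freq θ k) v, waveLp (freq θ k) (tensI (freq θ k) v)) ∈ gradThetaGraph n θ :=
  Submodule.le_topologicalClosure _ (wave_mem_smoothGraph θ k v)

theorem dense_gradTheta_domain (θ : RSpace d) : Dense ((gradTheta n θ).domain : Set (L2Y n d)) := by
  rw [Submodule.dense_iff_topologicalClosure_eq_top, ← Submodule.orthogonal_eq_bot_iff, 
    Submodule.orthogonal_closure, Submodule.eq_bot_iff]
  intro u hu
  refine eq_zero_of_inner_wave θ u fun k i => hu _ ?_
  have := wave_mem_gradThetaGraph θ k (EuclideanSpace.single i (1 : ℂ))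
  rw [← gradTheta_graph] at this
  exact LinearPMap.mem_domain_of_mem_graph this

/-- Integration by parts for quasi-periodic functions. -/
theorem inner_col_add_inner_col (θ : RSpace d) {u w : L2Y n d} {g q : L2YTen n d}
    (h : (u, g) ∈ gradThetaGraph n θ) (h' : (w, q) ∈ gradThetaGraph n θ) (j : Fin d) :
    inner ℂ (col n (volY d) j q) u + inner ℂ w (col n (volY d) j g) = 0 := by
  set b := waveBasis (ι := Fin n) θ with hb
  have hb' : ∀ p, b p = waveLp (freq θ p.1) (EuclideanSpace.single p.2 (1 : ℂ)) :=
    waveBasis_apply θ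
  rw [mem_gradThetaGraph_iff] at h h'
  have h1 := (b.hasSum_inner_mul_inner (col n (volY d) j q) u).add
    (b.hasSum_inner_mul_inner w (col n (volY d) j g))
  -- In Parseval's identity the terms cancel one by one: the multiplier `i(θ + 2πk)_j` is purely
  -- imaginary and appears once conjugated.
  refine h1.unique (hasSum_zero.congr_fun fun p => ?_)
  rw [← inner_conj_symm (col n (volY d) j q), ← inner_conj_symm w, hb', h, h']
  simp
  ring

theorem hasSum_norm_sq_waveBasis (θ : RSpace d) (u : L2Y n d) :
    HasSum (fun p : (Fin d → ℤ) × Fin n => ‖inner ℂ (waveBasis θ p) u‖ ^ 2) (‖u‖ ^ 2) := by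
  have h := (waveBasis (ι := Fin n) θ).hasSum_inner_mul_inner u u
  have h2 := Complex.reCLM.hasSum h
  rw [@norm_sq_eq_re_inner ℂ]
  refine h2.congr_fun fun p => ?_
  rw [← inner_conj_symm u, Complex.conj_mul']
  simp [← Complex.ofReal_pow]

/-- The Poincaré inequality on the orthogonal complement of `e^{i ⟨θ, ·⟩}`. -/
theorem norm_le_norm_grad {θ : RSpace d} (hθ : θ ∈ zoneΘ d) {u : L2Y n d} {g : L2YTen n d}
    (h : (u, g) ∈ gradThetaGraph n θ) (hu : ∀ v : Vec n, inner ℂ (waveLp θ v) u = 0) :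
    ‖u‖ ≤ ‖g‖ := by
  rw [mem_gradThetaGraph_iff] at h
  refine abs_le_of_sq_le_sq' ?_ (norm_nonneg _) |>.2
  rw [norm_sq_eq_sum_col]
  refine hasSum_le (fun p => ?_) (hasSum_norm_sq_waveBasis θ u)
    (hasSum_sum fun j _ => hasSum_norm_sq_waveBasis θ (col n (volY d) j g))
  obtain ⟨k, i⟩ := p
  rw [waveBasis_apply]
  simp only [h, norm_mul, Complex.norm_I, one_mul, mul_pow, Complex.norm_real, Real.norm_eq_abs,
    sq_abs]
  -- The inequality holds coefficient by coefficient: the mode `k = 0` is removed by the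
  -- orthogonality of `u`, and every other mode has a multiplier of modulus at least one.
  by_cases hk : k = 0
  · have : freq θ k = θ := by rw [hk, freq]; ext; simp [intVec]
    simp [this, hu]
  · obtain ⟨j, hj⟩ := Function.ne_iff.1 hk
    -- Since `|θ j| ≤ π` and `|2π k j| ≥ 2π`, this component is bounded away from zero uniformly in
    -- `θ`. Here the restriction to the Brillouin zone enters.
    have h1 : 1 ≤ freq θ k j ^ 2 := by
      rw [freq_apply]
      obtain ⟨l1, l2⟩ := hθ j
      have hp := Real.pi_gt_three
      rcases lt_or_gt_of_ne hj with hl | hl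
      · have : (k j : ℝ) ≤ -1 := by exact_mod_cast Int.le_sub_one_of_lt hl
        have h2 : θ j + 2 * Real.pi * k j ≤ -1 := by nlinarith
        nlinarith
      · have : (1 : ℝ) ≤ k j := by exact_mod_cast hl
        have h2 : 1 ≤ θ j + 2 * Real.pi * k j := by nlinarith
        nlinarith
    refine le_trans ?_ (Finset.single_le_sum (f := fun j => freq θ k j ^ 2 *
      ‖inner ℂ (waveLp (freq θ k) (EuclideanSpace.single i (1 : ℂ))) u‖ ^ 2)
      (fun _ _ => by positivity) (Finset.mem_univ j))
    exact le_mul_of_one_le_left (sq_nonneg _) h1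

/-- The gradient of a function orthogonal to `e^{i ⟨θ, ·⟩}` has vanishing mean against it. -/
theorem inner_wave_grad_eq_zero {θ : RSpace d} {u : L2Y n d} {g : L2YTen n d}
    (h : (u, g) ∈ gradThetaGraph n θ) (hu : ∀ v : Vec n, inner ℂ (waveLp θ v) u = 0)
    (ξ : Ten n d) : inner ℂ (waveLp θ ξ) g = 0 := by
  rw [mem_gradThetaGraph_iff] at h
  rw [inner_eq_sum_col]
  refine Finset.sum_eq_zero fun j _ => ?_
  have h1 := h 0 (colCLM n j ξ) j
  have : freq θ 0 = θ := by rw [freq]; ext; simp [intVec]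
  rw [this, hu, mul_zero] at h1
  rw [col_waveLp, h1]

end GradTheta

/-! ### Solution operators of coercive forms -/

section Forms

variable {V X K : Type*} [NormedAddCommGroup V] [InnerProductSpace ℂ V] [CompleteSpace V]
  [NormedAddCommGroup X] [InnerProductSpace ℂ X] [CompleteSpace X]
  [NormedAddCommGroup K] [InnerProductSpace ℂ K] [CompleteSpace K]

/-- The operator of the form `c ⟨A G v, G w⟩ + ⟨S J v, J w⟩`. -/
def formOp (c : ℂ) (G : V →L[ℂ] K) (J : V →L[ℂ] X) (A : K →L[ℂ] K) (S : X →L[ℂ] X) : V →L[ℂ] V :=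
  c • (adjoint G ∘L A ∘L G) + adjoint J ∘L S ∘L J

theorem inner_formOp (c : ℂ) (G : V →L[ℂ] K) (J : V →L[ℂ] X) (A : K →L[ℂ] K) (S : X →L[ℂ] X)
    (w v : V) : inner ℂ w (formOp c G J A S v)
      = c * inner ℂ (G w) (A (G v)) + inner ℂ (J w) (S (J v)) := by
  simp [formOp, adjoint_inner_right]

omit [CompleteSpace V] in
theorem inverse_apply_of_isUnit {B : V →L[ℂ] V} (h : IsUnit B) (v : V) :
    B (Ring.inverse B v) = v := by
  have := Ring.mul_inverse_cancel B h
  exact congrArg (fun T : V →L[ℂ] V => T v) this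

/-- Inversion is continuous at every unit. Continuity in `θ` of the correctors and fibre resolvents,
and through it the measurability of the direct integrals, comes from here. -/
theorem continuousOn_ringInverse {P : Type*} [TopologicalSpace P] {B : P → V →L[ℂ] V} {s : Set P}
    (hB : ContinuousOn B s) (hu : ∀ p ∈ s, IsUnit (B p)) :
    ContinuousOn (fun p => Ring.inverse (B p)) s := by
  intro p hp
  obtain ⟨x, hx⟩ := hu p hp
  have h := NormedRing.inverse_continuousAt x
  rw [hx] at h
  exact ContinuousAt.comp_continuousWithinAt h (hB p hp)

theorem ContinuousOn.formOp {P : Type*} [TopologicalSpace P] {s : Set P} (c : ℂ)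
    {G : P → V →L[ℂ] K} {A : P → K →L[ℂ] K} (hG : ContinuousOn G s) (hA : ContinuousOn A s)
    (J : V →L[ℂ] X) (S : X →L[ℂ] X) :
    ContinuousOn (fun p => formOp c (G p) J (A p) S) s := by
  have h1 : ContinuousOn (fun p => adjoint (G p)) s :=
    (LinearIsometryEquiv.continuous (adjoint (𝕜 := ℂ) (E := V) (F := K))).comp_continuousOn hG
  exact ((h1.clm_comp (hA.clm_comp hG)).const_smul c).add continuousOn_const

/-- The Hilbert space structure on a subspace of a product (with the graph norm). -/
def graphSpace (Γ : Submodule ℂ (X × K)) : Submodule ℂ (WithLp 2 (X × K)) :=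
  Γ.comap (WithLp.linearEquiv 2 ℂ (X × K)).toLinearMap

/-- The first component. -/
def graphFst (Γ : Submodule ℂ (X × K)) : graphSpace Γ →L[ℂ] X :=
  (WithLp.fstL 2 ℂ X K) ∘L (graphSpace Γ).subtypeL

/-- The second component. -/
def graphSnd (Γ : Submodule ℂ (X × K)) : graphSpace Γ →L[ℂ] K :=
  (WithLp.sndL 2 ℂ X K) ∘L (graphSpace Γ).subtypeL

theorem completeSpace_graphSpace {Γ : Submodule ℂ (X × K)} (h : IsClosed (Γ : Set (X × K))) :
    CompleteSpace (graphSpace Γ) := by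
  have : IsClosed (graphSpace Γ : Set (WithLp 2 (X × K))) :=
    h.preimage (WithLp.prod_continuous_ofLp 2 X K)
  exact this.completeSpace_coe

omit [CompleteSpace X] [CompleteSpace K] in
theorem norm_sq_graphSpace {Γ : Submodule ℂ (X × K)} (v : graphSpace Γ) :
    ‖v‖ ^ 2 = ‖graphFst Γ v‖ ^ 2 + ‖graphSnd Γ v‖ ^ 2 :=
  WithLp.prod_norm_sq_eq_of_L2 (v : WithLp 2 (X × K))

omit [CompleteSpace X] [CompleteSpace K] in
theorem mem_iff_exists_graphSpace {Γ : Submodule ℂ (X × K)} {u : X} {g : K} :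
    (u, g) ∈ Γ ↔ ∃ v, graphFst Γ v = u ∧ graphSnd Γ v = g :=
  ⟨fun h => ⟨⟨WithLp.toLp 2 (u, g), h⟩, rfl, rfl⟩, by rintro ⟨⟨v, hv⟩, rfl, rfl⟩; exact hv⟩

end Forms

/-! ### Multiplication by plane waves -/

section Phase

variable {ι : Type} [Fintype ι] {d n : ℕ}

theorem inner_mulOp_re_ge {α : Type} [MeasurableSpace α] {μ : Measure α}
    {a : α → (EuclideanSpace ℂ ι →L[ℂ] EuclideanSpace ℂ ι)} (ha : MemLp a ⊤ μ) {ν : ℝ}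
    (h : ∀ᵐ x ∂μ, ∀ X, ν * ‖X‖ ^ 2 ≤ (inner ℂ X (a x X)).re)
    (u : Lp (EuclideanSpace ℂ ι) 2 μ) : ν * ‖u‖ ^ 2 ≤ (inner ℂ u (mulOp μ a u)).re := by
  have e1 : ‖u‖ ^ 2 = ∫ x, ‖u x‖ ^ 2 ∂μ := by
    have h1 := congrArg Complex.re (L2.inner_def (𝕜 := ℂ) u u)
    rw [@norm_sq_eq_re_inner ℂ]
    refine h1.trans ?_
    have := integral_re (𝕜 := ℂ) (L2.integrable_inner (𝕜 := ℂ) u u)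
    rw [← RCLike.re_eq_complex_re, ← this]
    refine integral_congr_ae (Filter.Eventually.of_forall fun x => ?_)
    exact (norm_sq_eq_re_inner (𝕜 := ℂ) (u x)).symm
  have e2 : (inner ℂ u (mulOp μ a u)).re = ∫ x, (inner ℂ (u x) (a x (u x))).re ∂μ := by
    rw [L2.inner_def, ← RCLike.re_eq_complex_re,
      ← integral_re (𝕜 := ℂ) (L2.integrable_inner (𝕜 := ℂ) u (mulOp μ a u))]
    refine integral_congr_ae ?_
    filter_upwards [mulOp_coeFn ha u] with x hx
    rw [hx]
  rw [e1, e2, ← integral_const_mul]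
  refine integral_mono_ae ?_ ?_ ?_
  · exact (((memLp_two_iff_integrable_sq_norm (Lp.aestronglyMeasurable u)).1
      (Lp.memLp u))).const_mul ν
  · have := (L2.integrable_inner (𝕜 := ℂ) u (mulOp μ a u)).re
    refine this.congr ?_
    filter_upwards [mulOp_coeFn ha u] with x hx
    rw [hx]; rfl
  · filter_upwards [h] with x hx
    exact hx (u x)

theorem memLp_phase (θ : RSpace d) : MemLp (fun y : RSpace d => planeWave θ y •
    ContinuousLinearMap.id ℂ (EuclideanSpace ℂ ι)) ⊤ (volY d) := by
  refine memLp_top_of_bound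
    ((continuous_planeWave θ).smul continuous_const).aestronglyMeasurable
    ‖ContinuousLinearMap.id ℂ (EuclideanSpace ℂ ι)‖ (Filter.Eventually.of_forall fun y => ?_)
  rw [norm_smul, norm_planeWave, one_mul]

/-- Multiplication by `e^{i ⟨θ, ·⟩}`. -/
def phase (θ : RSpace d) :
    Lp (EuclideanSpace ℂ ι) 2 (volY d) →L[ℂ] Lp (EuclideanSpace ℂ ι) 2 (volY d) :=
  mulOp (volY d) fun y => planeWave θ y • ContinuousLinearMap.id ℂ (EuclideanSpace ℂ ι)

theorem phase_coeFn (θ : RSpace d) (u : Lp (EuclideanSpace ℂ ι) 2 (volY d)) :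
    phase θ u =ᵐ[volY d] fun y => planeWave θ y • u y := mulOp_coeFn (memLp_phase θ) u

theorem phase_phase (θ η : RSpace d) (u : Lp (EuclideanSpace ℂ ι) 2 (volY d)) :
    phase θ (phase η u) = phase (θ + η) u := by
  refine Lp.ext ?_
  filter_upwards [phase_coeFn θ (phase η u), phase_coeFn η u, phase_coeFn (θ + η) u]
    with y h1 h2 h3
  rw [h1, h2, h3, planeWave_add_left, mul_smul]

@[simp] theorem phase_zero (u : Lp (EuclideanSpace ℂ ι) 2 (volY d)) : phase 0 u = u := by
  refine Lp.ext ?_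
  filter_upwards [phase_coeFn 0 u] with y h1
  rw [h1, planeWave_zero_left, one_smul]

@[simp] theorem phase_phase_neg (θ : RSpace d) (u : Lp (EuclideanSpace ℂ ι) 2 (volY d)) :
    phase θ (phase (-θ) u) = u := by rw [phase_phase, add_neg_cancel, phase_zero]

@[simp] theorem phase_neg_phase (θ : RSpace d) (u : Lp (EuclideanSpace ℂ ι) 2 (volY d)) :
    phase (-θ) (phase θ u) = u := by rw [phase_phase, neg_add_cancel, phase_zero]

theorem inner_phase_left (θ : RSpace d) (u w : Lp (EuclideanSpace ℂ ι) 2 (volY d)) :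
    inner ℂ (phase θ u) w = inner ℂ u (phase (-θ) w) := by
  rw [L2.inner_def, L2.inner_def]
  refine integral_congr_ae ?_
  filter_upwards [phase_coeFn θ u, phase_coeFn (-θ) w] with y h1 h2
  rw [h1, h2, inner_smul_left, inner_smul_right, planeWave_neg_left]

theorem inner_phase_phase (θ : RSpace d) (u w : Lp (EuclideanSpace ℂ ι) 2 (volY d)) :
    inner ℂ (phase θ u) (phase θ w) = inner ℂ u w := by
  rw [inner_phase_left, phase_neg_phase]

theorem norm_phase_apply (θ : RSpace d) (u : Lp (EuclideanSpace ℂ ι) 2 (volY d)) :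
    ‖phase θ u‖ = ‖u‖ := by
  rw [@norm_eq_sqrt_re_inner ℂ, @norm_eq_sqrt_re_inner ℂ _ _ _ _ u, inner_phase_phase]

theorem phase_waveLp (θ η : RSpace d) (v : EuclideanSpace ℂ ι) :
    phase θ (waveLp η v) = waveLp (θ + η) v := by
  refine Lp.ext ?_
  filter_upwards [phase_coeFn θ (waveLp η v), waveLp_coeFn η v, waveLp_coeFn (θ + η) v]
    with y h1 h2 h3
  rw [h1, h2, h3, planeWave_add_left, mul_smul]

theorem phase_mulOp (θ : RSpace d) {a : RSpace d → (EuclideanSpace ℂ ι →L[ℂ] EuclideanSpace ℂ ι)}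
    (ha : MemLp a ⊤ (volY d)) (u : Lp (EuclideanSpace ℂ ι) 2 (volY d)) :
    mulOp (volY d) a (phase θ u) = phase θ (mulOp (volY d) a u) := by
  refine Lp.ext ?_
  filter_upwards [phase_coeFn θ (mulOp (volY d) a u), phase_coeFn θ u, mulOp_coeFn ha u,
    mulOp_coeFn ha (phase θ u)] with y h1 h2 h3 h4
  rw [h1, h3, h4, h2, map_smul]

theorem phase_compLpL {κ : Type} [Fintype κ] (θ : RSpace d)
    (A : EuclideanSpace ℂ ι →L[ℂ] EuclideanSpace ℂ κ) (u : Lp (EuclideanSpace ℂ ι) 2 (volY d)) :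
    A.compLpL 2 (volY d) (phase θ u) = phase θ (A.compLpL 2 (volY d) u) := by
  refine Lp.ext ?_
  filter_upwards [phase_coeFn θ (A.compLpL 2 (volY d) u), phase_coeFn θ u,
    coeFn_compLpL (p := 2) (μ := volY d) A u, coeFn_compLpL (p := 2) (μ := volY d) A (phase θ u)]
    with y h1 h2 h3 h4
  rw [h1, h3, h4, h2, map_smul]

theorem norm_planeWave_sub_le (θ η y : RSpace d) :
    ‖planeWave θ y - planeWave η y‖ ≤ ‖θ - η‖ * ‖y‖ := by
  have h : planeWave θ y - planeWave η y = planeWave η y * (planeWave (θ - η) y - 1) := by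
    rw [mul_sub, ← planeWave_add_left, mul_one, add_sub_cancel]
  rw [h, norm_mul, norm_planeWave, one_mul]
  exact (Real.norm_exp_I_mul_ofReal_sub_one_le).trans (norm_inner_le_norm (𝕜 := ℝ) _ _)

theorem norm_le_of_mem_cellY {y : RSpace d} (hy : y ∈ cellY d) : ‖y‖ ≤ Real.sqrt d := by
  rw [EuclideanSpace.norm_eq]
  refine Real.sqrt_le_sqrt ?_
  refine (Finset.sum_le_sum (g := fun _ => (1 : ℝ)) fun i _ => ?_).trans (by simp)
  obtain ⟨h1, h2⟩ := hy i
  rw [Real.norm_eq_abs, sq_abs]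
  nlinarith

/-- Norm continuity, and not just strong continuity, because the cell is bounded: the multipliers
differ by at most `|θ - η||y|`, and `|y| ≤ √d`. -/
theorem continuous_phase : Continuous (phase : RSpace d →
    Lp (EuclideanSpace ℂ ι) 2 (volY d) →L[ℂ] Lp (EuclideanSpace ℂ ι) 2 (volY d)) := by
  refine LipschitzWith.continuous (K := (Real.sqrt d).toNNReal) (LipschitzWith.of_dist_le_mul
    fun θ η => ?_)
  rw [dist_eq_norm, dist_eq_norm, Real.coe_toNNReal _ (Real.sqrt_nonneg _)]
  refine ContinuousLinearMap.opNorm_le_bound _ (by positivity) fun u => ?_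
  refine Lp.norm_le_mul_norm_of_ae_le_mul ?_
  rw [sub_apply]
  filter_upwards [phase_coeFn θ u, phase_coeFn η u, Lp.coeFn_sub (phase θ u) (phase η u),
    ae_restrict_mem (isOpen_cellY d).measurableSet] with y h1 h2 h3 hy
  rw [h3, Pi.sub_apply, h1, h2, ← sub_smul, norm_smul]
  refine mul_le_mul_of_nonneg_right ((norm_planeWave_sub_le θ η y).trans ?_) (norm_nonneg _)
  rw [mul_comm]
  exact mul_le_mul_of_nonneg_right (norm_le_of_mem_cellY hy) (norm_nonneg _)

variable (n) in
/-- The operator `u ↦ u ⊗ iθ`. -/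
def tensOp (θ : RSpace d) : L2Y n d →L[ℂ] L2YTen n d :=
  ∑ j, (Complex.I * θ j) • ins n (volY d) j

theorem col_tensOp (θ : RSpace d) (j : Fin d) (u : L2Y n d) :
    col n (volY d) j (tensOp n θ u) = (Complex.I * θ j) • u := by
  simp [tensOp, map_sum, col_ins]

theorem tensOp_neg (θ : RSpace d) (u : L2Y n d) : tensOp n (-θ) u = -tensOp n θ u := by
  refine ten_ext fun j => ?_
  rw [map_neg, col_tensOp, col_tensOp]
  simp

theorem continuous_tensOp : Continuous (tensOp n : RSpace d → L2Y n d →L[ℂ] L2YTen n d) := by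
  unfold tensOp
  refine continuous_finsetSum _ fun j _ => ?_
  have h : Continuous fun θ : RSpace d => Complex.I * (θ j : ℂ) :=
    continuous_const.mul (Complex.continuous_ofReal.comp (by fun_prop))
  exact h.smul continuous_const

theorem freq_add (θ η : RSpace d) (k : Fin d → ℤ) : freq (θ + η) k = θ + freq η k := by
  rw [freq, freq, add_assoc]

/-- On the Fourier side, multiplication by `e^{iθ·y}` translates all frequencies by `θ`, which adds
`iθ` to the gradient. -/
theorem phase_mem_gradThetaGraph (θ η : RSpace d) {u : L2Y n d} {g : L2YTen n d}
    (h : (u, g) ∈ gradThetaGraph n η) :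
    (phase θ u, phase θ (g + tensOp n θ u)) ∈ gradThetaGraph n (θ + η) := by
  rw [mem_gradThetaGraph_iff] at h ⊢
  intro k v j
  rw [freq_add, ← phase_waveLp, inner_phase_phase, col, phase_compLpL, inner_phase_phase]
  change inner ℂ _ (col n (volY d) j (g + tensOp n θ u)) = _
  rw [map_add, col_tensOp, inner_add_right, h, inner_smul_right]
  simp
  ring

end Phase

/-! ### The periodic Sobolev space as a Hilbert space -/

section PerSpace

variable {n d : ℕ}

/-- The Hilbert space of periodic `H¹` functions, realised as the graph of `grad_0`. -/
def PerSpace (n d : ℕ) : Type := graphSpace (gradThetaGraph n (0 : RSpace d))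

instance (n d : ℕ) : NormedAddCommGroup (PerSpace n d) :=
  inferInstanceAs (NormedAddCommGroup (graphSpace (gradThetaGraph n (0 : RSpace d))))

instance (n d : ℕ) : InnerProductSpace ℂ (PerSpace n d) :=
  inferInstanceAs (InnerProductSpace ℂ (graphSpace (gradThetaGraph n (0 : RSpace d))))

instance (n d : ℕ) : CompleteSpace (PerSpace n d) :=
  completeSpace_graphSpace (isClosed_gradThetaGraph (0 : RSpace d))

/-- The embedding into `L²(Y)`. -/
def perVal (n d : ℕ) : PerSpace n d →L[ℂ] L2Y n d :=
  graphFst (gradThetaGraph n (0 : RSpace d))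

/-- The gradient of periodic functions. -/
def perGradZero (n d : ℕ) : PerSpace n d →L[ℂ] L2YTen n d :=
  graphSnd (gradThetaGraph n (0 : RSpace d))

theorem mem_gradThetaGraph_zero_iff {n d : ℕ} {u : L2Y n d} {g : L2YTen n d} :
    (u, g) ∈ gradThetaGraph n 0 ↔ ∃ v, perVal n d v = u ∧ perGradZero n d v = g :=
  mem_iff_exists_graphSpace

theorem norm_sq_perSpace {n d : ℕ} (v : PerSpace n d) :
    ‖v‖ ^ 2 = ‖perVal n d v‖ ^ 2 + ‖perGradZero n d v‖ ^ 2 := norm_sq_graphSpace _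

/-- The shifted gradient `∇ + iθ`. -/
def perGrad (n : ℕ) {d : ℕ} (θ : RSpace d) : PerSpace n d →L[ℂ] L2YTen n d :=
  perGradZero n d + tensOp n θ ∘L perVal n d

theorem continuous_perGrad :
    Continuous (perGrad n : RSpace d → PerSpace n d →L[ℂ] L2YTen n d) :=
  continuous_const.add (continuous_tensOp.clm_comp continuous_const)

theorem mem_gradThetaGraph_of_perSpace (θ : RSpace d) (v : PerSpace n d) :
    (phase θ (perVal n d v), phase θ (perGrad n θ v)) ∈ gradThetaGraph n θ := by
  have h := phase_mem_gradThetaGraph θ 0 (mem_gradThetaGraph_zero_iff.2 ⟨v, rfl, rfl⟩)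
  rw [add_zero] at h
  exact h

/-- With `mem_gradThetaGraph_of_perSpace` this identifies all the spaces `H¹_θ` with the single
space `PerSpace`, so that the dependence on `θ` sits in the operator `∇ + iθ` alone. -/
theorem exists_perSpace_of_mem {θ : RSpace d} {u : L2Y n d} {g : L2YTen n d}
    (h : (u, g) ∈ gradThetaGraph n θ) :
    ∃ v : PerSpace n d, u = phase θ (perVal n d v) ∧ g = phase θ (perGrad n θ v) := by
  have h1 := phase_mem_gradThetaGraph (-θ) θ h
  rw [neg_add_cancel] at h1
  obtain ⟨v, hv1, hv2⟩ := mem_gradThetaGraph_zero_iff.1 h1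
  have e1 : perVal n d v = phase (-θ) u := hv1
  have e2 : perGrad n θ v = phase (-θ) g := by
    rw [perGrad, add_apply, hv2, ContinuousLinearMap.comp_apply, e1, tensOp_neg,
      map_add, map_neg, add_assoc]
    have : tensOp n θ (phase (-θ) u) = phase (-θ) (tensOp n θ u) := by
      refine ten_ext fun j => ?_
      have : col n (volY d) j (phase (-θ) (tensOp n θ u))
          = phase (-θ) (col n (volY d) j (tensOp n θ u)) := phase_compLpL _ _ _
      rw [this, col_tensOp, col_tensOp, map_smul]
    rw [this, neg_add_cancel, add_zero]
  exact ⟨v, by rw [e1, phase_phase_neg], by rw [e2, phase_phase_neg]⟩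

/-- The graph norm of `∇ + iθ` controls that of `∇`, as the two operators differ by a bounded one.
The constant may depend on `θ`: it only serves to prove invertibility, and the uniform bounds come
from `energy_bound`. -/
theorem norm_sq_perSpace_le (θ : RSpace d) (v : PerSpace n d) :
    ‖v‖ ^ 2 ≤ (2 + 2 * ‖tensOp n θ‖ ^ 2) * (‖perVal n d v‖ ^ 2 + ‖perGrad n θ v‖ ^ 2) := by
  have h1 : perGradZero n d v = perGrad n θ v - tensOp n θ (perVal n d v) := by
    rw [perGrad, add_apply, ContinuousLinearMap.comp_apply, add_sub_cancel_right]
  have h2 : ‖perGradZero n d v‖ ≤ ‖perGrad n θ v‖ + ‖tensOp n θ‖ * ‖perVal n d v‖ := by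
    rw [h1]
    exact (norm_sub_le _ _).trans (add_le_add_right ((tensOp n θ).le_opNorm _) _)
  have h3 : ‖v‖ ^ 2 = ‖perVal n d v‖ ^ 2 + ‖perGradZero n d v‖ ^ 2 := norm_sq_perSpace v
  have h4 := pow_le_pow_left₀ (norm_nonneg _) h2 2
  have h5 : (‖perGrad n θ v‖ + ‖tensOp n θ‖ * ‖perVal n d v‖) ^ 2
      ≤ 2 * (‖perGrad n θ v‖ ^ 2 + ‖tensOp n θ‖ ^ 2 * ‖perVal n d v‖ ^ 2) := by
    nlinarith [sq_nonneg (‖perGrad n θ v‖ - ‖tensOp n θ‖ * ‖perVal n d v‖)]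
  have h6 : 0 ≤ ‖tensOp n θ‖ ^ 2 * ‖perGrad n θ v‖ ^ 2 := by positivity
  nlinarith [sq_nonneg ‖perVal n d v‖]

end PerSpace

/-! ### The abstract cell problem -/

section AbstractCell

variable {V W K T : Type*} [NormedAddCommGroup V] [InnerProductSpace ℂ V] [CompleteSpace V]
  [NormedAddCommGroup W] [InnerProductSpace ℂ W]
  [NormedAddCommGroup K] [InnerProductSpace ℂ K] [CompleteSpace K]
  [NormedAddCommGroup T] [InnerProductSpace ℂ T] [CompleteSpace T]

/-- The kernel of `Q` as a closed subspace. -/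
abbrev kerOf (Q : V →L[ℂ] W) : Submodule ℂ V := LinearMap.ker Q.toLinearMap

instance completeSpace_kerOf (Q : V →L[ℂ] W) : CompleteSpace (kerOf Q) :=
  Q.isClosed_ker.completeSpace_coe

/-- The form operator of the cell problem on `ker Q`. -/
def cellForm (Q : V →L[ℂ] W) (A : K →L[ℂ] K) (G : V →L[ℂ] K) : kerOf Q →L[ℂ] kerOf Q :=
  adjoint (G ∘L (kerOf Q).subtypeL) ∘L A ∘L (G ∘L (kerOf Q).subtypeL)

theorem inner_cellForm (Q : V →L[ℂ] W) (A : K →L[ℂ] K) (G : V →L[ℂ] K) (w v : kerOf Q) :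
    inner ℂ w (cellForm Q A G v) = inner ℂ (G w) (A (G v)) := by
  simp [cellForm, adjoint_inner_right]

theorem isUnit_cellForm {Q : V →L[ℂ] W} {A : K →L[ℂ] K} {G : V →L[ℂ] K} {ν C : ℝ} (hν : 0 < ν)
    (hC : 0 < C) (hA : ∀ X, ν * ‖X‖ ^ 2 ≤ (inner ℂ X (A X)).re)
    (hG : ∀ v, Q v = 0 → ‖v‖ ^ 2 ≤ C * ‖G v‖ ^ 2) : IsUnit (cellForm Q A G) := by
  refine isUnit_of_coercive _ (c := ν / C) (by positivity) fun v => ?_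
  rw [inner_cellForm]
  refine le_trans ?_ (hA (G v))
  rw [div_mul_eq_mul_div, div_le_iff₀ hC, mul_assoc]
  refine mul_le_mul_of_nonneg_left ?_ hν.le
  rw [mul_comm]
  exact hG v v.2

/-- The corrector, as a linear function of the constant gradient. -/
def cellCorr (Q : V →L[ℂ] W) (A : K →L[ℂ] K) (E : T →L[ℂ] K) (G : V →L[ℂ] K) : T →L[ℂ] kerOf Q :=
  -(Ring.inverse (cellForm Q A G) ∘L adjoint (G ∘L (kerOf Q).subtypeL) ∘L A ∘L E)

omit [CompleteSpace T] in
theorem inner_cellCorr {Q : V →L[ℂ] W} {A : K →L[ℂ] K} {G : V →L[ℂ] K}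
    (h : IsUnit (cellForm Q A G)) (E : T →L[ℂ] K) (ξ : T) {φ : V} (hφ : Q φ = 0) :
    inner ℂ (G φ) (A (G (cellCorr Q A E G ξ) + E ξ)) = 0 := by
  have h1 : cellForm Q A G (cellCorr Q A E G ξ)
      = -(adjoint (G ∘L (kerOf Q).subtypeL) (A (E ξ))) := by
    have : cellCorr Q A E G ξ = -(Ring.inverse (cellForm Q A G)
        (adjoint (G ∘L (kerOf Q).subtypeL) (A (E ξ)))) := rfl
    rw [this, map_neg, inverse_apply_of_isUnit h]
  have h2 : inner ℂ (⟨φ, hφ⟩ : kerOf Q) (cellForm Q A G (cellCorr Q A E G ξ)) = _ :=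
    congrArg (fun w => inner ℂ (⟨φ, hφ⟩ : kerOf Q) w) h1
  rw [inner_cellForm, inner_neg_right, adjoint_inner_right] at h2
  rw [map_add, inner_add_right, h2]
  exact neg_add_cancel _

/-- The effective tensor. -/
def homTensor (Q : V →L[ℂ] W) (A : K →L[ℂ] K) (E : T →L[ℂ] K) (G : V →L[ℂ] K) : T →L[ℂ] T :=
  adjoint E ∘L A ∘L (G ∘L (kerOf Q).subtypeL ∘L cellCorr Q A E G + E)

theorem inner_homTensor (Q : V →L[ℂ] W) (A : K →L[ℂ] K) (E : T →L[ℂ] K) (G : V →L[ℂ] K)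
    (ζ ξ : T) : inner ℂ ζ (homTensor Q A E G ξ)
      = inner ℂ (E ζ) (A (G (cellCorr Q A E G ξ) + E ξ)) := by
  have h : homTensor Q A E G ξ = adjoint E (A (G (cellCorr Q A E G ξ) + E ξ)) := rfl
  rw [h, adjoint_inner_right]

theorem continuousOn_homTensor {P : Type*} [TopologicalSpace P] {s : Set P} {Q : V →L[ℂ] W}
    {A : K →L[ℂ] K} {G : P → V →L[ℂ] K} (E : T →L[ℂ] K) (hG : ContinuousOn G s)
    (hu : ∀ p ∈ s, IsUnit (cellForm Q A (G p))) :
    ContinuousOn (fun p => homTensor Q A E (G p)) s := by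
  have hG' : ContinuousOn (fun p => G p ∘L (kerOf Q).subtypeL) s :=
    hG.clm_comp continuousOn_const
  have hadj : ContinuousOn (fun p => adjoint (G p ∘L (kerOf Q).subtypeL)) s :=
    (LinearIsometryEquiv.continuous (adjoint (𝕜 := ℂ) (E := kerOf Q)
      (F := K))).comp_continuousOn hG'
  have hinv := continuousOn_ringInverse (B := fun p => cellForm Q A (G p))
    (hadj.clm_comp (continuousOn_const.clm_comp hG')) hu
  have hN : ContinuousOn (fun p => cellCorr Q A E (G p)) s :=
    (hinv.clm_comp (hadj.clm_comp continuousOn_const)).neg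
  exact continuousOn_const.clm_comp (continuousOn_const.clm_comp
    ((hG.clm_comp (continuousOn_const.clm_comp hN)).add continuousOn_const))

/-- The cell equation tested with the corrector `N` turns the effective form into the energy of `G N
+ E ξ`. Since `G N` is orthogonal to `E ξ`, this field has norm at least `‖ξ‖`, so the effective
tensor keeps the constant `ν`. -/
theorem norm_sq_le_inner_homTensor {Q : V →L[ℂ] W} {A : K →L[ℂ] K} {G : V →L[ℂ] K} {ν : ℝ}
    (hν : 0 ≤ ν) (hA : ∀ X, ν * ‖X‖ ^ 2 ≤ (inner ℂ X (A X)).re)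
    (hu : IsUnit (cellForm Q A G)) {E : T →L[ℂ] K} (hE : ∀ ξ, ‖E ξ‖ = ‖ξ‖)
    (hEG : ∀ v, Q v = 0 → ∀ ξ, inner ℂ (E ξ) (G v) = 0) (ξ : T) :
    ν * ‖ξ‖ ^ 2 ≤ (inner ℂ ξ (homTensor Q A E G ξ)).re := by
  set N : V := (cellCorr Q A E G ξ : V) with hN
  have hNp : Q N = 0 := (cellCorr Q A E G ξ).2
  have h1 : inner ℂ ξ (homTensor Q A E G ξ) = inner ℂ (G N + E ξ) (A (G N + E ξ)) := by
    rw [inner_homTensor, inner_add_left, inner_cellCorr hu E ξ hNp, zero_add]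
  have h3 := norm_add_sq_eq_norm_sq_add_norm_sq_of_inner_eq_zero _ _ (hEG N hNp ξ)
  rw [hE, add_comm (E ξ)] at h3
  rw [h1]
  refine le_trans ?_ (hA _)
  refine mul_le_mul_of_nonneg_left ?_ hν
  nlinarith [norm_nonneg (G N)]

end AbstractCell

/-! ### The periodic cell problem -/

section CellProblem

variable {n d : ℕ}

variable (n d) in
/-- The mean value of a periodic function. -/
def perMean : PerSpace n d →L[ℂ] Vec n :=
  adjoint (waveEmb (ι := Fin n) (0 : RSpace d)).toContinuousLinearMap ∘L perVal n d

theorem inner_waveLp_perVal (c : Vec n) (v : PerSpace n d) :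
    inner ℂ (waveLp 0 c) (perVal n d v) = inner ℂ c (perMean n d v) :=
  (adjoint_inner_right (waveEmb (ι := Fin n) (0 : RSpace d)).toContinuousLinearMap c
    (perVal n d v)).symm

theorem perMean_eq_zero_iff {v : PerSpace n d} :
    perMean n d v = 0 ↔ ∀ c : Vec n, inner ℂ (waveLp 0 c) (perVal n d v) = 0 := by
  simp_rw [inner_waveLp_perVal]
  exact ⟨fun h c => by rw [h, inner_zero_right],
    fun h => ext_inner_left ℂ fun c => by rw [h, inner_zero_right]⟩

theorem inner_wave_phase (θ : RSpace d) {ι : Type} [Fintype ι] (c : EuclideanSpace ℂ ι)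
    (u : Lp (EuclideanSpace ℂ ι) 2 (volY d)) :
    inner ℂ (waveLp θ c) (phase θ u) = inner ℂ (waveLp 0 c) u := by
  conv_lhs => rw [← add_zero θ, ← phase_waveLp θ 0, add_zero, inner_phase_phase]

theorem inner_wave_phase_perVal (θ : RSpace d) {v : PerSpace n d} (hv : perMean n d v = 0)
    (c : Vec n) : inner ℂ (waveLp θ c) (phase θ (perVal n d v)) = 0 := by
  rw [inner_wave_phase]
  exact perMean_eq_zero_iff.1 hv c

theorem norm_perVal_le {θ : RSpace d} (hθ : θ ∈ zoneΘ d) {v : PerSpace n d}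
    (hv : perMean n d v = 0) : ‖perVal n d v‖ ≤ ‖perGrad n θ v‖ := by
  have h := norm_le_norm_grad hθ (mem_gradThetaGraph_of_perSpace θ v)
    (inner_wave_phase_perVal θ hv)
  rwa [norm_phase_apply, norm_phase_apply] at h

theorem norm_sq_perSpace_le_perGrad {θ : RSpace d} (hθ : θ ∈ zoneΘ d) (v : PerSpace n d)
    (hv : perMean n d v = 0) :
    ‖v‖ ^ 2 ≤ 2 * (2 + 2 * ‖tensOp n θ‖ ^ 2) * ‖perGrad n θ v‖ ^ 2 := by
  have h2 := pow_le_pow_left₀ (norm_nonneg _) (norm_perVal_le hθ hv) 2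
  have h1 := norm_sq_perSpace_le θ v
  have hC : 0 < 2 + 2 * ‖tensOp n θ‖ ^ 2 := by positivity
  nlinarith

theorem isUnit_cellForm_perSpace {A : L2YTen n d →L[ℂ] L2YTen n d} {ν : ℝ} (hν : 0 < ν)
    (hA : ∀ X, ν * ‖X‖ ^ 2 ≤ (inner ℂ X (A X)).re) {θ : RSpace d} (hθ : θ ∈ zoneΘ d) :
    IsUnit (cellForm (perMean n d) A (perGrad n θ)) :=
  isUnit_cellForm hν (by positivity) hA (norm_sq_perSpace_le_perGrad hθ)

variable (n d) in
/-- The constant tensors in `L²(Y)`. -/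
def tenEmb : Ten n d →L[ℂ] L2YTen n d := (waveEmb (0 : RSpace d)).toContinuousLinearMap

theorem tenEmb_apply (ξ : Ten n d) : tenEmb n d ξ = waveLp 0 ξ := rfl

theorem norm_tenEmb (ξ : Ten n d) : ‖tenEmb n d ξ‖ = ‖ξ‖ :=
  (waveEmb (0 : RSpace d)).norm_map ξ

theorem inner_tenEmb_perGrad (θ : RSpace d) (v : PerSpace n d) (hv : perMean n d v = 0)
    (ξ : Ten n d) : inner ℂ (tenEmb n d ξ) (perGrad n θ v) = 0 := by
  rw [tenEmb_apply, ← inner_wave_phase θ]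
  exact inner_wave_grad_eq_zero (mem_gradThetaGraph_of_perSpace θ v)
    (inner_wave_phase_perVal θ hv) ξ

/-- The corrector of the periodic cell problem. -/
def perCorr (A : L2YTen n d →L[ℂ] L2YTen n d) (θ : RSpace d) (ξ : Ten n d) : PerSpace n d :=
  cellCorr (perMean n d) A (tenEmb n d) (perGrad n θ) ξ

theorem perMean_perCorr (A : L2YTen n d →L[ℂ] L2YTen n d) (θ : RSpace d) (ξ : Ten n d) :
    perMean n d (perCorr A θ ξ) = 0 :=
  (cellCorr (perMean n d) A (tenEmb n d) (perGrad n θ) ξ).2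

/-- The effective tensor at `θ`. -/
def perHom (A : L2YTen n d →L[ℂ] L2YTen n d) (θ : RSpace d) : Ten n d →L[ℂ] Ten n d :=
  homTensor (perMean n d) A (tenEmb n d) (perGrad n θ)

theorem inner_perHom (A : L2YTen n d →L[ℂ] L2YTen n d) (θ : RSpace d) (ζ ξ : Ten n d) :
    inner ℂ ζ (perHom A θ ξ)
      = inner ℂ (tenEmb n d ζ) (A (perGrad n θ (perCorr A θ ξ) + tenEmb n d ξ)) :=
  inner_homTensor (perMean n d) A (tenEmb n d) (perGrad n θ) ζ ξ

theorem continuousOn_perHom {A : L2YTen n d →L[ℂ] L2YTen n d} {ν : ℝ} (hν : 0 < ν)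
    (hA : ∀ X, ν * ‖X‖ ^ 2 ≤ (inner ℂ X (A X)).re) : ContinuousOn (perHom A) (zoneΘ d) :=
  continuousOn_homTensor (tenEmb n d) continuous_perGrad.continuousOn
    fun _ hθ => isUnit_cellForm_perSpace hν hA hθ

theorem norm_sq_le_inner_perHom {A : L2YTen n d →L[ℂ] L2YTen n d} {ν : ℝ} (hν : 0 < ν)
    (hA : ∀ X, ν * ‖X‖ ^ 2 ≤ (inner ℂ X (A X)).re) {θ : RSpace d} (hθ : θ ∈ zoneΘ d)
    (ξ : Ten n d) : ν * ‖ξ‖ ^ 2 ≤ (inner ℂ ξ (perHom A θ ξ)).re := by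
  have hu := isUnit_cellForm_perSpace hν hA hθ
  rw [perHom]
  exact norm_sq_le_inner_homTensor hν.le hA hu norm_tenEmb (inner_tenEmb_perGrad θ) ξ

theorem inner_perCorr {A : L2YTen n d →L[ℂ] L2YTen n d} {ν : ℝ} (hν : 0 < ν)
    (hA : ∀ X, ν * ‖X‖ ^ 2 ≤ (inner ℂ X (A X)).re) {θ : RSpace d} (hθ : θ ∈ zoneΘ d)
    (ξ : Ten n d) {φ : PerSpace n d} (hφ : perMean n d φ = 0) :
    inner ℂ (perGrad n θ φ) (A (perGrad n θ (perCorr A θ ξ) + waveLp 0 ξ)) = 0 :=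
  inner_cellCorr (isUnit_cellForm_perSpace hν hA hθ) (tenEmb n d) ξ hφ

/-! ### The cell problem in `[H¹_θ(Y)]^n` -/

theorem perpWave_iff (θ : RSpace d) (u : L2Y n d) :
    PerpWave θ u ↔ ∀ c : Vec n, inner ℂ (waveLp θ c) u = 0 := by
  have h1 : ∀ i, ∫ y in cellY d, u y i * starRingEnd ℂ (planeWave θ y)
      = inner ℂ (waveLp θ (EuclideanSpace.single i (1 : ℂ))) u := by
    intro i
    rw [inner_waveLp]
    refine integral_congr_ae (Filter.Eventually.of_forall fun y => ?_)
    simp only [EuclideanSpace.inner_single_left, map_one, one_mul, planeWave_neg_left]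
    ring
  constructor
  · intro h c
    have h2 : adjoint (waveEmb (ι := Fin n) θ).toContinuousLinearMap u = 0 := by
      ext i
      have := adjoint_inner_right (waveEmb (ι := Fin n) θ).toContinuousLinearMap
        (EuclideanSpace.single i (1 : ℂ)) u
      rw [EuclideanSpace.inner_single_left, map_one, one_mul] at this
      rw [this]
      exact (h1 i).symm.trans (h i)
    have := adjoint_inner_right (waveEmb (ι := Fin n) θ).toContinuousLinearMap c u
    rw [h2, inner_zero_right] at this
    exact this.symm
  · intro h i
    rw [h1, h]

theorem mem_graph_gradTheta {θ : RSpace d} (u : (gradTheta n θ).domain) :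
    ((u : L2Y n d), gradTheta n θ u) ∈ gradThetaGraph n θ := by
  rw [← gradTheta_graph]
  exact LinearPMap.mem_graph _ u

theorem exists_gradTheta_of_mem {θ : RSpace d} {u : L2Y n d} {g : L2YTen n d}
    (h : (u, g) ∈ gradThetaGraph n θ) :
    ∃ x : (gradTheta n θ).domain, (x : L2Y n d) = u ∧ gradTheta n θ x = g := by
  rw [← gradTheta_graph] at h
  exact (LinearPMap.mem_graph_iff _).1 h

variable {a : RSpace d → (Ten n d →L[ℂ] Ten n d)}

/-- Rewrites the pointwise cell problem as an identity in `L²(Y)`, where the operator-theoretic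
corrector lives. -/
theorem isCellSolution_iff (ha : MemLp a ⊤ (volY d)) (θ : RSpace d) (r : Fin n) (q : Fin d)
    (N : (gradTheta n θ).domain) :
    IsCellSolution a θ r q N ↔ (∀ c : Vec n, inner ℂ (waveLp θ c) (N : L2Y n d) = 0) ∧
      ∀ φ : (gradTheta n θ).domain, (∀ c : Vec n, inner ℂ (waveLp θ c) (φ : L2Y n d) = 0) →
        inner ℂ (gradTheta n θ φ) (mulOp (volY d) a
          (gradTheta n θ N + waveLp θ (EuclideanSpace.single (r, q) (1 : ℂ)))) = 0 := by
  rw [IsCellSolution, perpWave_iff]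
  refine and_congr Iff.rfl (forall_congr' fun φ => ?_)
  rw [perpWave_iff]
  refine imp_congr Iff.rfl ?_
  rw [L2.inner_def]
  refine Eq.congr ?_ rfl
  refine integral_congr_ae ?_
  filter_upwards [mulOp_coeFn ha
    (gradTheta n θ N + waveLp θ (EuclideanSpace.single (r, q) (1 : ℂ))),
    Lp.coeFn_add (gradTheta n θ N) (waveLp θ (EuclideanSpace.single (r, q) (1 : ℂ))),
    waveLp_coeFn θ (EuclideanSpace.single (r, q) (1 : ℂ) : Ten n d)] with y h1 h2 h3
  rw [h1, h2, Pi.add_apply, h3]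

/-- The corrector in `[H¹_θ(Y)]^n` solves the cell problem. -/
theorem inner_grad_phase_perCorr (ha : MemLp a ⊤ (volY d)) {ν : ℝ} (hν : 0 < ν)
    (hA : ∀ X, ν * ‖X‖ ^ 2 ≤ (inner ℂ X (mulOp (volY d) a X)).re) {θ : RSpace d}
    (hθ : θ ∈ zoneΘ d) (ξ : Ten n d) {w : L2Y n d} {q : L2YTen n d}
    (h : (w, q) ∈ gradThetaGraph n θ) (hw : ∀ c : Vec n, inner ℂ (waveLp θ c) w = 0) :
    inner ℂ q (mulOp (volY d) a
      (phase θ (perGrad n θ (perCorr (mulOp (volY d) a) θ ξ)) + waveLp θ ξ)) = 0 := by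
  obtain ⟨v, hv1, hv2⟩ := exists_perSpace_of_mem h
  have e : phase θ (perGrad n θ (perCorr (mulOp (volY d) a) θ ξ)) + waveLp θ ξ
      = phase θ (perGrad n θ (perCorr (mulOp (volY d) a) θ ξ) + waveLp 0 ξ) := by
    rw [map_add, phase_waveLp, add_zero]
  rw [hv2, e, phase_mulOp θ ha, inner_phase_phase]
  refine inner_perCorr hν hA hθ ξ (perMean_eq_zero_iff.2 fun c => ?_)
  rw [← inner_wave_phase θ, ← hv1]
  exact hw c

/-- The difference of two solutions is an admissible test function. Coercivity makes its gradient
vanish, and then the Poincaré inequality makes the difference itself vanish. -/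
theorem eq_of_isCellSolution (ha : MemLp a ⊤ (volY d)) {ν : ℝ} (hν : 0 < ν)
    (hA : ∀ X, ν * ‖X‖ ^ 2 ≤ (inner ℂ X (mulOp (volY d) a X)).re) {θ : RSpace d}
    (hθ : θ ∈ zoneΘ d) {r : Fin n} {q : Fin d} {N N' : (gradTheta n θ).domain}
    (hN' : IsCellSolution a θ r q N') (hN : IsCellSolution a θ r q N) : N' = N := by
  obtain ⟨p1, e1⟩ := (isCellSolution_iff ha θ r q N').1 hN'
  obtain ⟨p2, e2⟩ := (isCellSolution_iff ha θ r q N).1 hN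
  set D := N' - N with hD
  have hDp : ∀ c : Vec n, inner ℂ (waveLp θ c) (D : L2Y n d) = 0 := by
    intro c
    rw [hD, Submodule.coe_sub, inner_sub_right, p1, p2, sub_zero]
  have h1 := e1 D hDp
  have h2 := e2 D hDp
  have h3 : gradTheta n θ D = gradTheta n θ N' - gradTheta n θ N := LinearPMap.map_sub _ _ _
  have hz : inner ℂ (gradTheta n θ D) (mulOp (volY d) a (gradTheta n θ D)) = 0 := by
    generalize gradTheta n θ D = X at *
    generalize gradTheta n θ N' = X1 at *
    generalize gradTheta n θ N = X2 at *
    rw [map_add, inner_add_right] at h1 h2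
    have h4 : inner ℂ X (mulOp (volY d) a X)
        = inner ℂ X (mulOp (volY d) a X1) - inner ℂ X (mulOp (volY d) a X2) := by
      rw [← inner_sub_right, ← map_sub, ← h3]
    rw [h4]
    linear_combination h1 - h2
  have hg : ‖gradTheta n θ D‖ = 0 := by
    have := hA (gradTheta n θ D)
    rw [hz, Complex.zero_re] at this
    have h0 : ‖gradTheta n θ D‖ ^ 2 ≤ 0 := by nlinarith
    simpa using h0
  have h5 := norm_le_norm_grad hθ (mem_graph_gradTheta D) hDp
  rw [hg] at h5
  have h6 : (D : L2Y n d) = 0 := norm_le_zero_iff.1 h5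
  have h7 : D = 0 := Subtype.ext h6
  exact sub_eq_zero.1 h7

/-- The periodic corrector multiplied by `e^{iθ·y}`. Its gradient is recorded because `aHom` is
computed from it. -/
theorem exists_isCellSolution (ha : MemLp a ⊤ (volY d)) {ν : ℝ} (hν : 0 < ν)
    (hA : ∀ X, ν * ‖X‖ ^ 2 ≤ (inner ℂ X (mulOp (volY d) a X)).re) {θ : RSpace d}
    (hθ : θ ∈ zoneΘ d) (r : Fin n) (q : Fin d) :
    ∃ N : (gradTheta n θ).domain, IsCellSolution a θ r q N ∧ gradTheta n θ N
      = phase θ (perGrad n θ (perCorr (mulOp (volY d) a) θ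
        (EuclideanSpace.single (r, q) (1 : ℂ)))) := by
  obtain ⟨N, hN1, hN2⟩ := exists_gradTheta_of_mem (mem_gradThetaGraph_of_perSpace θ
    (perCorr (mulOp (volY d) a) θ (EuclideanSpace.single (r, q) (1 : ℂ))))
  refine ⟨N, (isCellSolution_iff ha θ r q N).2 ⟨fun c => ?_, fun φ hφ => ?_⟩, hN2⟩
  · rw [hN1]
    exact inner_wave_phase_perVal θ (perMean_perCorr _ _ _) c
  · rw [hN2]
    exact inner_grad_phase_perCorr ha hν hA hθ _ (mem_graph_gradTheta φ) hφ

theorem existsUnique_isCellSolution (ha : MemLp a ⊤ (volY d)) {ν : ℝ} (hν : 0 < ν)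
    (hA : ∀ X, ν * ‖X‖ ^ 2 ≤ (inner ℂ X (mulOp (volY d) a X)).re) {θ : RSpace d}
    (hθ : θ ∈ zoneΘ d) (r : Fin n) (q : Fin d) :
    ∃! N : (gradTheta n θ).domain, IsCellSolution a θ r q N := by
  obtain ⟨N, hN, -⟩ := exists_isCellSolution ha hν hA hθ r q
  exact ⟨N, hN, fun N' hN' => eq_of_isCellSolution ha hν hA hθ hN' hN⟩

/-- Uniqueness pins down the solution selected by the choice operator. -/
theorem gradTheta_cellSolution (ha : MemLp a ⊤ (volY d)) {ν : ℝ} (hν : 0 < ν)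
    (hA : ∀ X, ν * ‖X‖ ^ 2 ≤ (inner ℂ X (mulOp (volY d) a X)).re) {θ : RSpace d}
    (hθ : θ ∈ zoneΘ d) (r : Fin n) (q : Fin d) : gradTheta n θ (cellSolution a θ r q)
      = phase θ (perGrad n θ (perCorr (mulOp (volY d) a) θ
        (EuclideanSpace.single (r, q) (1 : ℂ)))) := by
  obtain ⟨N, hN, hN2⟩ := exists_isCellSolution ha hν hA hθ r q
  have : cellSolution a θ r q = N :=
    eq_of_isCellSolution ha hν hA hθ (Classical.epsilon_spec (p := IsCellSolution a θ r q) ⟨N, hN⟩)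
      hN
  rw [this, hN2]

end CellProblem

/-! ### Entries and homogenised coefficients -/

section Entries

variable {ι : Type} [Fintype ι] [DecidableEq ι] {d n : ℕ}

theorem entry_eq_inner (B : EuclideanSpace ℂ ι →L[ℂ] EuclideanSpace ℂ ι) (p q : ι) :
    entry B p q = inner ℂ (EuclideanSpace.single p (1 : ℂ)) (B (EuclideanSpace.single q 1)) := by
  rw [EuclideanSpace.inner_single_left, map_one, one_mul, entry]

theorem sum_smul_single (x : EuclideanSpace ℂ ι) :
    ∑ q, x q • (EuclideanSpace.single q 1 : EuclideanSpace ℂ ι) = x := by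
  ext i
  rw [WithLp.ofLp_sum, Finset.sum_apply]
  simp [PiLp.single_apply]

theorem apply_eq_sum_entry (B : EuclideanSpace ℂ ι →L[ℂ] EuclideanSpace ℂ ι)
    (x : EuclideanSpace ℂ ι) (p : ι) : B x p = ∑ q, entry B p q * x q := by
  conv_lhs => rw [← sum_smul_single x]
  rw [map_sum, WithLp.ofLp_sum, Finset.sum_apply]
  refine Finset.sum_congr rfl fun q _ => ?_
  rw [map_smul, PiLp.smul_apply, smul_eq_mul, mul_comm, entry]

theorem ofEntries_eq_of_entry {B : EuclideanSpace ℂ ι →L[ℂ] EuclideanSpace ℂ ι} {M : ι → ι → ℂ}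
    (h : ∀ p q, M p q = entry B p q) : ofEntries M = B := by
  ext x p
  rw [apply_eq_sum_entry, apply_eq_sum_entry]
  simp_rw [entry_ofEntries, h]

theorem norm_entry_le (B : EuclideanSpace ℂ ι →L[ℂ] EuclideanSpace ℂ ι) (p q : ι) :
    ‖entry B p q‖ ≤ ‖B‖ := by
  rw [entry_eq_inner]
  refine (norm_inner_le_norm _ _).trans ?_
  refine (mul_le_mul_of_nonneg_left (B.le_opNorm _) (norm_nonneg _)).trans ?_
  simp

/-- The bridge from operators to the coordinate formulas that define `aHom` and `meanCoeff`.
Boundedness of the coefficient makes every summand integrable, so sum and integral may be exchanged.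
-/
theorem inner_wave_single_mulOp
    {a : RSpace d → (EuclideanSpace ℂ ι →L[ℂ] EuclideanSpace ℂ ι)} (ha : MemLp a ⊤ (volY d))
    (θ : RSpace d) (p : ι) (G : Lp (EuclideanSpace ℂ ι) 2 (volY d)) :
    inner ℂ (waveLp θ (EuclideanSpace.single p (1 : ℂ))) (mulOp (volY d) a G)
      = ∑ q, ∫ y in cellY d, entry (a y) p q * G y q * planeWave (-θ) y := by
  have hent : ∀ q, AEStronglyMeasurable (fun y => entry (a y) p q) (volY d) := by
    intro q
    have hc : Continuous fun B : EuclideanSpace ℂ ι →L[ℂ] EuclideanSpace ℂ ι => entry B p q := by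
      have : Continuous fun B : EuclideanSpace ℂ ι →L[ℂ] EuclideanSpace ℂ ι =>
          B (EuclideanSpace.single q 1) := by fun_prop
      exact (EuclideanSpace.proj (𝕜 := ℂ) p).continuous.comp this
    exact hc.comp_aestronglyMeasurable ha.aestronglyMeasurable
  have hint : ∀ q, Integrable (fun y => entry (a y) p q * G y q * planeWave (-θ) y) (volY d) := by
    intro q
    have h1 : MemLp (fun y => G y q) 2 (volY d) :=
      (EuclideanSpace.proj (𝕜 := ℂ) q).comp_memLp' (Lp.memLp G)
    have h2 : Integrable (fun y => planeWave (-θ) y * G y q) (volY d) :=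
      (h1.integrable (by norm_num)).bdd_mul (c := 1)
        (continuous_planeWave _).aestronglyMeasurable
        (Filter.Eventually.of_forall fun y => (norm_planeWave _ y).le)
    have h3 := h2.bdd_mul (c := lpNorm a ⊤ (volY d)) (hent q) (by
      filter_upwards [ae_le_lpNorm_exponent_top ha] with y hy
      exact (norm_entry_le _ _ _).trans hy)
    refine h3.congr (Filter.Eventually.of_forall fun y => ?_)
    simp only
    ring
  rw [inner_waveLp, ← integral_finsetSum _ fun q _ => hint q]
  refine integral_congr_ae ?_
  filter_upwards [mulOp_coeFn ha G] with y hy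
  rw [hy, EuclideanSpace.inner_single_left, map_one, one_mul, apply_eq_sum_entry, Finset.mul_sum]
  refine Finset.sum_congr rfl fun q _ => ?_
  ring

/-- Pairing with the wave `e^{iθ·y}e_p` produces the factor `e^{-iθ·y}` of the coordinate
definition, and phases commute with multiplication by `a`. The coordinate tensor is therefore the
matrix of the abstract one, from which it inherits coercivity and continuity in `θ`. -/
theorem aHom_eq_perHom {a : RSpace d → (Ten n d →L[ℂ] Ten n d)} (ha : MemLp a ⊤ (volY d)) {ν : ℝ}
    (hν : 0 < ν) (hA : ∀ X, ν * ‖X‖ ^ 2 ≤ (inner ℂ X (mulOp (volY d) a X)).re) {θ : RSpace d}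
    (hθ : θ ∈ zoneΘ d) : aHom a θ = perHom (mulOp (volY d) a) θ := by
  refine ofEntries_eq_of_entry fun p p' => ?_
  set C := perGrad n θ (perCorr (mulOp (volY d) a) θ (EuclideanSpace.single p' (1 : ℂ))) with hC
  have h1 : entry (perHom (mulOp (volY d) a) θ) p p'
      = inner ℂ (waveLp θ (EuclideanSpace.single p (1 : ℂ)))
        (mulOp (volY d) a (phase θ C + waveLp θ (EuclideanSpace.single p' (1 : ℂ)))) := by
    have e : phase θ C + waveLp θ (EuclideanSpace.single p' (1 : ℂ))
        = phase θ (C + waveLp 0 (EuclideanSpace.single p' (1 : ℂ))) := by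
      rw [map_add, phase_waveLp, add_zero]
    rw [entry_eq_inner, inner_perHom, e, phase_mulOp θ ha, inner_wave_phase]
    rfl
  rw [h1, inner_wave_single_mulOp ha, Fintype.sum_prod_type]
  refine Finset.sum_congr rfl fun k _ => Finset.sum_congr rfl fun l _ => ?_
  refine integral_congr_ae ?_
  rw [gradTheta_cellSolution ha hν hA hθ]
  filter_upwards [Lp.coeFn_add (phase θ C) (waveLp θ (EuclideanSpace.single p' (1 : ℂ))),
    waveLp_coeFn θ (EuclideanSpace.single p' (1 : ℂ) : Ten n d)] with y h2 h3
  rw [h2, Pi.add_apply, h3]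
  simp only [Prod.mk.eta, PiLp.add_apply, PiLp.smul_apply, PiLp.single_apply, smul_eq_mul, ← hC]
  congr 3
  by_cases hk : k = p'.1 <;> by_cases hl : l = p'.2 <;> simp [hk, hl, Prod.ext_iff]

/-- The mean of `s` is the compression of multiplication by `s` to the constants, so it inherits
coercivity. -/
theorem inner_meanCoeff {s : RSpace d → (Vec n →L[ℂ] Vec n)} (hs : MemLp s ⊤ (volY d))
    (c c' : Vec n) : inner ℂ c (meanCoeff s c')
      = inner ℂ (waveLp 0 c) (mulOp (volY d) s (waveLp 0 c')) := by
  set E := (waveEmb (ι := Fin n) (0 : RSpace d)).toContinuousLinearMap with hE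
  have h : meanCoeff s = adjoint E ∘L mulOp (volY d) s ∘L E := by
    refine ofEntries_eq_of_entry fun p q => ?_
    rw [entry_eq_inner, comp_apply, adjoint_inner_right]
    change _ = inner ℂ (waveLp 0 (EuclideanSpace.single p (1 : ℂ)))
      (mulOp (volY d) s (waveLp 0 (EuclideanSpace.single q (1 : ℂ))))
    rw [inner_wave_single_mulOp hs, Finset.sum_eq_single q]
    · refine integral_congr_ae ?_
      filter_upwards [waveLp_coeFn 0 (EuclideanSpace.single q (1 : ℂ) : Vec n)] with y hy
      rw [hy]
      simp
    · intro l _ hl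
      rw [← integral_zero (RSpace d) ℂ (μ := volY d)]
      refine integral_congr_ae ?_
      filter_upwards [waveLp_coeFn 0 (EuclideanSpace.single q (1 : ℂ) : Vec n)] with y hy
      rw [hy]
      simp [hl]
    · simp
  rw [h, comp_apply, adjoint_inner_right]
  rfl

theorem norm_sq_le_inner_meanCoeff {s : RSpace d → (Vec n →L[ℂ] Vec n)} (hs : MemLp s ⊤ (volY d))
    {μ : ℝ} (hS : ∀ u, μ * ‖u‖ ^ 2 ≤ (inner ℂ u (mulOp (volY d) s u)).re) (c : Vec n) :
    μ * ‖c‖ ^ 2 ≤ (inner ℂ c (meanCoeff s c)).re := by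
  rw [inner_meanCoeff hs, ← (waveEmb (0 : RSpace d)).norm_map c]
  exact hS _

end Entries

/-! ### Constant coefficients -/

section ConstantCoefficients

variable {ι : Type} [Fintype ι] {d n : ℕ}

theorem compLpL_waveLp (A : EuclideanSpace ℂ ι →L[ℂ] EuclideanSpace ℂ ι) (θ : RSpace d)
    (v : EuclideanSpace ℂ ι) : A.compLpL 2 (volY d) (waveLp θ v) = waveLp θ (A v) := by
  refine Lp.ext ?_
  filter_upwards [coeFn_compLpL (p := 2) (μ := volY d) A (waveLp θ v), waveLp_coeFn θ v,
    waveLp_coeFn θ (A v)] with y h1 h2 h3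
  rw [h1, h2, h3, map_smul]

/-- The adjoint of a constant coefficient maps waves to waves of the same frequency. The homogenised
problem therefore decouples into its constant part and the orthogonal complement. -/
theorem inner_waveLp_compLpL (A : EuclideanSpace ℂ ι →L[ℂ] EuclideanSpace ℂ ι) (θ : RSpace d)
    (v : EuclideanSpace ℂ ι) (X : Lp (EuclideanSpace ℂ ι) 2 (volY d)) :
    inner ℂ (waveLp θ v) (A.compLpL 2 (volY d) X) = inner ℂ (waveLp θ (adjoint A v)) X := by
  rw [inner_waveLp, inner_waveLp]
  refine integral_congr_ae ?_
  filter_upwards [coeFn_compLpL (p := 2) (μ := volY d) A X] with y h1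
  rw [h1, adjoint_inner_left]

theorem compLpL_eq_mulOp (A : EuclideanSpace ℂ ι →L[ℂ] EuclideanSpace ℂ ι) :
    A.compLpL 2 (volY d) = mulOp (volY d) fun _ => A := by
  ext1 u
  refine Lp.ext ?_
  filter_upwards [coeFn_compLpL (p := 2) (μ := volY d) A u, mulOp_coeFn (memLp_top_const A) u]
    with y h1 h2
  rw [h1, h2]

theorem norm_sq_le_inner_compLpL {A : EuclideanSpace ℂ ι →L[ℂ] EuclideanSpace ℂ ι} {ν : ℝ}
    (h : ∀ X, ν * ‖X‖ ^ 2 ≤ (inner ℂ X (A X)).re) (X : Lp (EuclideanSpace ℂ ι) 2 (volY d)) :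
    ν * ‖X‖ ^ 2 ≤ (inner ℂ X (A.compLpL 2 (volY d) X)).re := by
  rw [compLpL_eq_mulOp]
  exact inner_mulOp_re_ge (memLp_top_const A) (Filter.Eventually.of_forall fun _ => h) X

theorem continuous_compLpL : Continuous fun A : EuclideanSpace ℂ ι →L[ℂ] EuclideanSpace ℂ ι =>
    A.compLpL 2 (volY d) := by
  refine LipschitzWith.continuous (K := 1) (LipschitzWith.of_dist_le_mul fun A B => ?_)
  rw [dist_eq_norm, dist_eq_norm, NNReal.coe_one, one_mul]
  refine opNorm_le_bound _ (norm_nonneg _) fun u => ?_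
  refine Lp.norm_le_mul_norm_of_ae_le_mul ?_
  rw [sub_apply]
  filter_upwards [coeFn_compLpL (p := 2) (μ := volY d) A u,
    coeFn_compLpL (p := 2) (μ := volY d) B u,
    Lp.coeFn_sub (A.compLpL 2 (volY d) u) (B.compLpL 2 (volY d) u)] with y h1 h2 h3
  rw [h3, Pi.sub_apply, h1, h2, ← sub_apply]
  exact (A - B).le_opNorm _

end ConstantCoefficients

/-! ### The fibre resolvents -/

section Resolvent

variable {n d : ℕ}

theorem isUnit_formOp_perSpace {A : L2YTen n d →L[ℂ] L2YTen n d} {S : L2Y n d →L[ℂ] L2Y n d}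
    {m c : ℝ} (hm : 0 < m) (hc : 0 < c) (hA : ∀ X, m * ‖X‖ ^ 2 ≤ (inner ℂ X (A X)).re)
    (hS : ∀ u, m * ‖u‖ ^ 2 ≤ (inner ℂ u (S u)).re) (θ : RSpace d) :
    IsUnit (formOp (c : ℂ) (perGrad n θ) (perVal n d) A S) := by
  have hC : 0 < 2 + 2 * ‖tensOp n θ‖ ^ 2 := by positivity
  refine isUnit_of_coercive _ (c := (min (c * m) m) / (2 + 2 * ‖tensOp n θ‖ ^ 2))
    (div_pos (lt_min (mul_pos hc hm) hm) hC) fun v => ?_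
  rw [inner_formOp, Complex.add_re, Complex.re_ofReal_mul, div_mul_eq_mul_div, div_le_iff₀ hC]
  have h1 := norm_sq_perSpace_le θ v
  have h2 := mul_le_mul_of_nonneg_left (hA (perGrad n θ v)) hc.le
  have h3 := hS (perVal n d v)
  have h4 : min (c * m) m * ‖perGrad n θ v‖ ^ 2 ≤ c * m * ‖perGrad n θ v‖ ^ 2 :=
    mul_le_mul_of_nonneg_right (min_le_left _ _) (sq_nonneg _)
  have h5 : min (c * m) m * ‖perVal n d v‖ ^ 2 ≤ m * ‖perVal n d v‖ ^ 2 :=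
    mul_le_mul_of_nonneg_right (min_le_right _ _) (sq_nonneg _)
  have h6 : 0 ≤ min (c * m) m := (lt_min (mul_pos hc hm) hm).le
  have h7 := mul_le_mul_of_nonneg_left h1 h6
  have h8 : min (c * m) m * (‖perVal n d v‖ ^ 2 + ‖perGrad n θ v‖ ^ 2)
      ≤ c * (inner ℂ (perGrad n θ v) (A (perGrad n θ v))).re
        + (inner ℂ (perVal n d v) (S (perVal n d v))).re := by linarith
  have h9 := mul_le_mul_of_nonneg_right h8 hC.le
  linarith

/-- The solution operator of the fibre problem in the periodic Sobolev space. -/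
def fibreSol (c : ℝ) (A : L2YTen n d →L[ℂ] L2YTen n d) (S : L2Y n d →L[ℂ] L2Y n d)
    (θ : RSpace d) : L2Y n d →L[ℂ] PerSpace n d :=
  Ring.inverse (formOp (c : ℂ) (perGrad n θ) (perVal n d) A S) ∘L adjoint (perVal n d) ∘L phase (-θ)

/-- The resolvent `(-c div_θ A grad_θ + S)⁻¹`. -/
def fibreRes (c : ℝ) (A : L2YTen n d →L[ℂ] L2YTen n d) (S : L2Y n d →L[ℂ] L2Y n d)
    (θ : RSpace d) : L2Y n d →L[ℂ] L2Y n d :=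
  phase θ ∘L perVal n d ∘L fibreSol c A S θ

/-- The gradient of the resolvent. -/
def fibreResGrad (c : ℝ) (A : L2YTen n d →L[ℂ] L2YTen n d) (S : L2Y n d →L[ℂ] L2Y n d)
    (θ : RSpace d) : L2Y n d →L[ℂ] L2YTen n d :=
  phase θ ∘L perGrad n θ ∘L fibreSol c A S θ

theorem mem_graph_fibreRes (c : ℝ) (A : L2YTen n d →L[ℂ] L2YTen n d) (S : L2Y n d →L[ℂ] L2Y n d)
    (θ : RSpace d) (f : L2Y n d) :
    (fibreRes c A S θ f, fibreResGrad c A S θ f) ∈ gradThetaGraph n θ :=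
  mem_gradThetaGraph_of_perSpace θ (fibreSol c A S θ f)

theorem fibreSol_weak {A : L2YTen n d →L[ℂ] L2YTen n d} {S : L2Y n d →L[ℂ] L2Y n d}
    {m c : ℝ} (hm : 0 < m) (hc : 0 < c) (hA : ∀ X, m * ‖X‖ ^ 2 ≤ (inner ℂ X (A X)).re)
    (hS : ∀ u, m * ‖u‖ ^ 2 ≤ (inner ℂ u (S u)).re) (θ : RSpace d) (f : L2Y n d)
    (w : PerSpace n d) :
    (c : ℂ) * inner ℂ (perGrad n θ w) (A (perGrad n θ (fibreSol c A S θ f)))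
      + inner ℂ (perVal n d w) (S (perVal n d (fibreSol c A S θ f)))
      = inner ℂ (perVal n d w) (phase (-θ) f) := by
  rw [← inner_formOp, ← adjoint_inner_right]
  congr 1
  exact inverse_apply_of_isUnit (isUnit_formOp_perSpace hm hc hA hS θ) _

/-- Besides coercivity, only commutation with phases is asked of `A` and `S`, so that both the
oscillating and the constant coefficients are covered. -/
theorem fibreRes_weak {A : L2YTen n d →L[ℂ] L2YTen n d} {S : L2Y n d →L[ℂ] L2Y n d}
    {m c : ℝ} (hm : 0 < m) (hc : 0 < c) (hA : ∀ X, m * ‖X‖ ^ 2 ≤ (inner ℂ X (A X)).re)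
    (hS : ∀ u, m * ‖u‖ ^ 2 ≤ (inner ℂ u (S u)).re) {θ : RSpace d}
    (hAθ : ∀ X, A (phase θ X) = phase θ (A X)) (hSθ : ∀ u, S (phase θ u) = phase θ (S u))
    (f : L2Y n d) {w : L2Y n d} {q : L2YTen n d} (hw : (w, q) ∈ gradThetaGraph n θ) :
    (c : ℂ) * inner ℂ q (A (fibreResGrad c A S θ f)) + inner ℂ w (S (fibreRes c A S θ f))
      = inner ℂ w f := by
  obtain ⟨v, rfl, rfl⟩ := exists_perSpace_of_mem hw
  have h := fibreSol_weak hm hc hA hS θ f v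
  rw [← inner_phase_left] at h
  have e1 : A (fibreResGrad c A S θ f) = phase θ (A (perGrad n θ (fibreSol c A S θ f))) := hAθ _
  have e2 : S (fibreRes c A S θ f) = phase θ (S (perVal n d (fibreSol c A S θ f))) := hSθ _
  rw [e1, e2, inner_phase_phase, inner_phase_phase, h]

/-- Phases are isometries, so the bounds of `energy_bound` carry over without any dependence on `θ`.
-/
theorem norm_fibreRes_le {A : L2YTen n d →L[ℂ] L2YTen n d} {S : L2Y n d →L[ℂ] L2Y n d}
    {m ε : ℝ} (hm : 0 < m) (hε : 0 < ε) (hA : ∀ X, m * ‖X‖ ^ 2 ≤ (inner ℂ X (A X)).re)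
    (hS : ∀ u, m * ‖u‖ ^ 2 ≤ (inner ℂ u (S u)).re) (θ : RSpace d) (f : L2Y n d) :
    ‖fibreRes (ε ^ 2)⁻¹ A S θ f‖ ≤ ‖f‖ / m ∧ ‖fibreResGrad (ε ^ 2)⁻¹ A S θ f‖ ≤ ε * ‖f‖ / m := by
  have h := energy_bound (J := (perVal n d).toLinearMap) (G := (perGrad n θ).toLinearMap) hm hε hA
    hS (u := fibreSol (ε ^ 2)⁻¹ A S θ f)
    (fibreSol_weak hm (inv_pos.2 (pow_pos hε 2)) hA hS θ f _)
  rw [norm_phase_apply] at h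
  have e1 : ‖fibreRes (ε ^ 2)⁻¹ A S θ f‖ = ‖perVal n d (fibreSol (ε ^ 2)⁻¹ A S θ f)‖ :=
    norm_phase_apply _ _
  have e2 : ‖fibreResGrad (ε ^ 2)⁻¹ A S θ f‖ = ‖perGrad n θ (fibreSol (ε ^ 2)⁻¹ A S θ f)‖ :=
    norm_phase_apply _ _
  rw [e1, e2]
  exact h

theorem continuousOn_fibreSol {A : RSpace d → L2YTen n d →L[ℂ] L2YTen n d}
    {S : L2Y n d →L[ℂ] L2Y n d} {m c : ℝ} (hm : 0 < m) (hc : 0 < c) {Θ : Set (RSpace d)}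
    (hA : ∀ θ ∈ Θ, ∀ X, m * ‖X‖ ^ 2 ≤ (inner ℂ X (A θ X)).re)
    (hS : ∀ u, m * ‖u‖ ^ 2 ≤ (inner ℂ u (S u)).re) (hAc : ContinuousOn A Θ) :
    ContinuousOn (fun θ => fibreSol c (A θ) S θ) Θ := by
  have h1 := continuousOn_ringInverse
    (ContinuousOn.formOp (c : ℂ) (continuous_perGrad (n := n)).continuousOn hAc (perVal n d) S)
    (fun θ hθ => isUnit_formOp_perSpace hm hc (hA θ hθ) hS θ)
  have h2 : Continuous fun θ : RSpace d => phase (ι := Fin n) (-θ) :=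
    continuous_phase.comp continuous_neg
  exact h1.clm_comp (continuousOn_const.clm_comp h2.continuousOn)

theorem continuousOn_fibreRes {A : RSpace d → L2YTen n d →L[ℂ] L2YTen n d}
    {S : L2Y n d →L[ℂ] L2Y n d} {m c : ℝ} (hm : 0 < m) (hc : 0 < c) {Θ : Set (RSpace d)}
    (hA : ∀ θ ∈ Θ, ∀ X, m * ‖X‖ ^ 2 ≤ (inner ℂ X (A θ X)).re)
    (hS : ∀ u, m * ‖u‖ ^ 2 ≤ (inner ℂ u (S u)).re) (hAc : ContinuousOn A Θ) :
    ContinuousOn (fun θ => fibreRes c (A θ) S θ) Θ :=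
  continuous_phase.continuousOn.clm_comp
    (continuousOn_const.clm_comp (continuousOn_fibreSol hm hc hA hS hAc))

theorem continuousOn_fibreResGrad {A : RSpace d → L2YTen n d →L[ℂ] L2YTen n d}
    {S : L2Y n d →L[ℂ] L2Y n d} {m c : ℝ} (hm : 0 < m) (hc : 0 < c) {Θ : Set (RSpace d)}
    (hA : ∀ θ ∈ Θ, ∀ X, m * ‖X‖ ^ 2 ≤ (inner ℂ X (A θ X)).re)
    (hS : ∀ u, m * ‖u‖ ^ 2 ≤ (inner ℂ u (S u)).re) (hAc : ContinuousOn A Θ) :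
    ContinuousOn (fun θ => fibreResGrad c (A θ) S θ) Θ :=
  continuous_phase.continuousOn.clm_comp
    (continuous_perGrad.continuousOn.clm_comp (continuousOn_fibreSol hm hc hA hS hAc))

/-! ### The fibrewise homogenisation estimate -/

/-- The constants in the periodic Sobolev space. -/
def constPer (n d : ℕ) : Vec n →ₗ[ℂ] PerSpace n d where
  toFun c := (⟨WithLp.toLp 2 (waveLp 0 c, 0), by
    have h := wave_mem_gradThetaGraph (n := n) (0 : RSpace d) 0 c
    have e : freq (0 : RSpace d) 0 = 0 := by ext; simp [freq, intVec]
    rw [e] at h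
    have e2 : tensI (0 : RSpace d) c = 0 := by ext; simp [tensI]
    rw [e2, ← waveEmb_apply 0 (0 : Ten n d), map_zero] at h
    exact h⟩ : graphSpace (gradThetaGraph n (0 : RSpace d)))
  map_add' c c' := by
    refine Subtype.ext ?_
    change WithLp.toLp 2 (waveLp 0 (c + c'), (0 : L2YTen n d))
      = WithLp.toLp 2 (waveLp 0 c, (0 : L2YTen n d)) + WithLp.toLp 2 (waveLp 0 c', 0)
    have h : waveLp (0 : RSpace d) (c + c') = waveLp 0 c + waveLp 0 c' := (waveEmb 0).map_add c c'
    rw [h]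
    exact congrArg (WithLp.toLp 2) (Prod.ext rfl (add_zero (0 : L2YTen n d)).symm)
  map_smul' t c := by
    refine Subtype.ext ?_
    change WithLp.toLp 2 (waveLp 0 (t • c), (0 : L2YTen n d))
      = t • WithLp.toLp 2 (waveLp 0 c, (0 : L2YTen n d))
    have h : waveLp (0 : RSpace d) (t • c) = t • waveLp 0 c := (waveEmb 0).map_smul t c
    rw [h]
    exact congrArg (WithLp.toLp 2) (Prod.ext rfl (smul_zero t).symm)

theorem perVal_constPer (c : Vec n) : perVal n d (constPer n d c) = waveLp 0 c := rfl

theorem perGradZero_constPer (c : Vec n) : perGradZero n d (constPer n d c) = 0 := rfl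

variable (n) in
/-- `tensI` as a linear map. -/
def tensILin (θ : RSpace d) : Vec n →ₗ[ℂ] Ten n d where
  toFun := tensI θ
  map_add' v w := by ext p; simp [tensI]; ring
  map_smul' c v := by ext p; simp [tensI]; ring

theorem perGrad_constPer (θ : RSpace d) (c : Vec n) :
    perGrad n θ (constPer n d c) = waveLp 0 (tensILin n θ c) := by
  rw [perGrad, add_apply, perGradZero_constPer, zero_add, comp_apply, perVal_constPer]
  refine ten_ext fun j => ?_
  have : colCLM n j (tensILin n θ c) = _ := colCLM_tensI θ c j
  rw [col_tensOp, col_waveLp, this, ← waveEmb_apply, ← waveEmb_apply, map_smul]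

theorem perMean_sub_constPer (v : PerSpace n d) :
    perMean n d (v - constPer n d (perMean n d v)) = 0 := by
  rw [map_sub, sub_eq_zero]
  refine ext_inner_left ℂ fun c => ?_
  rw [← inner_waveLp_perVal c (constPer n d _), perVal_constPer, inner_waveLp_self]

/-- `homogenisation_estimate` on `PerSpace`, with `G = ∇ + iθ` and `τ c = c ⊗ iθ`. The dependence on
`θ` is confined to `G`, `τ` and the effective tensor, so the constant depends on neither `θ` nor
`ε`. -/
theorem norm_fibreRes_sub_le {a : RSpace d → (Ten n d →L[ℂ] Ten n d)}
    {s : RSpace d → (Vec n →L[ℂ] Vec n)} (ha : MemLp a ⊤ (volY d)) (hs : MemLp s ⊤ (volY d))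
    {m : ℝ} (hm : 0 < m) (hA : ∀ X, m * ‖X‖ ^ 2 ≤ (inner ℂ X (mulOp (volY d) a X)).re)
    (hS : ∀ u, m * ‖u‖ ^ 2 ≤ (inner ℂ u (mulOp (volY d) s u)).re) {θ : RSpace d}
    (hθ : θ ∈ zoneΘ d) {ε : ℝ} (hε : 0 < ε) (f : L2Y n d) :
    ‖fibreRes (ε ^ 2)⁻¹ (mulOp (volY d) a) (mulOp (volY d) s) θ f
      - fibreRes (ε ^ 2)⁻¹ ((aHom a θ).compLpL 2 (volY d)) ((meanCoeff s).compLpL 2 (volY d)) θ f‖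
      ≤ homConst m ‖mulOp (volY d) a‖ ‖mulOp (volY d) s‖ * ε * ‖f‖ := by
  have hc : 0 < (ε ^ 2)⁻¹ := inv_pos.2 (pow_pos hε 2)
  have hah := aHom_eq_perHom ha hm hA hθ
  have hA' : ∀ X, m * ‖X‖ ^ 2 ≤ (inner ℂ X ((aHom a θ).compLpL 2 (volY d) X)).re := by
    rw [hah]
    exact norm_sq_le_inner_compLpL (norm_sq_le_inner_perHom hm hA hθ)
  have hS' : ∀ u, m * ‖u‖ ^ 2 ≤ (inner ℂ u ((meanCoeff s).compLpL 2 (volY d) u)).re :=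
    norm_sq_le_inner_compLpL (norm_sq_le_inner_meanCoeff hs hS)
  have key := homogenisation_estimate (perVal n d).toLinearMap (perGrad n θ).toLinearMap
    (constPer n d) (waveEmb (0 : RSpace d)) (tensILin n θ) (fun v => perMean n d v = 0)
    (perGrad_constPer θ) (fun v => ⟨_, perMean_sub_constPer v⟩)
    (fun v w hv hw => by rw [map_sub, hv, hw, sub_zero])
    (fun v hv ξ => inner_tenEmb_perGrad θ v hv ξ) (fun v hv => norm_perVal_le hθ hv)
    (mulOp (volY d) a).toLinearMap ((aHom a θ).compLpL 2 (volY d)).toLinearMap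
    (mulOp (volY d) s).toLinearMap ((meanCoeff s).compLpL 2 (volY d)).toLinearMap
    hm (norm_nonneg _) (norm_nonneg _) hA hA' hS hS' (le_opNorm _) (le_opNorm _)
    (fun v hv ξ => (inner_waveLp_compLpL _ _ _ _).trans (inner_tenEmb_perGrad θ v hv _))
    (fun v hv c => (inner_waveLp_compLpL _ _ _ _).trans (perMean_eq_zero_iff.1 hv _))
    (fun c c' => by
      change inner ℂ (waveLp 0 c) (mulOp (volY d) s (waveLp 0 c'))
        = inner ℂ (waveLp 0 c) ((meanCoeff s).compLpL 2 (volY d) (waveLp 0 c'))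
      rw [compLpL_waveLp, inner_waveLp_self, inner_meanCoeff hs])
    (fun ξ => ⟨perCorr (mulOp (volY d) a) θ ξ, perMean_perCorr _ _ _,
      fun φ hφ => inner_perCorr hm hA hθ ξ hφ, fun ζ => by
        change inner ℂ (waveLp 0 ζ) ((aHom a θ).compLpL 2 (volY d) (waveLp 0 ξ)) = _
        rw [compLpL_waveLp, inner_waveLp_self, hah, inner_perHom]
        rfl⟩) hε
    (fibreSol_weak hm hc hA hS θ f) (fibreSol_weak hm hc hA' hS' θ f)
  have e : fibreRes (ε ^ 2)⁻¹ (mulOp (volY d) a) (mulOp (volY d) s) θ f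
      - fibreRes (ε ^ 2)⁻¹ ((aHom a θ).compLpL 2 (volY d)) ((meanCoeff s).compLpL 2 (volY d)) θ f
      = phase θ (perVal n d (fibreSol (ε ^ 2)⁻¹ (mulOp (volY d) a) (mulOp (volY d) s) θ f)
        - perVal n d (fibreSol (ε ^ 2)⁻¹ ((aHom a θ).compLpL 2 (volY d))
          ((meanCoeff s).compLpL 2 (volY d)) θ f)) := by
    rw [map_sub]; rfl
  rw [e, norm_phase_apply, ← norm_phase_apply (-θ) f]
  exact key

end Resolvent

/-! ### Affine changes of variables -/

section Affine

variable {d : ℕ} {c : ℝ}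

theorem integral_comp_smul_add {F : Type*} [NormedAddCommGroup F] [NormedSpace ℝ F] (hc : 0 < c)
    (v : RSpace d) (f : RSpace d → F) : ∫ z, f z = c ^ d • ∫ y, f (c • (y + v)) := by
  rw [integral_add_right_eq_self (fun y => f (c • y)) v,
    Measure.integral_comp_smul_of_nonneg volume f c (hR := hc.le), finrank_euclideanSpace,
    Fintype.card_fin, smul_smul, mul_inv_cancel₀ (pow_pos hc d).ne', one_smul]

theorem map_smul_add (hc : 0 < c) (v : RSpace d) :
    Measure.map (fun y : RSpace d => c • (y + v)) volume
      = ENNReal.ofReal (c ^ d)⁻¹ • (volume : Measure (RSpace d)) := by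
  have e : (fun y : RSpace d => c • (y + v)) = (c • ·) ∘ (· + v) := rfl
  rw [e, ← Measure.map_map (by fun_prop) (by fun_prop), map_add_right_eq_self,
    Measure.map_addHaar_smul _ hc.ne', finrank_euclideanSpace, Fintype.card_fin,
    abs_of_pos (inv_pos.2 (pow_pos hc d))]

theorem quasiMeasurePreserving_smul_add (hc : 0 < c) (v : RSpace d) :
    Measure.QuasiMeasurePreserving (fun y : RSpace d => c • (y + v)) volume volume :=
  ⟨by fun_prop, by rw [map_smul_add hc]; exact Measure.smul_absolutelyContinuous⟩

theorem memLp_comp_smul_add {F : Type*} [NormedAddCommGroup F] (hc : 0 < c) (v : RSpace d)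
    {p : ENNReal} {f : RSpace d → F} (hf : MemLp f p volume) :
    MemLp (fun y => f (c • (y + v))) p volume := by
  refine MemLp.comp_of_map (f := fun y : RSpace d => c • (y + v)) ?_ (by fun_prop)
  rw [map_smul_add hc]
  exact hf.smul_measure ENNReal.ofReal_ne_top

theorem smul_add_inv (hc : 0 < c) (v z : RSpace d) : c⁻¹ • z - v = c⁻¹ • (z + -(c • v)) := by
  rw [smul_add, smul_neg, smul_smul, inv_mul_cancel₀ hc.ne', one_smul, sub_eq_add_neg]

theorem smul_add_smul_inv (hc : 0 < c) (v y : RSpace d) : c⁻¹ • (c • (y + v)) - v = y := by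
  rw [smul_smul, inv_mul_cancel₀ hc.ne', one_smul, add_sub_cancel_right]

theorem quasiMeasurePreserving_smul_sub (hc : 0 < c) (v : RSpace d) :
    Measure.QuasiMeasurePreserving (fun z : RSpace d => c⁻¹ • z - v) volume volume := by
  simp_rw [smul_add_inv hc]
  exact quasiMeasurePreserving_smul_add (inv_pos.2 hc) _

theorem memLp_comp_smul_sub {F : Type*} [NormedAddCommGroup F] (hc : 0 < c) (v : RSpace d)
    {p : ENNReal} {f : RSpace d → F} (hf : MemLp f p volume) :
    MemLp (fun z => f (c⁻¹ • z - v)) p volume := by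
  simp_rw [smul_add_inv hc]
  exact memLp_comp_smul_add (inv_pos.2 hc) _ hf

theorem ae_coord_ne (i : Fin d) (t : ℝ) : ∀ᵐ z : RSpace d, z i ≠ t := by
  have h1 : ∀ᵐ x : Fin d → ℝ, x i ≠ t :=
    (Measure.quasiMeasurePreserving_eval (fun _ : Fin d => (volume : Measure ℝ)) i).ae
      (Measure.ae_ne volume t)
  exact (PiLp.volume_preserving_ofLp (Fin d)).quasiMeasurePreserving.ae h1

/-- The integer translates of the open cell miss only points with an integer coordinate; elsewhere
the translate is found by taking integer parts. -/
theorem ae_exists_sub_mem_cellY : ∀ᵐ y : RSpace d, ∃ m : Fin d → ℤ, y - intVec m ∈ cellY d := by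
  have h : ∀ᵐ y : RSpace d, ∀ (i : Fin d) (t : ℤ), y i ≠ t :=
    ae_all_iff.2 fun i => ae_all_iff.2 fun t => ae_coord_ne i t
  filter_upwards [h] with y hy
  refine ⟨fun i => ⌊y i⌋, fun i => ?_⟩
  have h1 := Int.floor_le (y i)
  have h2 := Int.lt_floor_add_one (y i)
  have h3 := hy i ⌊y i⌋
  simp only [PiLp.sub_apply, intVec, Set.mem_Ioo, sub_pos]
  exact ⟨lt_of_le_of_ne h1 (Ne.symm h3), by linarith⟩

theorem add_intVec_mem_cellY {y : RSpace d} (hy : y ∈ cellY d) {k : Fin d → ℤ}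
    (hk : y + intVec k ∈ cellY d) : k = 0 := by
  funext i
  have h1 := hy i
  have h2 := hk i
  simp only [PiLp.add_apply, intVec, Set.mem_Ioo] at h1 h2
  have h3 : ((-1 : ℤ) : ℝ) < k i := by push_cast; linarith
  have h4 : (k i : ℝ) < ((1 : ℤ) : ℝ) := by push_cast; linarith
  have h5 : -1 < k i := by exact_mod_cast h3
  have h6 : k i < 1 := by exact_mod_cast h4
  simp only [Pi.zero_apply]
  omega

theorem measurableSet_cellY (d : ℕ) : MeasurableSet (cellY d) := (isOpen_cellY d).measurableSet

theorem ae_of_ae_cells (hc : 0 < c) {P : RSpace d → Prop}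
    (h : ∀ m : Fin d → ℤ, ∀ᵐ y ∂volY d, P (c • (y + intVec m))) : ∀ᵐ z, P z := by
  have h1 : ∀ᵐ z : RSpace d, ∀ m : Fin d → ℤ,
      c⁻¹ • z - intVec m ∈ cellY d → P (c • (c⁻¹ • z - intVec m + intVec m)) :=
    ae_all_iff.2 fun m => (quasiMeasurePreserving_smul_sub hc (intVec m)).ae
      ((ae_restrict_iff' (measurableSet_cellY d)).1 (h m))
  have h2 : ∀ᵐ z : RSpace d, ∃ m : Fin d → ℤ, c⁻¹ • z - intVec m ∈ cellY d := by
    have := (quasiMeasurePreserving_smul_sub hc (0 : RSpace d)).ae ae_exists_sub_mem_cellY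
    simpa using this
  filter_upwards [h1, h2] with z h1 ⟨m, hm⟩
  have := h1 m hm
  rwa [sub_add_cancel, smul_smul, mul_inv_cancel₀ hc.ne', one_smul] at this

theorem ae_volY_comp_smul_add (hc : 0 < c) (v : RSpace d) {P : RSpace d → Prop}
    (h : ∀ᵐ z, P z) : ∀ᵐ y ∂volY d, P (c • (y + v)) :=
  ae_restrict_of_ae ((quasiMeasurePreserving_smul_add hc v).ae h)

theorem ae_comp_smul_sub_of_volY (hc : 0 < c) (v : RSpace d) {P : RSpace d → Prop}
    (h : ∀ᵐ y ∂volY d, P y) : ∀ᵐ z, c⁻¹ • z - v ∈ cellY d → P (c⁻¹ • z - v) :=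
  (quasiMeasurePreserving_smul_sub hc v).ae ((ae_restrict_iff' (measurableSet_cellY d)).1 h)

end Affine

/-! ### Square integrable functions on the cells -/

section Cells

variable {ι ι' : Type} [Fintype ι] [Fintype ι'] {d : ℕ} {c : ℝ}

/-- The scale `c^{d/2}`. -/
def cellScale (d : ℕ) (c : ℝ) : ℂ := ((c ^ ((d : ℝ) / 2) : ℝ) : ℂ)

theorem cellScale_ne_zero (hc : 0 < c) : cellScale d c ≠ 0 :=
  Complex.ofReal_ne_zero.2 (Real.rpow_pos_of_pos hc _).ne'

theorem conj_cellScale (d : ℕ) (c : ℝ) : starRingEnd ℂ (cellScale d c) = cellScale d c :=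
  Complex.conj_ofReal _

theorem cellScale_mul_self (hc : 0 < c) : cellScale d c * cellScale d c = ((c ^ d : ℝ) : ℂ) := by
  rw [cellScale, ← Complex.ofReal_mul, ← Real.rpow_add hc, add_halves, Real.rpow_natCast]

theorem memLp_cellFun (hc : 0 < c) (v : RSpace d) (x : Lp (EuclideanSpace ℂ ι) 2 (volY d)) :
    MemLp (fun z => (cellScale d c)⁻¹ • (cellY d).indicator x (c⁻¹ • z - v)) 2 volume :=
  MemLp.const_smul (f := fun z => (cellY d).indicator x (c⁻¹ • z - v)) (memLp_comp_smul_sub hc v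
    ((memLp_indicator_iff_restrict (measurableSet_cellY d)).2 (Lp.memLp x))) (cellScale d c)⁻¹

/-- The function on the cell `c (Y + v)` which corresponds to a function on `Y`. -/
def cellFun (hc : 0 < c) (v : RSpace d) (x : Lp (EuclideanSpace ℂ ι) 2 (volY d)) :
    Lp (EuclideanSpace ℂ ι) 2 (volume : Measure (RSpace d)) :=
  (memLp_cellFun hc v x).toLp _

theorem cellFun_coeFn (hc : 0 < c) (v : RSpace d) (x : Lp (EuclideanSpace ℂ ι) 2 (volY d)) :
    cellFun hc v x =ᵐ[volume]
      fun z => (cellScale d c)⁻¹ • (cellY d).indicator x (c⁻¹ • z - v) :=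
  (memLp_cellFun hc v x).coeFn_toLp

theorem cellFun_congr (hc : 0 < c) (v : RSpace d) (x : Lp (EuclideanSpace ℂ ι) 2 (volY d))
    {f : RSpace d → EuclideanSpace ℂ ι} (h : x =ᵐ[volY d] f) : cellFun hc v x =ᵐ[volume]
      fun z => (cellScale d c)⁻¹ • (cellY d).indicator f (c⁻¹ • z - v) := by
  filter_upwards [cellFun_coeFn hc v x, ae_comp_smul_sub_of_volY hc v h] with z h1 h2
  rw [h1]
  by_cases hz : c⁻¹ • z - v ∈ cellY d
  · rw [Set.indicator_of_mem hz, Set.indicator_of_mem hz, h2 hz]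
  · rw [Set.indicator_of_notMem hz, Set.indicator_of_notMem hz]

theorem memLp_restrictCell (hc : 0 < c) (v : RSpace d)
    (w : Lp (EuclideanSpace ℂ ι) 2 (volume : Measure (RSpace d))) :
    MemLp (fun y => cellScale d c • w (c • (y + v))) 2 (volY d) :=
  MemLp.const_smul (f := fun y => w (c • (y + v)))
    ((memLp_comp_smul_add hc v (Lp.memLp w)).restrict (cellY d)) (cellScale d c)

/-- The function on `Y` which corresponds to the restriction to the cell `c (Y + v)`. -/
def restrictCell (hc : 0 < c) (v : RSpace d)
    (w : Lp (EuclideanSpace ℂ ι) 2 (volume : Measure (RSpace d))) :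
    Lp (EuclideanSpace ℂ ι) 2 (volY d) := (memLp_restrictCell hc v w).toLp _

theorem restrictCell_coeFn (hc : 0 < c) (v : RSpace d)
    (w : Lp (EuclideanSpace ℂ ι) 2 (volume : Measure (RSpace d))) :
    restrictCell hc v w =ᵐ[volY d] fun y => cellScale d c • w (c • (y + v)) :=
  (memLp_restrictCell hc v w).coeFn_toLp

/-- `restrictCell` is the adjoint of `cellFun`. The Jacobian `c^d` of the change of variables is the
square of `cellScale`: one factor cancels the inverse scale in `cellFun`, the other is the one in
`restrictCell`. -/
theorem inner_cellFun (hc : 0 < c) (v : RSpace d) (x : Lp (EuclideanSpace ℂ ι) 2 (volY d))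
    (w : Lp (EuclideanSpace ℂ ι) 2 (volume : Measure (RSpace d))) :
    inner ℂ (cellFun hc v x) w = inner ℂ x (restrictCell hc v w) := by
  rw [L2.inner_def, L2.inner_def, integral_comp_smul_add hc v,
    ← integral_indicator (measurableSet_cellY d), ← integral_smul]
  refine integral_congr_ae ?_
  filter_upwards [(quasiMeasurePreserving_smul_add hc v).ae (cellFun_coeFn hc v x),
    (ae_restrict_iff' (measurableSet_cellY d)).1 (restrictCell_coeFn hc v w)] with y h1 h2
  rw [h1, smul_add_smul_inv hc]
  by_cases hy : y ∈ cellY d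
  · rw [Set.indicator_of_mem hy, Set.indicator_of_mem hy, h2 hy, inner_smul_left,
      inner_smul_right, map_inv₀, conj_cellScale, Complex.real_smul, ← cellScale_mul_self hc,
      ← mul_assoc, mul_inv_cancel_right₀ (cellScale_ne_zero hc)]
  · rw [Set.indicator_of_notMem hy, Set.indicator_of_notMem hy, smul_zero, inner_zero_left,
      smul_zero]

theorem restrictCell_cellFun (hc : 0 < c) (k m : Fin d → ℤ)
    (x : Lp (EuclideanSpace ℂ ι) 2 (volY d)) :
    restrictCell hc (intVec k) (cellFun hc (intVec m) x) = if k = m then x else 0 := by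
  refine Lp.ext ?_
  have h0 : (if k = m then x else 0 : Lp (EuclideanSpace ℂ ι) 2 (volY d))
      =ᵐ[volY d] fun y => if k = m then x y else 0 := by
    split_ifs
    · exact Filter.EventuallyEq.rfl
    · exact Lp.coeFn_zero _ _ _
  filter_upwards [restrictCell_coeFn hc (intVec k) (cellFun hc (intVec m) x), h0,
    ae_volY_comp_smul_add hc (intVec k) (cellFun_coeFn hc (intVec m) x),
    ae_restrict_mem (measurableSet_cellY d)] with y h1 h2 h3 hy
  have e : c⁻¹ • (c • (y + intVec k)) - intVec m = y + intVec (k - m) := by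
    have : (intVec (k - m) : RSpace d) = intVec k - intVec m := by ext; simp [intVec]
    rw [this, smul_smul, inv_mul_cancel₀ hc.ne', one_smul, add_sub_assoc]
  rw [h1, h2, h3, e, smul_smul, mul_inv_cancel₀ (cellScale_ne_zero hc), one_smul]
  split_ifs with hkm
  · have : (intVec (k - m) : RSpace d) = 0 := by ext; simp [intVec, hkm]
    rw [this, add_zero, Set.indicator_of_mem hy]
  · exact Set.indicator_of_notMem (fun h => hkm (sub_eq_zero.1 (add_intVec_mem_cellY hy h))) _

theorem inner_cellFun_cellFun (hc : 0 < c) (k m : Fin d → ℤ)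
    (x x' : Lp (EuclideanSpace ℂ ι) 2 (volY d)) :
    inner ℂ (cellFun hc (intVec k) x) (cellFun hc (intVec m) x')
      = if k = m then inner ℂ x x' else 0 := by
  rw [inner_cellFun, restrictCell_cellFun]
  split_ifs <;> simp

theorem eq_zero_of_restrictCell (hc : 0 < c)
    {w : Lp (EuclideanSpace ℂ ι) 2 (volume : Measure (RSpace d))}
    (h : ∀ m : Fin d → ℤ, restrictCell hc (intVec m) w = 0) : w = 0 := by
  refine Lp.eq_zero_iff_ae_eq_zero.2 (ae_of_ae_cells (P := fun z => w z = 0) hc fun m => ?_)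
  filter_upwards [restrictCell_coeFn hc (intVec m) w, Lp.eq_zero_iff_ae_eq_zero.1 (h m)]
    with y h1 h2
  rw [h1] at h2
  exact (smul_eq_zero.1 h2).resolve_left (cellScale_ne_zero hc)

/-- `cellFun` as an isometric embedding. -/
def cellIso (hc : 0 < c) (m : Fin d → ℤ) : Lp (EuclideanSpace ℂ ι) 2 (volY d) →ₗᵢ[ℂ]
    Lp (EuclideanSpace ℂ ι) 2 (volume : Measure (RSpace d)) where
  toFun := cellFun hc (intVec m)
  map_add' x y := by
    refine Lp.ext ?_
    filter_upwards [cellFun_congr hc (intVec m) (x + y) (Lp.coeFn_add x y),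
      cellFun_coeFn hc (intVec m) x, cellFun_coeFn hc (intVec m) y,
      Lp.coeFn_add (cellFun hc (intVec m) x) (cellFun hc (intVec m) y)] with z h1 h2 h3 h4
    rw [h1, h4, Pi.add_apply, h2, h3, Set.indicator_add', Pi.add_apply, smul_add]
  map_smul' t x := by
    refine Lp.ext ?_
    filter_upwards [cellFun_congr hc (intVec m) (t • x) (Lp.coeFn_smul t x),
      cellFun_coeFn hc (intVec m) x,
      Lp.coeFn_smul t (cellFun hc (intVec m) x)] with z h1 h2 h3
    rw [RingHom.id_apply, h1, h3, Pi.smul_apply, h2, smul_comm t]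
    congr 1
    by_cases hz : c⁻¹ • z - intVec m ∈ cellY d
    · rw [Set.indicator_of_mem hz, Set.indicator_of_mem hz, Pi.smul_apply]
    · rw [Set.indicator_of_notMem hz, Set.indicator_of_notMem hz, smul_zero]
  norm_map' x := by
    have h := inner_cellFun_cellFun hc m m x x
    rw [if_pos rfl] at h
    refine (sq_eq_sq₀ (norm_nonneg _) (norm_nonneg _)).1 ?_
    rw [@norm_sq_eq_re_inner ℂ, @norm_sq_eq_re_inner ℂ]
    exact congrArg _ h

theorem cellIso_apply (hc : 0 < c) (m : Fin d → ℤ) (x : Lp (EuclideanSpace ℂ ι) 2 (volY d)) :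
    cellIso hc m x = cellFun hc (intVec m) x := rfl

/-- By adjointness, an element orthogonal to all cell spaces has zero restriction to each cell, and
the cells exhaust `ℝ^d` up to a null set. -/
theorem topologicalClosure_range_cellIso (hc : 0 < c) :
    (⨆ m, LinearMap.range (cellIso (ι := ι) (d := d) hc m).toLinearMap).topologicalClosure = ⊤ := by
  rw [Submodule.topologicalClosure_eq_top_iff, Submodule.eq_bot_iff]
  intro w hw
  refine eq_zero_of_restrictCell hc fun m => ?_
  rw [← inner_self_eq_zero (𝕜 := ℂ), ← inner_cellFun]
  exact (Submodule.mem_orthogonal _ _).1 hw _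
    (Submodule.mem_iSup_of_mem m ⟨restrictCell hc (intVec m) w, rfl⟩)

theorem isHilbertSum_cellIso (hc : 0 < c) :
    IsHilbertSum ℂ (fun _ : Fin d → ℤ => Lp (EuclideanSpace ℂ ι) 2 (volY d))
      (fun m => cellIso (ι := ι) hc m) :=
  IsHilbertSum.mk (fun k m hkm x y => (inner_cellFun_cellFun hc k m x y).trans (if_neg hkm))
    (top_le_iff.2 (topologicalClosure_range_cellIso hc))

/-- For compactly supported functions the Hilbert sum is finite, so the Gelfand formula can be
checked without any question of convergence. -/
theorem eq_sum_cellFun (hc : 0 < c) (w : Lp (EuclideanSpace ℂ ι) 2 (volume : Measure (RSpace d)))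
    (F : Finset (Fin d → ℤ)) (hF : ∀ m ∉ F, restrictCell hc (intVec m) w = 0) :
    w = ∑ m ∈ F, cellIso hc m (restrictCell hc (intVec m) w) := by
  rw [← sub_eq_zero]
  refine eq_zero_of_restrictCell hc fun k => ?_
  refine ext_inner_left ℂ fun x => ?_
  rw [← inner_cellFun, inner_sub_right, inner_sum, inner_zero_right]
  simp_rw [cellIso_apply, inner_cellFun_cellFun]
  rw [Finset.sum_ite_eq, inner_cellFun]
  split_ifs with h
  · exact sub_self _
  · rw [hF k h, inner_zero_right, sub_zero]

end Cells

/-! ### Fourier series on the Brillouin zone -/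

section Zone

variable {d : ℕ}

theorem measurableSet_zoneΘ (d : ℕ) : MeasurableSet (zoneΘ d) := by
  have : zoneΘ d = ⋂ i, (fun y : RSpace d => y i) ⁻¹' Set.Ico (-Real.pi) Real.pi := by
    ext y
    simp [zoneΘ]
  rw [this]
  exact MeasurableSet.iInter fun i => measurableSet_Ico.preimage (by fun_prop)

instance isFiniteMeasure_volΘ (d : ℕ) : IsFiniteMeasure (volΘ d) := by
  refine ⟨?_⟩
  rw [Measure.restrict_apply_univ]
  have hK : IsCompact ((WithLp.toLp 2 : (Fin d → ℝ) → RSpace d) ''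
      Set.Icc (fun _ => -Real.pi) (fun _ => Real.pi)) :=
    isCompact_Icc.image (PiLp.continuous_toLp 2 _)
  refine lt_of_le_of_lt (measure_mono fun θ hθ => ?_) hK.measure_lt_top
  exact ⟨WithLp.ofLp θ, ⟨fun i => (hθ i).1, fun i => (hθ i).2.le⟩, rfl⟩

/-- The vector `-(1/2, …, 1/2)`. -/
def zoneShift (d : ℕ) : RSpace d := WithLp.toLp 2 fun _ => -(1 / 2)

/-- Up to its boundary, the Brillouin zone is the unit cell shifted by `-(1/2, …, 1/2)` and scaled
by `2π`, so Fourier analysis in `θ` reduces to that on the cell. Points with a zero coordinate are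
excluded since the zone is half-open. -/
theorem smul_add_zoneShift_mem_iff {y : RSpace d} (hy : ∀ i, y i ≠ 0) :
    (2 * Real.pi) • (y + zoneShift d) ∈ zoneΘ d ↔ y ∈ cellY d := by
  have hπ := Real.pi_pos
  refine forall_congr' fun i => ?_
  simp only [PiLp.smul_apply, PiLp.add_apply, zoneShift, smul_eq_mul, Set.mem_Ico, Set.mem_Ioo]
  constructor
  · rintro ⟨h1, h2⟩
    refine ⟨lt_of_le_of_ne ?_ (Ne.symm (hy i)), ?_⟩ <;> by_contra! h <;> nlinarith
  · rintro ⟨h1, h2⟩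
    constructor <;> nlinarith

theorem ae_smul_add_zoneShift_mem_iff :
    ∀ᵐ y : RSpace d, (2 * Real.pi) • (y + zoneShift d) ∈ zoneΘ d ↔ y ∈ cellY d := by
  filter_upwards [ae_all_iff.2 fun i : Fin d => ae_coord_ne i 0] with y hy
  exact smul_add_zoneShift_mem_iff hy

theorem integral_zoneΘ {E : Type*} [NormedAddCommGroup E] [NormedSpace ℝ E] (g : RSpace d → E) :
    ∫ θ in zoneΘ d, g θ
      = (2 * Real.pi) ^ d • ∫ y in cellY d, g ((2 * Real.pi) • (y + zoneShift d)) := by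
  rw [← integral_indicator (measurableSet_zoneΘ d), ← integral_indicator (measurableSet_cellY d),
    integral_comp_smul_add Real.two_pi_pos (zoneShift d)]
  congr 1
  refine integral_congr_ae ?_
  filter_upwards [ae_smul_add_zoneShift_mem_iff (d := d)] with y hy
  by_cases h : y ∈ cellY d
  · rw [Set.indicator_of_mem h, Set.indicator_of_mem (hy.2 h)]
  · rw [Set.indicator_of_notMem h, Set.indicator_of_notMem (fun h' => h (hy.1 h'))]

theorem planeWave_zone (y : RSpace d) (m : Fin d → ℤ) :
    planeWave ((2 * Real.pi) • (y + zoneShift d)) (intVec m)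
      = planeWave ((2 * Real.pi) • zoneShift d) (intVec m)
        * planeWave ((2 * Real.pi) • intVec m) y := by
  rw [smul_add, planeWave_add_left, mul_comm]
  congr 1
  rw [planeWave_comm, planeWave_smul_comm]

theorem integral_zoneΘ_planeWave (m : Fin d → ℤ) :
    ∫ θ in zoneΘ d, planeWave θ (intVec m) = if m = 0 then (((2 * Real.pi) ^ d : ℝ) : ℂ) else 0 := by
  rw [integral_zoneΘ]
  simp_rw [planeWave_zone]
  rw [integral_const_mul, integral_cellY_planeWave_two_pi]
  split_ifs with h
  · have : (intVec m : RSpace d) = 0 := by ext; simp [intVec, h]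
    rw [this, planeWave_comm, planeWave_zero_left, mul_one, Complex.real_smul, mul_one]
  · rw [mul_zero, smul_zero]

theorem ae_eq_zero_of_fourier_zoneΘ {h : RSpace d → ℂ} (hh : MemLp h 2 (volΘ d))
    (h0 : ∀ m : Fin d → ℤ, ∫ θ in zoneΘ d, planeWave θ (intVec m) * h θ = 0) :
    h =ᵐ[volΘ d] 0 := by
  have hπ := Real.two_pi_pos
  have h1 : MemLp (fun y => h ((2 * Real.pi) • (y + zoneShift d))) 2 (volY d) := by
    have h2 : MemLp (fun y => (zoneΘ d).indicator h ((2 * Real.pi) • (y + zoneShift d))) 2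
        (volY d) := (memLp_comp_smul_add (p := 2) (f := (zoneΘ d).indicator h) hπ (zoneShift d)
      ((memLp_indicator_iff_restrict (measurableSet_zoneΘ d)).2 hh)).restrict (cellY d)
    refine h2.ae_eq ?_
    filter_upwards [ae_restrict_of_ae (ae_smul_add_zoneShift_mem_iff (d := d)),
      ae_restrict_mem (measurableSet_cellY d)] with y hy hy'
    rw [Set.indicator_of_mem (hy.2 hy')]
  have h3 := ae_eq_zero_of_fourier_cellY h1 fun k => by
    -- The sign is reversed because completeness on the cell is stated with the conjugate waves.
    have h4 := h0 (-k)
    rw [integral_zoneΘ, smul_eq_zero] at h4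
    replace h4 := h4.resolve_left (pow_pos hπ d).ne'
    simp_rw [planeWave_zone, mul_assoc] at h4
    rw [integral_const_mul, mul_eq_zero] at h4
    replace h4 := h4.resolve_left (norm_ne_zero_iff.1 (by
      rw [norm_planeWave]; exact one_ne_zero))
    have e : (2 * Real.pi) • (intVec (-k) : RSpace d) = -((2 * Real.pi) • intVec k) := by
      ext; simp [intVec]
    rwa [e] at h4
  have h5 := ae_comp_smul_sub_of_volY (P := fun y => h ((2 * Real.pi) • (y + zoneShift d)) = 0)
    hπ (zoneShift d) h3
  have h6 := (quasiMeasurePreserving_smul_sub hπ (zoneShift d)).ae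
    (ae_smul_add_zoneShift_mem_iff (d := d))
  filter_upwards [ae_restrict_of_ae h5, ae_restrict_of_ae h6,
    ae_restrict_mem (measurableSet_zoneΘ d)] with θ h5 h6 hθ
  have e : (2 * Real.pi) • ((2 * Real.pi)⁻¹ • θ - zoneShift d + zoneShift d) = θ := by
    rw [sub_add_cancel, smul_smul, mul_inv_cancel₀ hπ.ne', one_smul]
  rw [e] at h5 h6
  exact h5 (h6.1 hθ)

end Zone

/-! ### Fourier modes in `θ` with values in `L²(Y)` -/

section ZoneWave

variable {ι ι' : Type} [Fintype ι] [Fintype ι'] {d : ℕ}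

theorem memLp_zoneWave (m : Fin d → ℤ) (x : Lp (EuclideanSpace ℂ ι) 2 (volY d)) :
    MemLp (fun θ => ((cellScale d (2 * Real.pi))⁻¹ * planeWave (-θ) (intVec m)) • x) 2
      (volΘ d) := by
  have hc : Continuous fun θ : RSpace d => planeWave (-θ) (intVec m) :=
    (continuous_planeWave_left (intVec m)).comp continuous_neg
  refine MemLp.of_bound ((continuous_const.mul hc).smul continuous_const).aestronglyMeasurable
    (‖(cellScale d (2 * Real.pi))⁻¹‖ * ‖x‖) (Filter.Eventually.of_forall fun y => ?_)
  rw [norm_smul, norm_mul, norm_planeWave, mul_one]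

/-- The function `(2π)^{-d/2} e^{-i ⟨θ, m⟩} x` of `θ`. -/
def zoneWave (m : Fin d → ℤ) (x : Lp (EuclideanSpace ℂ ι) 2 (volY d)) :
    Lp (Lp (EuclideanSpace ℂ ι) 2 (volY d)) 2 (volΘ d) := (memLp_zoneWave m x).toLp _

theorem zoneWave_coeFn (m : Fin d → ℤ) (x : Lp (EuclideanSpace ℂ ι) 2 (volY d)) :
    zoneWave m x =ᵐ[volΘ d]
      fun θ => ((cellScale d (2 * Real.pi))⁻¹ * planeWave (-θ) (intVec m)) • x :=
  (memLp_zoneWave m x).coeFn_toLp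

theorem inner_zoneWave (m : Fin d → ℤ) (x : Lp (EuclideanSpace ℂ ι) 2 (volY d))
    (F : Lp (Lp (EuclideanSpace ℂ ι) 2 (volY d)) 2 (volΘ d)) :
    inner ℂ (zoneWave m x) F = (cellScale d (2 * Real.pi))⁻¹ *
      ∫ θ in zoneΘ d, planeWave θ (intVec m) * inner ℂ x (F θ) := by
  rw [L2.inner_def, ← integral_const_mul]
  refine integral_congr_ae ?_
  filter_upwards [zoneWave_coeFn m x] with θ hθ
  rw [hθ, inner_smul_left, map_mul, map_inv₀, conj_cellScale, ← planeWave_neg_left, neg_neg,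
    mul_assoc]

theorem inner_zoneWave_zoneWave (k m : Fin d → ℤ) (x x' : Lp (EuclideanSpace ℂ ι) 2 (volY d)) :
    inner ℂ (zoneWave k x) (zoneWave m x') = if k = m then inner ℂ x x' else 0 := by
  have h : ∫ θ in zoneΘ d, planeWave θ (intVec k) * inner ℂ x (zoneWave m x' θ)
      = ∫ θ in zoneΘ d, ((cellScale d (2 * Real.pi))⁻¹ * inner ℂ x x') *
        planeWave θ (intVec (k - m)) := by
    refine integral_congr_ae ?_
    filter_upwards [zoneWave_coeFn m x'] with θ hθ
    have e : (intVec (k - m) : RSpace d) = intVec k + -intVec m := by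
      ext; simp [intVec, sub_eq_add_neg]
    rw [hθ, inner_smul_right, e, planeWave_add_right, planeWave_neg_right]
    ring
  rw [inner_zoneWave, h, integral_const_mul, integral_zoneΘ_planeWave]
  have h2 := cellScale_ne_zero (d := d) Real.two_pi_pos
  simp only [sub_eq_zero]
  split_ifs
  · rw [← cellScale_mul_self Real.two_pi_pos]
    field_simp
  · simp

/-- Completeness is used twice. For each plane wave in `y`, the coefficient of `F θ` is a scalar
function of `θ` whose Fourier coefficients vanish, hence it is zero almost everywhere. There are
countably many plane waves, so off one null set all coefficients of `F θ` vanish. -/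
theorem eq_zero_of_inner_zoneWave {F : Lp (Lp (EuclideanSpace ℂ ι) 2 (volY d)) 2 (volΘ d)}
    (h : ∀ m x, inner ℂ (zoneWave m x) F = 0) : F = 0 := by
  classical
  have key : ∀ p : (Fin d → ℤ) × ι, ∀ᵐ θ ∂volΘ d,
      inner ℂ (waveLp (freq 0 p.1) (EuclideanSpace.single p.2 (1 : ℂ))) (F θ) = 0 := by
    intro p
    set x := waveLp (freq (0 : RSpace d) p.1) (EuclideanSpace.single p.2 (1 : ℂ))
    have h1 : MemLp (fun θ => inner ℂ x (F θ)) 2 (volΘ d) := (Lp.memLp F).const_inner x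
    refine ae_eq_zero_of_fourier_zoneΘ h1 fun m => ?_
    have h2 := h m x
    rw [inner_zoneWave, mul_eq_zero] at h2
    exact h2.resolve_left (inv_ne_zero (cellScale_ne_zero Real.two_pi_pos))
  refine Lp.eq_zero_iff_ae_eq_zero.2 ?_
  filter_upwards [ae_all_iff.2 key] with θ hθ
  exact eq_zero_of_inner_wave 0 (F θ) fun k i => hθ (k, i)

theorem norm_eq_of_inner_self_eq {E F : Type*} [NormedAddCommGroup E] [InnerProductSpace ℂ E]
    [NormedAddCommGroup F] [InnerProductSpace ℂ F] {x : E} {y : F}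
    (h : (inner ℂ x x : ℂ) = inner ℂ y y) : ‖x‖ = ‖y‖ := by
  rw [@norm_eq_sqrt_re_inner ℂ, @norm_eq_sqrt_re_inner ℂ, h]

theorem zoneWave_add (m : Fin d → ℤ) (x y : Lp (EuclideanSpace ℂ ι) 2 (volY d)) :
    zoneWave m (x + y) = zoneWave m x + zoneWave m y := by
  refine Lp.ext ?_
  filter_upwards [zoneWave_coeFn m (x + y), zoneWave_coeFn m x, zoneWave_coeFn m y,
    Lp.coeFn_add (zoneWave m x) (zoneWave m y)] with z h1 h2 h3 h4
  rw [h1, h4, Pi.add_apply, h2, h3, smul_add]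

theorem zoneWave_smul (m : Fin d → ℤ) (t : ℂ) (x : Lp (EuclideanSpace ℂ ι) 2 (volY d)) :
    zoneWave m (t • x) = t • zoneWave m x := by
  refine Lp.ext ?_
  filter_upwards [zoneWave_coeFn m (t • x), zoneWave_coeFn m x,
    Lp.coeFn_smul t (zoneWave m x)] with z h1 h2 h3
  rw [h1, h3, Pi.smul_apply, h2, smul_comm t]

theorem norm_zoneWave (m : Fin d → ℤ) (x : Lp (EuclideanSpace ℂ ι) 2 (volY d)) :
    ‖zoneWave m x‖ = ‖x‖ :=
  norm_eq_of_inner_self_eq ((inner_zoneWave_zoneWave m m x x).trans (if_pos rfl))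

/-- `zoneWave` as an isometric embedding. -/
def zoneIso (m : Fin d → ℤ) : Lp (EuclideanSpace ℂ ι) 2 (volY d) →ₗᵢ[ℂ]
    Lp (Lp (EuclideanSpace ℂ ι) 2 (volY d)) 2 (volΘ d) where
  toFun := zoneWave m
  map_add' := zoneWave_add m
  map_smul' := zoneWave_smul m
  norm_map' := norm_zoneWave m

theorem zoneIso_apply (m : Fin d → ℤ) (x : Lp (EuclideanSpace ℂ ι) 2 (volY d)) :
    zoneIso m x = zoneWave m x := rfl

theorem isHilbertSum_zoneIso :
    IsHilbertSum ℂ (fun _ : Fin d → ℤ => Lp (EuclideanSpace ℂ ι) 2 (volY d))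
      (fun m => zoneIso (ι := ι) m) := by
  refine IsHilbertSum.mk (fun k m hkm x y => ?_) (top_le_iff.2 ?_)
  · exact (inner_zoneWave_zoneWave k m x y).trans (if_neg hkm)
  · rw [Submodule.topologicalClosure_eq_top_iff, Submodule.eq_bot_iff]
    intro w hw
    refine eq_zero_of_inner_zoneWave fun m x => ?_
    exact (Submodule.mem_orthogonal _ _).1 hw _ (Submodule.mem_iSup_of_mem m ⟨x, rfl⟩)

/-! ### The Gelfand transform -/

/-- The Gelfand transform. -/
def gelfand {c : ℝ} (hc : 0 < c) : Lp (EuclideanSpace ℂ ι) 2 (volume : Measure (RSpace d)) ≃ₗᵢ[ℂ]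
    Lp (Lp (EuclideanSpace ℂ ι) 2 (volY d)) 2 (volΘ d) :=
  (isHilbertSum_cellIso hc).linearIsometryEquiv.trans
    isHilbertSum_zoneIso.linearIsometryEquiv.symm

variable {c : ℝ} (hc : 0 < c)

theorem gelfand_cellIso (m : Fin d → ℤ) (x : Lp (EuclideanSpace ℂ ι) 2 (volY d)) :
    gelfand hc (cellIso hc m x) = zoneIso m x := by
  classical
  rw [gelfand, LinearIsometryEquiv.trans_apply,
    ← (isHilbertSum_cellIso hc).linearIsometryEquiv_symm_apply_single x,
    LinearIsometryEquiv.apply_symm_apply,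
    isHilbertSum_zoneIso.linearIsometryEquiv_symm_apply_single]

/-- Operators which act in the same way on all cells act fibrewise after the Gelfand transform. -/
theorem gelfand_intertwine
    {P : Lp (EuclideanSpace ℂ ι) 2 (volume : Measure (RSpace d)) →L[ℂ]
      Lp (EuclideanSpace ℂ ι') 2 (volume : Measure (RSpace d))}
    {p : Lp (EuclideanSpace ℂ ι) 2 (volY d) →L[ℂ] Lp (EuclideanSpace ℂ ι') 2 (volY d)}
    (h : ∀ m x, P (cellIso hc m x) = cellIso hc m (p x))
    (w : Lp (EuclideanSpace ℂ ι) 2 (volume : Measure (RSpace d))) :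
    gelfand hc (P w) =ᵐ[volΘ d] fun θ => p (gelfand hc w θ) := by
  set U := (gelfand (ι := ι) (d := d) hc).toLinearIsometry.toContinuousLinearMap with hU
  set U' := (gelfand (ι := ι') (d := d) hc).toLinearIsometry.toContinuousLinearMap with hU'
  -- Both sides are continuous in `w` and agree on functions supported in one cell, which span a
  -- dense subspace.
  have hle : (⨆ m, LinearMap.range (cellIso (ι := ι) hc m).toLinearMap).topologicalClosure
      ≤ LinearMap.eqLocus (U' ∘L P).toLinearMap (p.compLpL 2 (volΘ d) ∘L U).toLinearMap := by
    refine Submodule.topologicalClosure_minimal _ (iSup_le ?_)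
      (isClosed_eq (U' ∘L P).continuous (p.compLpL 2 (volΘ d) ∘L U).continuous)
    rintro m _ ⟨x, rfl⟩
    change gelfand hc (P (cellIso hc m x)) = p.compLpL 2 (volΘ d) (gelfand hc (cellIso hc m x))
    rw [h, gelfand_cellIso, gelfand_cellIso]
    refine Lp.ext ?_
    filter_upwards [coeFn_compLpL (p := 2) (μ := volΘ d) p (zoneIso m x),
      zoneWave_coeFn m x, zoneWave_coeFn m (p x)] with θ h1 h2 h3
    rw [h1, zoneIso_apply, zoneIso_apply, h2, h3, map_smul]
  have e : gelfand hc (P w) = p.compLpL 2 (volΘ d) (gelfand hc w) :=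
    hle (topologicalClosure_range_cellIso (ι := ι) (d := d) hc ▸ Submodule.mem_top : w ∈ _)
  rw [e]
  exact coeFn_compLpL p _

/-- The finitely many cells `c (Y + m)` which meet the ball of radius `r`. -/
def cellBox (d : ℕ) (c r : ℝ) : Finset (Fin d → ℤ) :=
  Fintype.piFinset fun _ => Finset.Icc (-(⌈r / c⌉ + 1)) (⌈r / c⌉ + 1)

/-- Some coordinate of `m` lies beyond `⌈r/c⌉ + 1` in absolute value; the extra one in the box
absorbs the coordinate of `y`, which is less than one. -/
theorem lt_norm_of_notMem_cellBox (hc : 0 < c) {r : ℝ} {m : Fin d → ℤ} (hm : m ∉ cellBox d c r) {y : RSpace d}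
    (hy : y ∈ cellY d) : r < ‖c • (y + intVec m)‖ := by
  simp only [cellBox, Fintype.mem_piFinset, Finset.mem_Icc, not_forall] at hm
  obtain ⟨i, hi⟩ := hm
  have h1 : r / c < |y i + m i| := by
    have h2 := Int.le_ceil (r / c)
    have h3 := hy i
    rcases not_and_or.1 hi with h | h
    · have h4 : m i + 1 ≤ -(⌈r / c⌉ + 1) := by omega
      have h5 : ((m i + 1 : ℤ) : ℝ) ≤ ((-(⌈r / c⌉ + 1) : ℤ) : ℝ) := by exact_mod_cast h4
      push_cast at h5
      have := neg_le_abs (y i + m i)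
      linarith [h3.2]
    · have h4 : ⌈r / c⌉ + 1 + 1 ≤ m i := by omega
      have h5 : ((⌈r / c⌉ + 1 + 1 : ℤ) : ℝ) ≤ ((m i : ℤ) : ℝ) := by exact_mod_cast h4
      push_cast at h5
      have := le_abs_self (y i + m i)
      linarith [h3.1]
  have h6 : |y i + m i| ≤ ‖y + intVec m‖ := PiLp.norm_apply_le (y + intVec m) i
  rw [norm_smul, Real.norm_eq_abs, abs_of_pos hc]
  calc r = c * (r / c) := by field_simp
    _ < c * ‖y + intVec m‖ := mul_lt_mul_of_pos_left (h1.trans_le h6) hc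

theorem restrictCell_eq_zero {r : ℝ}
    {w : Lp (EuclideanSpace ℂ ι) 2 (volume : Measure (RSpace d))}
    (hw : ∀ᵐ z, r < ‖z‖ → w z = 0) {m : Fin d → ℤ} (hm : m ∉ cellBox d c r) :
    restrictCell hc (intVec m) w = 0 := by
  refine Lp.eq_zero_iff_ae_eq_zero.2 ?_
  filter_upwards [restrictCell_coeFn hc (intVec m) w, ae_volY_comp_smul_add hc (intVec m) hw,
    ae_restrict_mem (measurableSet_cellY d)] with y h1 h2 hy
  rw [h1, h2 (lt_norm_of_notMem_cellBox hc hm hy), smul_zero]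
  rfl

theorem gelfand_eq_sum {r : ℝ} {w : Lp (EuclideanSpace ℂ ι) 2 (volume : Measure (RSpace d))}
    (hw : ∀ᵐ z, r < ‖z‖ → w z = 0) :
    gelfand hc w = ∑ m ∈ cellBox d c r, zoneIso m (restrictCell hc (intVec m) w) := by
  conv_lhs => rw [eq_sum_cellFun hc w (cellBox d c r) fun m hm => restrictCell_eq_zero hc hw hm]
  rw [map_sum]
  simp_rw [gelfand_cellIso]

theorem gelfand_ae_eq_sum {r : ℝ} {w : Lp (EuclideanSpace ℂ ι) 2 (volume : Measure (RSpace d))}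
    (hw : ∀ᵐ z, r < ‖z‖ → w z = 0) :
    gelfand hc w =ᵐ[volΘ d] fun θ => ∑ m ∈ cellBox d c r,
      ((cellScale d (2 * Real.pi))⁻¹ * planeWave (-θ) (intVec m)) •
        restrictCell hc (intVec m) w := by
  rw [gelfand_eq_sum hc hw]
  filter_upwards [Lp.coeFn_finsetSum (cellBox d c r) fun m => zoneIso m (restrictCell hc (intVec m) w),
    ae_all_iff.2 fun m : Fin d → ℤ => zoneWave_coeFn m (restrictCell hc (intVec m) w)]
    with θ h1 h2
  rw [h1, Finset.sum_apply]
  exact Finset.sum_congr rfl fun m _ => h2 m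

/-- Compact support reduces the lattice sum to a finite box of cells, on which the transform is
explicit. The normalisations `c^{d/2}` and `(2π)^{-d/2}` of the two Hilbert sums combine to the
prescribed factor. -/
theorem isGelfandTransform_gelfand {n : ℕ} :
    IsGelfandTransform (n := n) (d := d) c (gelfand hc) := by
  intro f hf hfc F hF
  obtain ⟨r, hr⟩ := hfc.isCompact.isBounded.exists_norm_le
  have hf0 : ∀ z, r < ‖z‖ → f z = 0 := fun z hz =>
    image_eq_zero_of_notMem_tsupport fun h => absurd (hr z h) (not_le.2 hz)
  have hw : ∀ᵐ z, r < ‖z‖ → F z = 0 := by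
    filter_upwards [hF] with z hz h
    rw [hz, hf0 z h]
  filter_upwards [gelfand_ae_eq_sum hc hw] with θ hθ
  rw [hθ]
  filter_upwards [Lp.coeFn_finsetSum (cellBox d c r) fun m =>
      ((cellScale d (2 * Real.pi))⁻¹ * planeWave (-θ) (intVec m)) • restrictCell hc (intVec m) F,
    ae_all_iff.2 fun m : Fin d → ℤ => Lp.coeFn_smul
      ((cellScale d (2 * Real.pi))⁻¹ * planeWave (-θ) (intVec m)) (restrictCell hc (intVec m) F),
    ae_all_iff.2 fun m : Fin d → ℤ => restrictCell_coeFn hc (intVec m) F,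
    ae_all_iff.2 fun m : Fin d → ℤ => ae_volY_comp_smul_add hc (intVec m) hF,
    ae_restrict_mem (measurableSet_cellY d)] with y h1 h2 h3 h4 hy
  have e : ((c / (2 * Real.pi)) ^ ((d : ℝ) / 2) : ℝ)
      = c ^ ((d : ℝ) / 2) / (2 * Real.pi) ^ ((d : ℝ) / 2) :=
    Real.div_rpow hc.le Real.two_pi_pos.le _
  rw [h1, Finset.sum_apply, tsum_eq_sum (s := cellBox d c r) fun m hm => by
    rw [hf0 _ (lt_norm_of_notMem_cellBox hc hm hy), smul_zero], Finset.smul_sum]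
  refine Finset.sum_congr rfl fun m _ => ?_
  rw [h2, Pi.smul_apply, h3, h4, e, ← Complex.coe_smul, smul_smul, smul_smul]
  congr 1
  rw [Complex.ofReal_div, cellScale, cellScale]
  ring

end ZoneWave

/-! ### Multiplication operators and the Gelfand transform -/

section Intertwine

variable {ι ι' : Type} [Fintype ι] [Fintype ι'] {d : ℕ} {c : ℝ} (hc : 0 < c)

theorem memLp_comp_inv_smul {F : Type*} [NormedAddCommGroup F] (hc : 0 < c) {p : ENNReal}
    {f : RSpace d → F} (hf : MemLp f p volume) : MemLp (fun z => f (c⁻¹ • z)) p volume := by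
  have := memLp_comp_smul_sub hc (0 : RSpace d) hf
  simpa using this

/-- Periodicity makes the rescaled coefficient look the same on every cell, which is the hypothesis
of `gelfand_intertwine`. -/
theorem mulOp_cellIso {a : RSpace d → (EuclideanSpace ℂ ι →L[ℂ] EuclideanSpace ℂ ι)}
    (ha : PeriodicCoercive a) (m : Fin d → ℤ) (x : Lp (EuclideanSpace ℂ ι) 2 (volY d)) :
    mulOp volume (fun z => a (c⁻¹ • z)) (cellIso hc m x)
      = cellIso hc m (mulOp (volY d) a x) := by
  have h0 : ∀ᵐ z : RSpace d, a (c⁻¹ • z) = a (c⁻¹ • z - intVec m) := by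
    filter_upwards [(quasiMeasurePreserving_smul_sub hc (intVec m)).ae (ha.periodic m)] with z hz
    rwa [sub_add_cancel] at hz
  refine Lp.ext ?_
  rw [cellIso_apply, cellIso_apply]
  filter_upwards [mulOp_coeFn (memLp_comp_inv_smul hc ha.memLp) (cellFun hc (intVec m) x),
    cellFun_coeFn hc (intVec m) x,
    cellFun_congr hc (intVec m) _ (mulOp_coeFn (ha.memLp.restrict (cellY d)) x), h0]
    with z h1 h2 h3 h4
  rw [h1, h2, h3, h4, map_smul]
  congr 1
  by_cases hz : c⁻¹ • z - intVec m ∈ cellY d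
  · rw [Set.indicator_of_mem hz, Set.indicator_of_mem hz]
  · rw [Set.indicator_of_notMem hz, Set.indicator_of_notMem hz, map_zero]

theorem compLpL_cellIso (L : EuclideanSpace ℂ ι →L[ℂ] EuclideanSpace ℂ ι') (m : Fin d → ℤ)
    (x : Lp (EuclideanSpace ℂ ι) 2 (volY d)) :
    L.compLpL 2 volume (cellIso hc m x) = cellIso hc m (L.compLpL 2 (volY d) x) := by
  refine Lp.ext ?_
  rw [cellIso_apply, cellIso_apply]
  filter_upwards [coeFn_compLpL (p := 2) (μ := volume) L (cellFun hc (intVec m) x),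
    cellFun_coeFn hc (intVec m) x,
    cellFun_congr hc (intVec m) _ (coeFn_compLpL (p := 2) (μ := volY d) L x)] with z h1 h2 h3
  rw [h1, h2, h3, map_smul]
  congr 1
  by_cases hz : c⁻¹ • z - intVec m ∈ cellY d
  · rw [Set.indicator_of_mem hz, Set.indicator_of_mem hz]
  · rw [Set.indicator_of_notMem hz, Set.indicator_of_notMem hz, map_zero]

theorem gelfand_mulOp {a : RSpace d → (EuclideanSpace ℂ ι →L[ℂ] EuclideanSpace ℂ ι)}
    (ha : PeriodicCoercive a)
    (w : Lp (EuclideanSpace ℂ ι) 2 (volume : Measure (RSpace d))) :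
    gelfand hc (mulOp volume (fun z => a (c⁻¹ • z)) w)
      =ᵐ[volΘ d] fun θ => mulOp (volY d) a (gelfand hc w θ) :=
  gelfand_intertwine hc (mulOp_cellIso hc ha) w

theorem gelfand_col {n : ℕ} (j : Fin d) (g : L2RTen n d) :
    gelfand hc (col n volume j g) =ᵐ[volΘ d] fun θ => col n (volY d) j (gelfand hc g θ) :=
  gelfand_intertwine hc (compLpL_cellIso hc _) g

end Intertwine

/-! ### Test functions -/

/-- Smooth compactly supported functions. -/
structure TestFun (d : ℕ) where
  /-- The function. -/
  toFun : RSpace d → ℂ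
  contDiff : ContDiff ℝ ((⊤ : ℕ∞) : WithTop ℕ∞) toFun
  hasCompactSupport : HasCompactSupport toFun

namespace TestFun

variable {n d : ℕ}

/-- Partial derivatives of test functions. -/
def deriv (φ : TestFun d) (j : Fin d) : TestFun d where
  toFun x := fderiv ℝ φ.toFun x (basisVec j)
  contDiff := (φ.contDiff.fderiv_right (by norm_cast)).clm_apply contDiff_const
  hasCompactSupport := φ.hasCompactSupport.fderiv_apply (𝕜 := ℝ) (basisVec j)

/-- Complex conjugation. -/
def conj (φ : TestFun d) : TestFun d where
  toFun x := starRingEnd ℂ (φ.toFun x)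
  contDiff := Complex.conjCLE.contDiff.comp φ.contDiff
  hasCompactSupport := φ.hasCompactSupport.comp_left (map_zero _)

/-- Products with smooth functions. -/
def mul (φ : TestFun d) (ψ : RSpace d → ℂ) (hψ : ContDiff ℝ ((⊤ : ℕ∞) : WithTop ℕ∞) ψ) :
    TestFun d where
  toFun x := φ.toFun x * ψ x
  contDiff := φ.contDiff.mul hψ
  hasCompactSupport := φ.hasCompactSupport.mul_right

theorem deriv_conj (φ : TestFun d) (j : Fin d) : φ.conj.deriv j = (φ.deriv j).conj := by
  have h : ∀ x, fderiv ℝ φ.conj.toFun x (basisVec j)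
      = starRingEnd ℂ (fderiv ℝ φ.toFun x (basisVec j)) := fun x => by
    have h1 := (Complex.conjCLE : ℂ ≃L[ℝ] ℂ).toContinuousLinearMap.hasFDerivAt.comp x
      (φ.contDiff.differentiable (by simp) x).hasFDerivAt
    exact congrArg (fun L : RSpace d →L[ℝ] ℂ => L (basisVec j)) h1.fderiv
  rw [deriv, conj]
  congr 1
  exact funext h

theorem conj_conj (φ : TestFun d) : φ.conj.conj = φ := by
  cases φ
  simp [conj]

theorem fderiv_mul (φ : TestFun d) (ψ : RSpace d → ℂ)
    (hψ : ContDiff ℝ ((⊤ : ℕ∞) : WithTop ℕ∞) ψ) (j : Fin d) (x : RSpace d) :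
    ((φ.mul ψ hψ).deriv j).toFun x
      = (φ.deriv j).toFun x * ψ x + φ.toFun x * fderiv ℝ ψ x (basisVec j) := by
  have h := ((φ.contDiff.differentiable (by simp) x).hasFDerivAt.mul
    (hψ.differentiable (by simp) x).hasFDerivAt).fderiv
  refine (congrArg (fun L : RSpace d →L[ℝ] ℂ => L (basisVec j)) h).trans ?_
  simp only [add_apply, smul_apply, smul_eq_mul, deriv]
  ring

theorem memLp (φ : TestFun d) (v : Vec n) : MemLp (fun x => φ.toFun x • v) 2 volume :=
  (φ.contDiff.continuous.smul continuous_const).memLp_of_hasCompactSupport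
    φ.hasCompactSupport.smul_right

/-- The vector field `φ v` in `L²`. -/
def lp (φ : TestFun d) (v : Vec n) : L2R n d := (φ.memLp v).toLp _

theorem lp_coeFn (φ : TestFun d) (v : Vec n) : φ.lp v =ᵐ[volume] fun x => φ.toFun x • v :=
  (φ.memLp v).coeFn_toLp

theorem inner_lp (φ : TestFun d) (v : Vec n) (u : L2R n d) :
    inner ℂ (φ.lp v) u = ∫ x, φ.conj.toFun x * inner ℂ v (u x) := by
  rw [L2.inner_def]
  refine integral_congr_ae ?_
  filter_upwards [φ.lp_coeFn v] with x hx
  rw [hx, inner_smul_left]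
  rfl

theorem inner_lp_single (φ : TestFun d) (i : Fin n) (u : L2R n d) :
    inner ℂ (φ.lp (EuclideanSpace.single i (1 : ℂ))) u = ∫ x, φ.conj.toFun x * u x i := by
  rw [inner_lp]
  simp_rw [EuclideanSpace.inner_single_left, map_one, one_mul]

theorem lp_eq_sum (φ : TestFun d) (v : Vec n) :
    φ.lp v = ∑ i, v i • φ.lp (EuclideanSpace.single i (1 : ℂ)) := by
  refine ext_inner_right ℂ fun u => ?_
  rw [sum_inner]
  simp_rw [inner_smul_left, inner_lp, ← integral_const_mul]
  rw [← integral_finsetSum]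
  · refine integral_congr_ae (Filter.Eventually.of_forall fun x => ?_)
    simp only
    conv_lhs => rw [← sum_smul_single v, sum_inner, Finset.mul_sum]
    refine Finset.sum_congr rfl fun i _ => ?_
    rw [inner_smul_left]
    ring
  · intro i _
    refine Integrable.const_mul ?_ _
    refine (L2.integrable_inner (𝕜 := ℂ) (φ.lp (EuclideanSpace.single i (1 : ℂ))) u).congr ?_
    filter_upwards [φ.lp_coeFn (EuclideanSpace.single i (1 : ℂ) : Vec n)] with x hx
    rw [hx, inner_smul_left]
    rfl

/-- The inner product conjugates its first argument, so the condition for `φ` is the defining one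
for `φ.conj`; conjugation is an involution on test functions that commutes with derivatives. -/
theorem mem_weakGradGraph_iff_single (u : L2R n d) (g : L2RTen n d) :
    (u, g) ∈ weakGradGraph n (Set.univ : Set (RSpace d)) volume ↔
      ∀ (φ : TestFun d) (i : Fin n) (j : Fin d),
        inner ℂ ((φ.deriv j).lp (EuclideanSpace.single i (1 : ℂ))) u
          + inner ℂ (φ.lp (EuclideanSpace.single i (1 : ℂ))) (col n volume j g) = 0 := by
  have hcol : ∀ (φ : TestFun d) (i : Fin n) (j : Fin d),
      inner ℂ (φ.lp (EuclideanSpace.single i (1 : ℂ))) (col n volume j g)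
        = ∫ x, φ.conj.toFun x * g x (i, j) := by
    intro φ i j
    rw [inner_lp_single]
    refine integral_congr_ae ?_
    filter_upwards [col_coeFn volume j g] with x hx
    rw [hx]
    rfl
  have hw : (u, g) ∈ weakGradGraph n (Set.univ : Set (RSpace d)) volume ↔
      IsWeakGrad Set.univ volume u g := Iff.rfl
  rw [hw]
  constructor
  · intro h φ i j
    rw [hcol, inner_lp_single, ← deriv_conj]
    exact add_eq_zero_iff_eq_neg.2
      (h φ.conj.toFun φ.conj.contDiff φ.conj.hasCompactSupport (Set.subset_univ _) i j)
  · intro h φ h1 h2 _ i j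
    have h3 := h (TestFun.conj ⟨φ, h1, h2⟩) i j
    rw [hcol, inner_lp_single, ← deriv_conj, conj_conj] at h3
    exact add_eq_zero_iff_eq_neg.1 h3

theorem mem_weakGradGraph_iff (u : L2R n d) (g : L2RTen n d) :
    (u, g) ∈ weakGradGraph n (Set.univ : Set (RSpace d)) volume ↔
      ∀ (φ : TestFun d) (v : Vec n) (j : Fin d),
        inner ℂ ((φ.deriv j).lp v) u + inner ℂ (φ.lp v) (col n volume j g) = 0 := by
  rw [mem_weakGradGraph_iff_single]
  refine ⟨fun h φ v j => ?_, fun h φ i j => h φ _ j⟩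
  rw [lp_eq_sum (φ.deriv j), lp_eq_sum φ, sum_inner, sum_inner, ← Finset.sum_add_distrib]
  refine Finset.sum_eq_zero fun i _ => ?_
  rw [inner_smul_left, inner_smul_left, ← mul_add, h, mul_zero]

/-- The gradient of the vector field `φ v`. -/
def gradLp (φ : TestFun d) (v : Vec n) : L2RTen n d :=
  ∑ j, ins n volume j ((φ.deriv j).lp v)

theorem col_gradLp (φ : TestFun d) (v : Vec n) (j : Fin d) :
    col n volume j (φ.gradLp v) = (φ.deriv j).lp v := by
  rw [gradLp, map_sum]
  simp [col_ins]

theorem mem_weakGradGraph (φ : TestFun d) (v : Vec n) :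
    (φ.lp v, φ.gradLp v) ∈ weakGradGraph n (Set.univ : Set (RSpace d)) volume := by
  refine (mem_weakGradGraph_iff _ _).2 fun ψ v' j => ?_
  have h1 : ∀ χ χ' : TestFun d, inner ℂ (χ.lp v') (χ'.lp v)
      = (∫ x, χ.conj.toFun x * χ'.toFun x) * inner ℂ v' v := by
    intro χ χ'
    rw [inner_lp, ← integral_mul_const]
    refine integral_congr_ae ?_
    filter_upwards [χ'.lp_coeFn v] with x hx
    rw [hx, inner_smul_right]
    ring
  rw [col_gradLp, h1, h1, ← add_mul, ← deriv_conj]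
  have h2 := integral_mul_fderiv_eq_neg_fderiv_mul_of_integrable (μ := volume)
    (f := ψ.conj.toFun) (g := φ.toFun) (v := basisVec j)
    ((((ψ.conj.deriv j).contDiff.continuous.mul
      φ.contDiff.continuous)).integrable_of_hasCompactSupport
        (ψ.conj.deriv j).hasCompactSupport.mul_right)
    ((ψ.conj.contDiff.continuous.mul (φ.deriv j).contDiff.continuous).integrable_of_hasCompactSupport
        ψ.conj.hasCompactSupport.mul_right)
    ((ψ.conj.contDiff.continuous.mul φ.contDiff.continuous).integrable_of_hasCompactSupport
        ψ.conj.hasCompactSupport.mul_right)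
    (fun x _ => ψ.conj.contDiff.differentiable (by simp) x)
    (fun x _ => φ.contDiff.differentiable (by simp) x)
  have h3 : ∫ x, ψ.conj.toFun x * (φ.deriv j).toFun x
      = - ∫ x, (ψ.conj.deriv j).toFun x * φ.toFun x := h2
  rw [h3, add_neg_cancel, zero_mul]

theorem exists_norm_lt (φ : TestFun d) : ∃ r : ℝ, ∀ z, r < ‖z‖ → φ.toFun z = 0 := by
  obtain ⟨r, hr⟩ := φ.hasCompactSupport.isCompact.isBounded.exists_norm_le
  exact ⟨r, fun z hz => image_eq_zero_of_notMem_tsupport fun h => absurd (hr z h) (not_le.2 hz)⟩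

theorem ae_gradLp_eq_zero (φ : TestFun d) (v : Vec n) {r : ℝ}
    (hr : ∀ j z, r < ‖z‖ → (φ.deriv j).toFun z = 0) :
    ∀ᵐ z, r < ‖z‖ → φ.gradLp v z = 0 := by
  filter_upwards [ae_all_iff.2 fun j : Fin d => col_coeFn volume j (φ.gradLp v),
    ae_all_iff.2 fun j : Fin d => (φ.deriv j).lp_coeFn v] with z h1 h2 hz
  ext ⟨i, j⟩
  have h3 := h1 j
  rw [col_gradLp, h2, hr j z hz, zero_smul] at h3
  exact (congrArg (fun w : Vec n => w i) h3).symm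

theorem eq_zero_of_inner (u : L2R n d) (h : ∀ (φ : TestFun d) (v : Vec n), inner ℂ (φ.lp v) u = 0) :
    u = 0 := by
  have key : ∀ i : Fin n, ∀ᵐ x, u x i = 0 := by
    intro i
    have hg : MemLp (fun x => u x i) 2 volume :=
      (EuclideanSpace.proj (𝕜 := ℂ) i).comp_memLp' (Lp.memLp u)
    refine ae_eq_zero_of_integral_contDiff_smul_eq_zero (hg.locallyIntegrable (by norm_num)) ?_
    intro ψ h1 h2
    have h3 := h ⟨fun x => (ψ x : ℂ), Complex.ofRealCLM.contDiff.comp h1,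
      h2.comp_left (g := fun r : ℝ => (r : ℂ)) (by simp)⟩ (EuclideanSpace.single i 1)
    rw [inner_lp_single] at h3
    simpa [conj] using h3
  refine Lp.eq_zero_iff_ae_eq_zero.2 ?_
  filter_upwards [ae_all_iff.2 key] with x hx
  ext i
  exact hx i

end TestFun

theorem dense_grad_domain (n d : ℕ) : Dense ((grad n d).domain : Set (L2R n d)) := by
  rw [Submodule.dense_iff_topologicalClosure_eq_top, Submodule.topologicalClosure_eq_top_iff,
    Submodule.eq_bot_iff]
  intro u hu
  refine TestFun.eq_zero_of_inner u fun φ v => ?_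
  refine (Submodule.mem_orthogonal _ _).1 hu _ ?_
  have h := φ.mem_weakGradGraph v
  rw [← grad_graph] at h
  exact LinearPMap.mem_domain_of_mem_graph h

/-! ### The gradient and the Gelfand transform -/

section Gradient

variable {n d : ℕ} {c : ℝ} (hc : 0 < c)

theorem contDiff_planeWave_top (η : RSpace d) :
    ContDiff ℝ ((⊤ : ℕ∞) : WithTop ℕ∞) (planeWave η) := contDiff_planeWave η

/-- Modulation of a test function. -/
def TestFun.wave (χ : TestFun d) (η : RSpace d) : TestFun d :=
  χ.mul (planeWave η) (contDiff_planeWave_top η)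

theorem intVec_add_planeWave (θ y : RSpace d) (k m : Fin d → ℤ) :
    planeWave (freq θ k) (y + intVec m) = planeWave (freq θ k) y * planeWave θ (intVec m) := by
  rw [planeWave_add_right, planeWave_freq_intVec]

/-- Where `w` does not vanish the cutoff equals one, so the modulated test function acts as a pure
plane wave. On the `m`-th cell this wave is `e^{iθ·m}` times the wave of frequency `θ + 2πk` on `Y`.
-/
theorem inner_restrictCell_wave {r : ℝ} {w : L2R n d} (hw : ∀ᵐ z, r < ‖z‖ → w z = 0)
    {χ : TestFun d} (hχ : ∀ z, ‖z‖ ≤ r → χ.toFun z = 1) (θ : RSpace d) (k m : Fin d → ℤ)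
    (v : Vec n) :
    inner ℂ (restrictCell hc (intVec m) ((χ.wave (c⁻¹ • freq θ k)).lp v))
        (restrictCell hc (intVec m) w)
      = cellScale d c * (planeWave (-θ) (intVec m) *
        inner ℂ (waveLp (freq θ k) v) (restrictCell hc (intVec m) w)) := by
  rw [inner_waveLp, L2.inner_def, ← integral_const_mul, ← integral_const_mul]
  refine integral_congr_ae ?_
  filter_upwards [restrictCell_coeFn hc (intVec m) ((χ.wave (c⁻¹ • freq θ k)).lp v),
    restrictCell_coeFn hc (intVec m) w, ae_volY_comp_smul_add hc (intVec m) hw,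
    ae_volY_comp_smul_add hc (intVec m) ((χ.wave (c⁻¹ • freq θ k)).lp_coeFn v)] with y h1 h2 h3 h4
  rw [h1, h4]
  by_cases hr : r < ‖c • (y + intVec m)‖
  · rw [h2, h3 hr]
    simp
  · have e : (χ.wave (c⁻¹ • freq θ k)).toFun (c • (y + intVec m))
        = planeWave (freq θ k) y * planeWave θ (intVec m) := by
      have : (χ.wave (c⁻¹ • freq θ k)).toFun (c • (y + intVec m))
        = χ.toFun (c • (y + intVec m)) * planeWave (c⁻¹ • freq θ k) (c • (y + intVec m)) := rfl
      rw [this, hχ _ (not_lt.1 hr), one_mul, planeWave_smul_comm, smul_smul,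
        mul_inv_cancel₀ hc.ne', one_smul, intVec_add_planeWave]
    rw [e, inner_smul_left, inner_smul_left, map_mul, conj_cellScale, ← planeWave_neg_left,
      ← planeWave_neg_left]
    ring

/-- Summing over the cells, the Fourier coefficients of the fibre at `θ` are, up to normalisation,
the Fourier transform of `w` at the frequencies `c⁻¹(θ + 2πk)`. -/
theorem inner_waveLp_gelfand {r : ℝ} {w : L2R n d} (hw : ∀ᵐ z, r < ‖z‖ → w z = 0)
    {χ : TestFun d} (hχ : ∀ z, ‖z‖ ≤ r → χ.toFun z = 1) :
    ∀ᵐ θ ∂volΘ d, ∀ (k : Fin d → ℤ) (v : Vec n),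
      inner ℂ (waveLp (freq θ k) v) (gelfand hc w θ)
        = ((cellScale d (2 * Real.pi))⁻¹ * (cellScale d c)⁻¹) *
          inner ℂ ((χ.wave (c⁻¹ • freq θ k)).lp v) w := by
  filter_upwards [gelfand_ae_eq_sum hc hw] with θ hθ k v
  conv_rhs => rw [eq_sum_cellFun hc w (cellBox d c r) fun m hm => restrictCell_eq_zero hc hw hm]
  rw [hθ, inner_sum, inner_sum, Finset.mul_sum]
  refine Finset.sum_congr rfl fun m _ => ?_
  rw [inner_smul_right, cellIso_apply,
    ← inner_conj_symm ((χ.wave (c⁻¹ • freq θ k)).lp v), inner_cellFun, inner_conj_symm,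
    inner_restrictCell_wave hc hw hχ]
  have := cellScale_ne_zero (d := d) hc
  field_simp

theorem exists_cutoff (d : ℕ) (r : ℝ) : ∃ χ : TestFun d, ∀ z, ‖z‖ < r → χ.toFun z = 1 := by
  have h1 : 0 < max r 1 := lt_max_of_lt_right one_pos
  let b : ContDiffBump (0 : RSpace d) := ⟨max r 1, max r 1 + 1, h1, by linarith⟩
  refine ⟨⟨fun z => (b z : ℂ), Complex.ofRealCLM.contDiff.comp b.contDiff,
    b.hasCompactSupport.comp_left (g := fun r : ℝ => (r : ℂ)) (by simp)⟩, fun z hz => ?_⟩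
  have : b z = 1 := b.one_of_mem_closedBall (by
    rw [mem_closedBall_zero_iff]
    exact hz.le.trans (le_max_left _ _))
  simp [this]

/-- Testing the weak gradient with a truncated wave of frequency `c⁻¹(θ + 2πk)` multiplies by `i
c⁻¹(θ + 2πk)_j`, since the cutoff is constant where `w` lives. This is the Fourier criterion for the
fibre graph, once the gradient is multiplied by the scale `c`. -/
theorem ae_mem_gradThetaGraph_gelfand {r : ℝ} {w : L2R n d} {q : L2RTen n d}
    (h : (w, q) ∈ weakGradGraph n (Set.univ : Set (RSpace d)) volume)
    (hw : ∀ᵐ z, r < ‖z‖ → w z = 0) (hq : ∀ᵐ z, r < ‖z‖ → q z = 0) :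
    ∀ᵐ θ ∂volΘ d, (gelfand hc w θ, (c : ℂ) • gelfand hc q θ) ∈ gradThetaGraph n θ := by
  -- Radius `r + 1`, so that `χ` is constant near every point of the closed ball of radius `r` and
  -- its derivatives vanish there.
  obtain ⟨χ, hχ⟩ := exists_cutoff d (r + 1)
  have hχ' : ∀ z, ‖z‖ ≤ r → χ.toFun z = 1 := fun z hz => hχ z (by linarith)
  have hdχ : ∀ (j : Fin d) z, ‖z‖ ≤ r → (χ.deriv j).toFun z = 0 := by
    intro j z hz
    have : χ.toFun =ᶠ[nhds z] fun _ => 1 := by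
      filter_upwards [(isOpen_lt continuous_norm continuous_const).mem_nhds
        (show ‖z‖ < r + 1 by linarith)] with y hy using hχ y hy
    change fderiv ℝ χ.toFun z (basisVec j) = 0
    rw [this.fderiv_eq]
    simp
  have hqj : ∀ j : Fin d, ∀ᵐ z, r < ‖z‖ → col n volume j q z = 0 := fun j => by
    filter_upwards [hq, col_coeFn volume j q] with z h1 h2 hz
    rw [h2, h1 hz, map_zero]
  filter_upwards [inner_waveLp_gelfand hc hw hχ',
    ae_all_iff.2 fun j : Fin d => inner_waveLp_gelfand hc (hqj j) hχ',
    ae_all_iff.2 fun j : Fin d => gelfand_col hc j q] with θ h1 h2 h3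
  refine (mem_gradThetaGraph_iff θ _ _).2 fun k v j => ?_
  have key : inner ℂ ((χ.wave (c⁻¹ • freq θ k)).lp v) (col n volume j q)
      = Complex.I * ((c⁻¹ * freq θ k j : ℝ) : ℂ) * inner ℂ ((χ.wave (c⁻¹ • freq θ k)).lp v) w := by
    have h4 := (TestFun.mem_weakGradGraph_iff w q).1 h (χ.wave (c⁻¹ • freq θ k)) v j
    have h5 : inner ℂ (((χ.wave (c⁻¹ • freq θ k)).deriv j).lp v) w
        = - (Complex.I * ((c⁻¹ * freq θ k j : ℝ) : ℂ)) *
          inner ℂ ((χ.wave (c⁻¹ • freq θ k)).lp v) w := by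
      rw [TestFun.inner_lp, TestFun.inner_lp, ← integral_const_mul]
      refine integral_congr_ae ?_
      filter_upwards [hw] with z hz
      by_cases hr : r < ‖z‖
      · rw [hz hr]
        simp
      · have e1 : ((χ.wave (c⁻¹ • freq θ k)).deriv j).toFun z
            = Complex.I * ((c⁻¹ * freq θ k j : ℝ) : ℂ) * (χ.wave (c⁻¹ • freq θ k)).toFun z := by
          rw [TestFun.wave, TestFun.fderiv_mul, hdχ j z (not_lt.1 hr), fderiv_planeWave]
          change _ = _ * (χ.toFun z * planeWave (c⁻¹ • freq θ k) z)
          simp only [PiLp.smul_apply, smul_eq_mul]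
          ring
        change starRingEnd ℂ (((χ.wave (c⁻¹ • freq θ k)).deriv j).toFun z) * _
          = _ * (starRingEnd ℂ ((χ.wave (c⁻¹ • freq θ k)).toFun z) * _)
        rw [e1, map_mul, map_mul, Complex.conj_I, Complex.conj_ofReal]
        ring
    rw [h5] at h4
    linear_combination h4
  rw [map_smul, inner_smul_right, ← h3 j, h2 j k v, h1 k v, key]
  have : (c : ℂ) ≠ 0 := Complex.ofReal_ne_zero.2 hc.ne'
  push_cast
  field_simp

theorem inner_gelfand {ι : Type} [Fintype ι]
    (u w : Lp (EuclideanSpace ℂ ι) 2 (volume : Measure (RSpace d))) :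
    inner ℂ u w = ∫ θ in zoneΘ d, inner ℂ (gelfand hc u θ) (gelfand hc w θ) := by
  rw [← (gelfand hc).inner_map_map u w, L2.inner_def]

theorem integrable_inner_gelfand {ι : Type} [Fintype ι]
    (u w : Lp (EuclideanSpace ℂ ι) 2 (volume : Measure (RSpace d))) :
    Integrable (fun θ => (inner ℂ (gelfand hc u θ) (gelfand hc w θ) : ℂ)) (volΘ d) :=
  L2.integrable_inner _ _

theorem inner_add_inner_eq_zero_of_gelfand {ι ι' : Type} [Fintype ι] [Fintype ι']
    {u v : Lp (EuclideanSpace ℂ ι) 2 (volume : Measure (RSpace d))}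
    {u' v' : Lp (EuclideanSpace ℂ ι') 2 (volume : Measure (RSpace d))}
    (h : ∀ᵐ θ ∂volΘ d, inner ℂ (gelfand hc u θ) (gelfand hc v θ)
      + inner ℂ (gelfand hc u' θ) (gelfand hc v' θ) = (0 : ℂ)) :
    inner ℂ u v + inner ℂ u' v' = (0 : ℂ) := by
  rw [inner_gelfand hc u, inner_gelfand hc u',
    ← integral_add (integrable_inner_gelfand hc _ _) (integrable_inner_gelfand hc _ _),
    integral_congr_ae h, integral_zero]

/-- A test function and its gradient have fibres in the same graphs by the compactly supported case.
Integrating the fibrewise integration by parts over `θ` yields the defining identity of the weak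
gradient. -/
theorem mem_weakGradGraph_of_gelfand {u : L2R n d} {g : L2RTen n d}
    (h : ∀ᵐ θ ∂volΘ d, (gelfand hc u θ, (c : ℂ) • gelfand hc g θ) ∈ gradThetaGraph n θ) :
    (u, g) ∈ weakGradGraph n (Set.univ : Set (RSpace d)) volume := by
  refine (TestFun.mem_weakGradGraph_iff u g).2 fun φ v j => ?_
  have hsupp : ∃ r : ℝ, (∀ᵐ z, r < ‖z‖ → φ.lp v z = 0) ∧
      ∀ᵐ z, r < ‖z‖ → φ.gradLp v z = 0 := by
    obtain ⟨r₀, h0⟩ := φ.exists_norm_lt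
    choose r hr using fun j => (φ.deriv j).exists_norm_lt
    have hle : ∀ j, r j ≤ r₀ + ∑ j, |r j - r₀| := by
      intro j
      have : |r j - r₀| ≤ ∑ j, |r j - r₀| := Finset.single_le_sum (f := fun j => |r j - r₀|)
        (fun _ _ => abs_nonneg _) (Finset.mem_univ j)
      have h2 := le_abs_self (r j - r₀)
      linarith
    have hle0 : r₀ ≤ r₀ + ∑ j, |r j - r₀| :=
      le_add_of_nonneg_right (Finset.sum_nonneg fun _ _ => abs_nonneg _)
    -- A common radius for the function and all its partial derivatives.
    refine ⟨r₀ + ∑ j, |r j - r₀|, ?_, φ.ae_gradLp_eq_zero v fun j z hz => hr j z ?_⟩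
    · filter_upwards [φ.lp_coeFn v] with z hz hlt
      rw [hz, h0 z (hle0.trans_lt hlt), zero_smul]
    · exact (hle j).trans_lt hz
  obtain ⟨r, hr1, hr2⟩ := hsupp
  have h1 := ae_mem_gradThetaGraph_gelfand hc (φ.mem_weakGradGraph v) hr1 hr2
  rw [← φ.col_gradLp v j]
  refine inner_add_inner_eq_zero_of_gelfand hc ?_
  filter_upwards [h, h1, gelfand_col hc j g, gelfand_col hc j (φ.gradLp v)] with θ h2 h3 h4 h5
  have h6 := inner_col_add_inner_col θ h2 h3 j
  rw [map_smul, map_smul, ← h4, ← h5, inner_smul_left, inner_smul_right, Complex.conj_ofReal,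
    ← mul_add] at h6
  exact (mul_eq_zero.1 h6).resolve_left (Complex.ofReal_ne_zero.2 hc.ne')

end Gradient

/-! ### Cutoff -/

section Cutoff

variable {n d : ℕ}

/-- The cutoff `χ(·/(k+1))`. -/
theorem exists_cutoff_sequence (d : ℕ) : ∃ (χ : ℕ → TestFun d) (C : ℝ),
    (∀ k z, ‖(χ k).toFun z‖ ≤ C) ∧ (∀ k j z, ‖((χ k).deriv j).toFun z‖ ≤ C) ∧
    (∀ z, Filter.Tendsto (fun k => (χ k).toFun z) Filter.atTop (nhds 1)) ∧
    ∀ j z, Filter.Tendsto (fun k => ((χ k).deriv j).toFun z) Filter.atTop (nhds 0) := by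
  obtain ⟨χ, hχ⟩ := exists_cutoff d 1
  have hpos : ∀ k : ℕ, (0 : ℝ) < ((k : ℝ) + 1)⁻¹ := fun k => by positivity
  let χs : ℕ → TestFun d := fun k => ⟨fun z => χ.toFun (((k : ℝ) + 1)⁻¹ • z),
    χ.contDiff.comp (contDiff_const_smul _),
    χ.hasCompactSupport.comp_smul (hpos k).ne'⟩
  have hd : ∀ k j z, ((χs k).deriv j).toFun z
      = (((k : ℝ) + 1)⁻¹ : ℝ) • (χ.deriv j).toFun (((k : ℝ) + 1)⁻¹ • z) := by
    intro k j z
    have h1 := (χ.contDiff.differentiable (by simp) (((k : ℝ) + 1)⁻¹ • z)).hasFDerivAt.comp z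
      (((k : ℝ) + 1)⁻¹ • ContinuousLinearMap.id ℝ (RSpace d)).hasFDerivAt
    refine (congrArg (fun L : RSpace d →L[ℝ] ℂ => L (basisVec j)) h1.fderiv).trans ?_
    simp [TestFun.deriv]
  obtain ⟨C, hC⟩ := χ.contDiff.continuous.bounded_above_of_compact_support χ.hasCompactSupport
  choose Cj hCj using fun j => (χ.deriv j).contDiff.continuous.bounded_above_of_compact_support
    (χ.deriv j).hasCompactSupport
  have hC0 : 0 ≤ C := (norm_nonneg _).trans (hC 0)
  have hCj0 : ∀ j, 0 ≤ Cj j := fun j => (norm_nonneg _).trans (hCj j 0)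
  have hinv : ∀ k : ℕ, ((k : ℝ) + 1)⁻¹ ≤ 1 := fun k => inv_le_one_of_one_le₀ (by
    have : (0 : ℝ) ≤ k := k.cast_nonneg
    linarith)
  have hinv0 : Filter.Tendsto (fun k : ℕ => ((k : ℝ) + 1)⁻¹) Filter.atTop (nhds 0) := by
    simpa [one_div] using tendsto_one_div_add_atTop_nhds_zero_nat (𝕜 := ℝ)
  have hdle : ∀ k j z, ‖((χs k).deriv j).toFun z‖ ≤ ((k : ℝ) + 1)⁻¹ * Cj j := fun k j z => by
    rw [hd, norm_smul, Real.norm_of_nonneg (hpos k).le]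
    exact mul_le_mul_of_nonneg_left (hCj j _) (hpos k).le
  refine ⟨χs, C + ∑ j, Cj j, fun k z => ?_, fun k j z => ?_, fun z => ?_, fun j z => ?_⟩
  · exact (hC _).trans (le_add_of_nonneg_right (Finset.sum_nonneg fun j _ => hCj0 j))
  · refine (hdle k j z).trans (le_trans ?_ (le_add_of_nonneg_left hC0))
    exact (mul_le_of_le_one_left (hCj0 j) (hinv k)).trans
      (Finset.single_le_sum (fun j _ => hCj0 j) (Finset.mem_univ j))
  · refine tendsto_const_nhds.congr' ?_
    have : Filter.Tendsto (fun k : ℕ => ‖((k : ℝ) + 1)⁻¹ • z‖) Filter.atTop (nhds 0) := by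
      simpa using (hinv0.smul_const z).norm
    filter_upwards [this.eventually (gt_mem_nhds one_pos)] with k hk
    exact (hχ _ hk).symm
  · refine squeeze_zero_norm (fun k => hdle k j z) ?_
    simpa using hinv0.mul_const (Cj j)

theorem TestFun.memLp_top (χ : TestFun d) {ι : Type} [Fintype ι] :
    MemLp (fun x => χ.toFun x • ContinuousLinearMap.id ℂ (EuclideanSpace ℂ ι)) ⊤
      (volume : Measure (RSpace d)) := by
  obtain ⟨C, hC⟩ := χ.contDiff.continuous.bounded_above_of_compact_support χ.hasCompactSupport
  refine memLp_top_of_bound (χ.contDiff.continuous.smul continuous_const).aestronglyMeasurable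
    (C * ‖ContinuousLinearMap.id ℂ (EuclideanSpace ℂ ι)‖) (Filter.Eventually.of_forall fun x => ?_)
  rw [norm_smul]
  exact mul_le_mul_of_nonneg_right (hC x) (norm_nonneg _)

/-- Multiplication by a test function. -/
def TestFun.mulL (χ : TestFun d) (ι : Type) [Fintype ι] :
    Lp (EuclideanSpace ℂ ι) 2 (volume : Measure (RSpace d)) →L[ℂ]
      Lp (EuclideanSpace ℂ ι) 2 (volume : Measure (RSpace d)) :=
  mulOp volume fun x => χ.toFun x • ContinuousLinearMap.id ℂ (EuclideanSpace ℂ ι)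

theorem TestFun.mulL_coeFn (χ : TestFun d) {ι : Type} [Fintype ι]
    (u : Lp (EuclideanSpace ℂ ι) 2 (volume : Measure (RSpace d))) :
    χ.mulL ι u =ᵐ[volume] fun x => χ.toFun x • u x := mulOp_coeFn χ.memLp_top u

/-- The gradient of the product of a test function with a Sobolev function. -/
def TestFun.gradMul (χ : TestFun d) (w : L2R n d) (q : L2RTen n d) : L2RTen n d :=
  χ.mulL (Fin n × Fin d) q + ∑ j, ins n volume j ((χ.deriv j).mulL (Fin n) w)

theorem TestFun.inner_mulL (χ : TestFun d) {ι : Type} [Fintype ι]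
    (u f : Lp (EuclideanSpace ℂ ι) 2 (volume : Measure (RSpace d))) :
    inner ℂ f (χ.mulL ι u) = ∫ x, χ.toFun x * inner ℂ (f x) (u x) := by
  rw [L2.inner_def]
  refine integral_congr_ae ?_
  filter_upwards [χ.mulL_coeFn u] with x hx
  rw [hx, inner_smul_right]

theorem TestFun.col_mulL (χ : TestFun d) (q : L2RTen n d) (j : Fin d) :
    col n volume j (χ.mulL (Fin n × Fin d) q) = χ.mulL (Fin n) (col n volume j q) := by
  refine Lp.ext ?_
  filter_upwards [col_coeFn volume j (χ.mulL (Fin n × Fin d) q), χ.mulL_coeFn q,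
    χ.mulL_coeFn (col n volume j q), col_coeFn volume j q] with x h1 h2 h3 h4
  rw [h1, h2, h3, h4, map_smul]

theorem TestFun.col_gradMul (χ : TestFun d) (w : L2R n d) (q : L2RTen n d) (j : Fin d) :
    col n volume j (χ.gradMul w q)
      = χ.mulL (Fin n) (col n volume j q) + (χ.deriv j).mulL (Fin n) w := by
  rw [gradMul, map_add, map_sum, col_mulL]
  simp [col_ins]

theorem TestFun.inner_lp_mulL (φ χ : TestFun d) (v : Vec n) (u : L2R n d) :
    inner ℂ (φ.lp v) (χ.mulL (Fin n) u)
      = inner ℂ ((φ.mul χ.conj.toFun χ.conj.contDiff).lp v) u := by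
  rw [inner_mulL, inner_lp]
  refine integral_congr_ae ?_
  filter_upwards [φ.lp_coeFn v] with x hx
  have : (φ.mul χ.conj.toFun χ.conj.contDiff).conj.toFun x
      = starRingEnd ℂ (φ.toFun x * starRingEnd ℂ (χ.toFun x)) := rfl
  rw [hx, inner_smul_left, this, map_mul, Complex.conj_conj]
  ring

theorem TestFun.lp_add_of_toFun (φ ψ χ : TestFun d) (h : ∀ x, φ.toFun x = ψ.toFun x + χ.toFun x)
    (v : Vec n) : φ.lp v = ψ.lp v + χ.lp v := by
  refine Lp.ext ?_
  filter_upwards [φ.lp_coeFn v, ψ.lp_coeFn v, χ.lp_coeFn v, Lp.coeFn_add (ψ.lp v) (χ.lp v)]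
    with x h1 h2 h3 h4
  rw [h4, Pi.add_apply, h1, h2, h3, h, add_smul]

/-- The product rule: move `χ` to the test function, apply the weak identity for `w` to the product,
and expand the derivative of that product. -/
theorem TestFun.gradMul_mem (χ : TestFun d) {w : L2R n d} {q : L2RTen n d}
    (h : (w, q) ∈ weakGradGraph n (Set.univ : Set (RSpace d)) volume) :
    (χ.mulL (Fin n) w, χ.gradMul w q) ∈ weakGradGraph n (Set.univ : Set (RSpace d)) volume := by
  refine (mem_weakGradGraph_iff _ _).2 fun φ v j => ?_
  have h1 := (mem_weakGradGraph_iff w q).1 h (φ.mul χ.conj.toFun χ.conj.contDiff) v j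
  have h2 : ((φ.mul χ.conj.toFun χ.conj.contDiff).deriv j).lp v
      = ((φ.deriv j).mul χ.conj.toFun χ.conj.contDiff).lp v
        + (φ.mul (χ.deriv j).conj.toFun (χ.deriv j).conj.contDiff).lp v := by
    refine lp_add_of_toFun _ _ _ (fun x => ?_) v
    rw [fderiv_mul]
    have : fderiv ℝ χ.conj.toFun x (basisVec j) = (χ.deriv j).conj.toFun x :=
      congrArg (fun ψ : TestFun d => ψ.toFun x) (χ.deriv_conj j)
    rw [this]
    rfl
  rw [h2, inner_add_left] at h1
  rw [col_gradMul, inner_add_right, inner_lp_mulL, inner_lp_mulL, inner_lp_mulL]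
  linear_combination h1

theorem TestFun.ae_mulL_eq_zero (χ : TestFun d) {ι : Type} [Fintype ι] {r : ℝ}
    (hr : ∀ z, r < ‖z‖ → χ.toFun z = 0)
    (u : Lp (EuclideanSpace ℂ ι) 2 (volume : Measure (RSpace d))) :
    ∀ᵐ z, r < ‖z‖ → χ.mulL ι u z = 0 := by
  filter_upwards [χ.mulL_coeFn u] with z hz h
  rw [hz, hr z h, zero_smul]

theorem TestFun.deriv_eq_zero (χ : TestFun d) {r : ℝ} (hr : ∀ z, r < ‖z‖ → χ.toFun z = 0)
    (j : Fin d) (z : RSpace d) (hz : r < ‖z‖) : (χ.deriv j).toFun z = 0 := by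
  have : χ.toFun =ᶠ[nhds z] fun _ => 0 := by
    filter_upwards [(isOpen_lt continuous_const continuous_norm).mem_nhds hz] with y hy
    exact hr y hy
  change fderiv ℝ χ.toFun z (basisVec j) = 0
  rw [this.fderiv_eq]
  simp

theorem ten_ae_eq_zero {q : L2RTen n d} {r : ℝ}
    (h : ∀ j : Fin d, ∀ᵐ z, r < ‖z‖ → col n volume j q z = 0) : ∀ᵐ z, r < ‖z‖ → q z = 0 := by
  filter_upwards [ae_all_iff.2 h, ae_all_iff.2 fun j : Fin d => col_coeFn volume j q]
    with z h1 h2 hz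
  ext ⟨i, j⟩
  have h3 := h1 j hz
  rw [h2] at h3
  exact congrArg (fun w : Vec n => w i) h3

theorem TestFun.ae_gradMul_eq_zero (χ : TestFun d) {r : ℝ} (hr : ∀ z, r < ‖z‖ → χ.toFun z = 0)
    (w : L2R n d) (q : L2RTen n d) : ∀ᵐ z, r < ‖z‖ → χ.gradMul w q z = 0 := by
  refine ten_ae_eq_zero fun j => ?_
  rw [col_gradMul]
  filter_upwards [χ.ae_mulL_eq_zero hr (col n volume j q),
    (χ.deriv j).ae_mulL_eq_zero (χ.deriv_eq_zero hr j) w,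
    Lp.coeFn_add (χ.mulL (Fin n) (col n volume j q)) ((χ.deriv j).mulL (Fin n) w)]
    with z h1 h2 h3 hz
  rw [h3, Pi.add_apply, h1 hz, h2 hz, add_zero]

/-- Dominated convergence. The limit `t` is one for the cutoffs and zero for their derivatives;
convergence of inner products is all that is used. -/
theorem tendsto_inner_mulL {χ : ℕ → TestFun d} {C : ℝ} {t : ℂ} (hC : ∀ k z, ‖(χ k).toFun z‖ ≤ C)
    (ht : ∀ z, Filter.Tendsto (fun k => (χ k).toFun z) Filter.atTop (nhds t))
    {ι : Type} [Fintype ι] (u f : Lp (EuclideanSpace ℂ ι) 2 (volume : Measure (RSpace d))) :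
    Filter.Tendsto (fun k => inner ℂ f ((χ k).mulL ι u)) Filter.atTop (nhds (t * inner ℂ f u)) := by
  simp_rw [TestFun.inner_mulL]
  rw [L2.inner_def, ← integral_const_mul]
  have hi := L2.integrable_inner (𝕜 := ℂ) f u
  refine tendsto_integral_of_dominated_convergence (fun x => C * ‖(inner ℂ (f x) (u x) : ℂ)‖)
    (fun k => (χ k).contDiff.continuous.aestronglyMeasurable.mul hi.aestronglyMeasurable)
    (hi.norm.const_mul C) (fun k => Filter.Eventually.of_forall fun x => ?_)
    (Filter.Eventually.of_forall fun x => (ht x).mul_const _)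
  rw [norm_mul]
  exact mul_le_mul_of_nonneg_right (hC k x) (norm_nonneg _)

/-- Weak identities on the graph of the gradient may be tested with compactly supported
elements. -/
theorem inner_eq_zero_of_compact_support {h : L2RTen n d} {f : L2R n d}
    (H : ∀ (r : ℝ) (w : L2R n d) (q : L2RTen n d),
      (w, q) ∈ weakGradGraph n (Set.univ : Set (RSpace d)) volume →
      (∀ᵐ z, r < ‖z‖ → w z = 0) → (∀ᵐ z, r < ‖z‖ → q z = 0) → inner ℂ h q + inner ℂ f w = (0 : ℂ))
    {w : L2R n d} {q : L2RTen n d}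
    (hwq : (w, q) ∈ weakGradGraph n (Set.univ : Set (RSpace d)) volume) :
    inner ℂ h q + inner ℂ f w = (0 : ℂ) := by
  obtain ⟨χ, C, h1, h2, h3, h4⟩ := exists_cutoff_sequence d
  have hz : ∀ k, inner ℂ h ((χ k).gradMul w q) + inner ℂ f ((χ k).mulL (Fin n) w) = (0 : ℂ) := by
    intro k
    obtain ⟨r, hr⟩ := (χ k).exists_norm_lt
    exact H r _ _ ((χ k).gradMul_mem hwq) ((χ k).ae_mulL_eq_zero hr w)
      ((χ k).ae_gradMul_eq_zero hr w q)
  have t1 := tendsto_inner_mulL h1 h3 w f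
  -- The terms with the derivative of the cutoff tend to zero, so only the gradient of `w` survives.
  have t2 : Filter.Tendsto (fun k => inner ℂ h ((χ k).gradMul w q)) Filter.atTop
      (nhds (∑ j, (1 * inner ℂ (col n volume j h) (col n volume j q)
        + 0 * inner ℂ (col n volume j h) w))) := by
    simp_rw [inner_eq_sum_col volume h ((χ _).gradMul w q), TestFun.col_gradMul, inner_add_right]
    exact tendsto_finsetSum _ fun j _ => (tendsto_inner_mulL h1 h3 _ _).add
      (tendsto_inner_mulL (fun k => h2 k j) (h4 j) _ _)
  have t3 := t2.add t1
  simp_rw [hz, one_mul, zero_mul, add_zero, ← inner_eq_sum_col] at t3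
  exact tendsto_nhds_unique t3 tendsto_const_nhds

end Cutoff

/-! ### Direct integrals -/

section DirectIntegral

variable {d : ℕ} {X X' : Type} [NormedAddCommGroup X] [NormedSpace ℂ X] [NormedAddCommGroup X']
  [NormedSpace ℂ X']

/-- The direct integral of an essentially bounded family of operators. -/
def dirInt {T : RSpace d → X →L[ℂ] X'} (hT : MemLp T ⊤ (volΘ d)) :
    Lp X 2 (volΘ d) →L[ℂ] Lp X' 2 (volΘ d) :=
  holderL (volΘ d) ⊤ 2 2 (ContinuousLinearMap.id ℂ (X →L[ℂ] X')) (hT.toLp T)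

theorem dirInt_coeFn {T : RSpace d → X →L[ℂ] X'} (hT : MemLp T ⊤ (volΘ d)) (g : Lp X 2 (volΘ d)) :
    dirInt hT g =ᵐ[volΘ d] fun θ => T θ (g θ) := by
  have h1 : dirInt hT g
      = holder 2 (ContinuousLinearMap.id ℂ (X →L[ℂ] X')) (hT.toLp T) g := rfl
  rw [h1]
  filter_upwards [coeFn_holder (r := 2) (ContinuousLinearMap.id ℂ (X →L[ℂ] X')) (hT.toLp T) g,
    hT.coeFn_toLp] with θ h2 h3
  rw [h2, h3]
  rfl

theorem memLp_top_of_continuousOn {T : RSpace d → X →L[ℂ] X'} (hT : ContinuousOn T (zoneΘ d))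
    {C : ℝ} (hC : ∀ θ ∈ zoneΘ d, ‖T θ‖ ≤ C) : MemLp T ⊤ (volΘ d) := by
  refine memLp_top_of_bound (hT.aestronglyMeasurable (measurableSet_zoneΘ d)) C ?_
  filter_upwards [ae_restrict_mem (measurableSet_zoneΘ d)] with θ hθ using hC θ hθ

end DirectIntegral

/-! ### The oscillating and the homogenised resolvent -/

section Main

variable {n d : ℕ}

theorem norm_fibreRes_le_opNorm {A : L2YTen n d →L[ℂ] L2YTen n d} {S : L2Y n d →L[ℂ] L2Y n d}
    {m ε : ℝ} (hm : 0 < m) (hε : 0 < ε) (hA : ∀ X, m * ‖X‖ ^ 2 ≤ (inner ℂ X (A X)).re)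
    (hS : ∀ u, m * ‖u‖ ^ 2 ≤ (inner ℂ u (S u)).re) (θ : RSpace d) :
    ‖fibreRes (ε ^ 2)⁻¹ A S θ‖ ≤ m⁻¹ ∧ ‖fibreResGrad (ε ^ 2)⁻¹ A S θ‖ ≤ ε * m⁻¹ :=
  ⟨opNorm_le_bound _ (inv_nonneg.2 hm.le) fun f => by
      rw [inv_mul_eq_div]
      exact (norm_fibreRes_le hm hε hA hS θ f).1,
    opNorm_le_bound _ (mul_nonneg hε.le (inv_nonneg.2 hm.le)) fun f => by
      rw [mul_right_comm, ← div_eq_mul_inv]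
      exact (norm_fibreRes_le hm hε hA hS θ f).2⟩

theorem isBoundedInverse_fibreOp {A : Ten n d →L[ℂ] Ten n d} {S : Vec n →L[ℂ] Vec n} {m ε : ℝ}
    (hm : 0 < m) (hε : 0 < ε) (hA : ∀ X, m * ‖X‖ ^ 2 ≤ (inner ℂ X (A X)).re)
    (hS : ∀ u, m * ‖u‖ ^ 2 ≤ (inner ℂ u (S u)).re) (θ : RSpace d) :
    IsBoundedInverse (fibreOp A S ε θ)
      (fibreRes (ε ^ 2)⁻¹ (A.compLpL 2 (volY d)) (S.compLpL 2 (volY d)) θ) := by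
  have hc : 0 < (ε ^ 2)⁻¹ := inv_pos.2 (pow_pos hε 2)
  have hA' := norm_sq_le_inner_compLpL (d := d) hA
  have hS' := norm_sq_le_inner_compLpL (d := d) hS
  refine isBoundedInverse_ellipticOp
    (RG := fibreResGrad (ε ^ 2)⁻¹ (A.compLpL 2 (volY d)) (S.compLpL 2 (volY d)) θ)
    (dense_gradTheta_domain θ) hc hm
    (fun X => (mul_nonneg hm.le (sq_nonneg _)).trans (hA' X)) hS' (fun f => ?_)
    fun f w q hq => ?_
  · rw [gradTheta_graph]
    exact mem_graph_fibreRes _ _ _ θ f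
  · rw [gradTheta_graph] at hq
    exact fibreRes_weak hm hc hA' hS' (phase_compLpL θ A) (phase_compLpL θ S) f hq

theorem memLp_fibreRes_fibreResGrad {a : RSpace d → (Ten n d →L[ℂ] Ten n d)}
    {s : RSpace d → (Vec n →L[ℂ] Vec n)} {m ε : ℝ} (hm : 0 < m) (hε : 0 < ε)
    (hA : ∀ X, m * ‖X‖ ^ 2 ≤ (inner ℂ X (mulOp (volY d) a X)).re)
    (hS : ∀ u, m * ‖u‖ ^ 2 ≤ (inner ℂ u (mulOp (volY d) s u)).re) :
    MemLp (fun θ => fibreRes (ε ^ 2)⁻¹ (mulOp (volY d) a) (mulOp (volY d) s) θ) ⊤ (volΘ d) ∧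
    MemLp (fun θ => fibreResGrad (ε ^ 2)⁻¹ (mulOp (volY d) a) (mulOp (volY d) s) θ) ⊤ (volΘ d) := by
  have hc : 0 < (ε ^ 2)⁻¹ := inv_pos.2 (pow_pos hε 2)
  exact ⟨memLp_top_of_continuousOn
      (continuousOn_fibreRes hm hc (fun _ _ => hA) hS continuousOn_const)
      fun θ _ => (norm_fibreRes_le_opNorm hm hε hA hS θ).1,
    memLp_top_of_continuousOn
      (continuousOn_fibreResGrad hm hc (fun _ _ => hA) hS continuousOn_const)
      fun θ _ => (norm_fibreRes_le_opNorm hm hε hA hS θ).2⟩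

theorem coercive_comp_inv_smul {ι : Type} [Fintype ι] {ε : ℝ} (hε : 0 < ε)
    {a : RSpace d → (EuclideanSpace ℂ ι →L[ℂ] EuclideanSpace ℂ ι)} (ha : MemLp a ⊤ volume) {m : ℝ}
    (h : ∀ᵐ x, ∀ X, m * ‖X‖ ^ 2 ≤ (inner ℂ X (a x X)).re)
    (u : Lp (EuclideanSpace ℂ ι) 2 (volume : Measure (RSpace d))) :
    m * ‖u‖ ^ 2 ≤ (inner ℂ u (mulOp volume (fun z => a (ε⁻¹ • z)) u)).re := by
  refine inner_mulOp_re_ge (memLp_comp_inv_smul hε ha) ?_ u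
  have := (quasiMeasurePreserving_smul_sub hε (0 : RSpace d)).ae h
  simpa using this

theorem gelfand_sub_ae {ι : Type} [Fintype ι] {c : ℝ} (hc : 0 < c)
    (u v : Lp (EuclideanSpace ℂ ι) 2 (volume : Measure (RSpace d))) :
    gelfand hc (u - v) =ᵐ[volΘ d] fun θ => gelfand hc u θ - gelfand hc v θ := by
  have h : gelfand hc (u - v) = gelfand hc u - gelfand hc v :=
    LinearIsometryEquiv.map_sub (gelfand hc) u v
  rw [h]
  exact Lp.coeFn_sub (gelfand hc u) (gelfand hc v)

/-- The fibre gradient is `ε` times the transformed gradient on `ℝ^d`; the two factors `ε` in the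
form cancel the `ε⁻²` of the fibre operator. -/
theorem inner_add_inner_eq_zero_of_scaled {X K : Type*} [NormedAddCommGroup X]
    [InnerProductSpace ℂ X] [NormedAddCommGroup K] [InnerProductSpace ℂ K] {ε : ℝ} (hε : 0 < ε)
    {A : K →L[ℂ] K} {S : X →L[ℂ] X} {q G g : K} {w V v f W : X} (hG : G = A g) (hV : V = S v)
    (hW : W = V - f)
    (h : (((ε ^ 2)⁻¹ : ℝ) : ℂ) * inner ℂ ((ε : ℂ) • q) (A ((ε : ℂ) • g)) + inner ℂ w (S v)
      = inner ℂ w f) : inner ℂ q G + inner ℂ w W = (0 : ℂ) := by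
  have hε' : (ε : ℂ) ≠ 0 := Complex.ofReal_ne_zero.2 hε.ne'
  rw [map_smul, inner_smul_left, inner_smul_right, Complex.conj_ofReal, ← hG, ← hV] at h
  rw [hW, inner_sub_right, ← h]
  push_cast
  field_simp
  ring

/-- The fibre equations are integrated over `θ` against the transform of a test pair. Only compactly
supported pairs are known to have fibres in the right graphs, so the identity is proved for these
first and extended by cutoffs. -/
theorem weak_of_fibre_weak {A : RSpace d → (Ten n d →L[ℂ] Ten n d)}
    {S : RSpace d → (Vec n →L[ℂ] Vec n)} (hA : PeriodicCoercive A) (hS : PeriodicCoercive S)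
    {ε : ℝ} (hε : 0 < ε) {f v : L2R n d} {g : L2RTen n d}
    (h : ∀ᵐ θ ∂volΘ d, ∀ w q, (w, q) ∈ gradThetaGraph n θ →
      (((ε ^ 2)⁻¹ : ℝ) : ℂ) * inner ℂ q (mulOp (volY d) A ((ε : ℂ) • gelfand hε g θ))
        + inner ℂ w (mulOp (volY d) S (gelfand hε v θ)) = inner ℂ w (gelfand hε f θ))
    {w : L2R n d} {q : L2RTen n d}
    (hwq : (w, q) ∈ weakGradGraph n (Set.univ : Set (RSpace d)) volume) :
    inner ℂ q (mulOp volume (fun z => A (ε⁻¹ • z)) g)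
      + inner ℂ w (mulOp volume (fun z => S (ε⁻¹ • z)) v) = inner ℂ w f := by
  set G := mulOp volume (fun z => A (ε⁻¹ • z)) g with hG
  set V := mulOp volume (fun z => S (ε⁻¹ • z)) v with hV
  have h0 := inner_eq_zero_of_compact_support (h := G) (f := V - f) (fun r w q hwq hw hq => by
    have h1 : inner ℂ q G + inner ℂ w (V - f) = 0 := by
      refine inner_add_inner_eq_zero_of_gelfand hε ?_
      filter_upwards [h, gelfand_mulOp hε hA g, gelfand_mulOp hε hS v, gelfand_sub_ae hε V f,
        ae_mem_gradThetaGraph_gelfand hε hwq hw hq] with θ h2 h3 h4 h5 h6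
      exact inner_add_inner_eq_zero_of_scaled hε h3 h4 h5 (h2 _ _ h6)
    rw [← inner_conj_symm, ← inner_conj_symm (V - f), ← map_add, h1, map_zero]) hwq
  rw [← inner_conj_symm, ← inner_conj_symm (V - f), ← map_add, map_eq_zero, inner_sub_right] at h0
  linear_combination h0

/-- The oscillating resolvent is a direct integral of fibre resolvents. -/
theorem exists_isBoundedInverse_oscOp {a : RSpace d → (Ten n d →L[ℂ] Ten n d)}
    {s : RSpace d → (Vec n →L[ℂ] Vec n)} (ha : PeriodicCoercive a) (hs : PeriodicCoercive s)
    {m : ℝ} (hm : 0 < m) (ham : ∀ᵐ x, ∀ X, m * ‖X‖ ^ 2 ≤ (inner ℂ X (a x X)).re)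
    (hsm : ∀ᵐ x, ∀ X, m * ‖X‖ ^ 2 ≤ (inner ℂ X (s x X)).re) {ε : ℝ} (hε : 0 < ε) :
    ∃ R : L2R n d →L[ℂ] L2R n d, IsBoundedInverse (oscOp a s ε) R ∧
      ∀ f, gelfand hε (R f) =ᵐ[volΘ d]
        fun θ => fibreRes (ε ^ 2)⁻¹ (mulOp (volY d) a) (mulOp (volY d) s) θ (gelfand hε f θ) := by
  have haY : MemLp a ⊤ (volY d) := ha.memLp.restrict _
  have hsY : MemLp s ⊤ (volY d) := hs.memLp.restrict _
  have hA := inner_mulOp_re_ge haY (ae_restrict_of_ae ham)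
  have hS := inner_mulOp_re_ge hsY (ae_restrict_of_ae hsm)
  have hc : 0 < (ε ^ 2)⁻¹ := inv_pos.2 (pow_pos hε 2)
  have hε' : (ε : ℂ) ≠ 0 := Complex.ofReal_ne_zero.2 hε.ne'
  obtain ⟨h1, h2⟩ := memLp_fibreRes_fibreResGrad hm hε hA hS
  set U := gelfand (ι := Fin n) (d := d) hε with hU
  set U' := gelfand (ι := Fin n × Fin d) (d := d) hε with hU'
  let R : L2R n d →L[ℂ] L2R n d :=
    U.symm.toLinearIsometry.toContinuousLinearMap ∘L dirInt h1 ∘L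
      U.toLinearIsometry.toContinuousLinearMap
  -- The factor `ε⁻¹` undoes the scaling between the fibre gradient and the gradient on `ℝ^d`.
  let RG : L2R n d → L2RTen n d := fun f => U'.symm ((ε : ℂ)⁻¹ • dirInt h2 (U f))
  have hR : ∀ f, U (R f) =ᵐ[volΘ d]
      fun θ => fibreRes (ε ^ 2)⁻¹ (mulOp (volY d) a) (mulOp (volY d) s) θ (U f θ) := by
    intro f
    have : U (R f) = dirInt h1 (U f) := U.apply_symm_apply _
    rw [this]
    exact dirInt_coeFn h1 _
  have hRG : ∀ f, ∀ᵐ θ ∂volΘ d, (ε : ℂ) • U' (RG f) θ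
      = fibreResGrad (ε ^ 2)⁻¹ (mulOp (volY d) a) (mulOp (volY d) s) θ (U f θ) := by
    intro f
    have : U' (RG f) = (ε : ℂ)⁻¹ • dirInt h2 (U f) := U'.apply_symm_apply _
    rw [this]
    filter_upwards [dirInt_coeFn h2 (U f), Lp.coeFn_smul (ε : ℂ)⁻¹ (dirInt h2 (U f))] with θ h3 h4
    rw [h4, Pi.smul_apply, h3, smul_inv_smul₀ hε']
  refine ⟨R, ?_, hR⟩
  have key : IsBoundedInverse (ellipticOp (grad n d) ((1 : ℝ) : ℂ)
      (mulOp volume fun x => a (ε⁻¹ • x)) (mulOp volume fun x => s (ε⁻¹ • x))) R := by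
    refine isBoundedInverse_ellipticOp (RG := RG) (dense_grad_domain n d) one_pos hm
      (fun X => (mul_nonneg hm.le (sq_nonneg _)).trans (coercive_comp_inv_smul hε ha.memLp ham X))
      (coercive_comp_inv_smul hε hs.memLp hsm) (fun f => ?_) fun f w q hq => ?_
    · rw [grad_graph]
      refine mem_weakGradGraph_of_gelfand hε ?_
      filter_upwards [hR f, hRG f] with θ h3 h4
      rw [h3, h4]
      exact mem_graph_fibreRes _ _ _ θ _
    · rw [grad_graph] at hq
      rw [Complex.ofReal_one, one_mul]
      refine weak_of_fibre_weak ha hs hε ?_ hq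
      filter_upwards [hR f, hRG f] with θ h3 h4 w q hq
      rw [h3, h4]
      exact fibreRes_weak hm hc hA hS (phase_mulOp θ haY) (phase_mulOp θ hsY) _ hq
  rwa [Complex.ofReal_one] at key

theorem homConst_pos {m α σ : ℝ} (hm : 0 < m) (hα : 0 ≤ α) (hσ : 0 ≤ σ) : 0 < homConst m α σ := by
  unfold homConst
  positivity

theorem periodicCoercive_const {ι : Type} [Fintype ι]
    {A : EuclideanSpace ℂ ι →L[ℂ] EuclideanSpace ℂ ι} {ν : ℝ} (hν : 0 < ν)
    (hA : ∀ X, ν * ‖X‖ ^ 2 ≤ (inner ℂ X (A X)).re) :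
    PeriodicCoercive (fun _ : RSpace d => A) :=
  ⟨memLp_top_const A, fun _ => Filter.Eventually.of_forall fun _ => rfl,
    ν, hν, Filter.Eventually.of_forall fun _ => hA⟩

/-- The homogenised resolvents form an essentially bounded family. -/
theorem memLp_fibreRes_hom {a : RSpace d → (Ten n d →L[ℂ] Ten n d)}
    {s : RSpace d → (Vec n →L[ℂ] Vec n)} (ha : MemLp a ⊤ (volY d)) (hs : MemLp s ⊤ (volY d))
    {m ε : ℝ} (hm : 0 < m) (hε : 0 < ε)
    (hA : ∀ X, m * ‖X‖ ^ 2 ≤ (inner ℂ X (mulOp (volY d) a X)).re)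
    (hS : ∀ u, m * ‖u‖ ^ 2 ≤ (inner ℂ u (mulOp (volY d) s u)).re) :
    MemLp (fun θ => fibreRes (ε ^ 2)⁻¹ ((aHom a θ).compLpL 2 (volY d))
      ((meanCoeff s).compLpL 2 (volY d)) θ) ⊤ (volΘ d) := by
  have hc : 0 < (ε ^ 2)⁻¹ := inv_pos.2 (pow_pos hε 2)
  have hA' : ∀ θ ∈ zoneΘ d, ∀ X, m * ‖X‖ ^ 2
      ≤ (inner ℂ X ((aHom a θ).compLpL 2 (volY d) X)).re := fun θ hθ => by
    rw [aHom_eq_perHom ha hm hA hθ]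
    exact norm_sq_le_inner_compLpL (norm_sq_le_inner_perHom hm hA hθ)
  have hS' := norm_sq_le_inner_compLpL (d := d) (norm_sq_le_inner_meanCoeff hs hS)
  -- The effective tensor is known to coincide with the continuous family `perHom` only on the
  -- Brillouin zone, so continuity is claimed only there.
  have hcont : ContinuousOn (fun θ => (aHom a θ).compLpL 2 (volY d)) (zoneΘ d) :=
    continuous_compLpL.comp_continuousOn ((continuousOn_perHom hm hA).congr fun θ hθ =>
      aHom_eq_perHom ha hm hA hθ)
  exact memLp_top_of_continuousOn (continuousOn_fibreRes hm hc hA' hS' hcont)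
    fun θ hθ => (norm_fibreRes_le_opNorm hm hε (hA' θ hθ) hS' θ).1

theorem norm_sub_conj_le {H H' : Type*} [NormedAddCommGroup H] [NormedSpace ℂ H]
    [NormedAddCommGroup H'] [NormedSpace ℂ H'] (U : H ≃ₗᵢ[ℂ] H') (R : H →L[ℂ] H)
    (D : H' →L[ℂ] H') {C : ℝ} (hC : 0 ≤ C) (h : ∀ f, ‖U (R f) - D (U f)‖ ≤ C * ‖U f‖) :
    ‖R - (U.symm.toContinuousLinearEquiv : H' →L[ℂ] H) ∘L D ∘L
      (U.toContinuousLinearEquiv : H →L[ℂ] H')‖ ≤ C := by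
  refine opNorm_le_bound _ hC fun f => ?_
  have e : (R - (U.symm.toContinuousLinearEquiv : H' →L[ℂ] H) ∘L D ∘L
      (U.toContinuousLinearEquiv : H →L[ℂ] H')) f = U.symm (U (R f) - D (U f)) := by
    rw [map_sub, U.symm_apply_apply]
    rfl
  rw [e, U.symm.norm_map, ← U.norm_map f]
  exact h f

/-- The fibre estimate has a constant independent of `θ`, so it passes to the `L²` norm over `Θ`. -/
theorem norm_gelfand_sub_dirInt_le {a : RSpace d → (Ten n d →L[ℂ] Ten n d)}
    {s : RSpace d → (Vec n →L[ℂ] Vec n)} (ha : MemLp a ⊤ (volY d)) (hs : MemLp s ⊤ (volY d))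
    {m ε : ℝ} (hm : 0 < m) (hε : 0 < ε)
    (hA : ∀ X, m * ‖X‖ ^ 2 ≤ (inner ℂ X (mulOp (volY d) a X)).re)
    (hS : ∀ u, m * ‖u‖ ^ 2 ≤ (inner ℂ u (mulOp (volY d) s u)).re) {F G : L2ΘY n d}
    (hG : G =ᵐ[volΘ d] fun θ => fibreRes (ε ^ 2)⁻¹ (mulOp (volY d) a) (mulOp (volY d) s) θ (F θ)) :
    ‖G - dirInt (memLp_fibreRes_hom ha hs hm hε hA hS) F‖
      ≤ homConst m ‖mulOp (volY d) a‖ ‖mulOp (volY d) s‖ * ε * ‖F‖ := by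
  have hT := memLp_fibreRes_hom ha hs hm hε hA hS
  refine Lp.norm_le_mul_norm_of_ae_le_mul ?_
  filter_upwards [hG, dirInt_coeFn hT F, Lp.coeFn_sub G (dirInt hT F),
    ae_restrict_mem (measurableSet_zoneΘ d)] with θ h1 h2 h3 hθ
  rw [h3, Pi.sub_apply, h1, h2]
  exact norm_fibreRes_sub_le ha hs hm hA hS hθ hε _

end Main

end FibreHom

end

/-! ### The fibre homogenisation theorem -/

open FibreHom MeasureTheory

theorem theorem3p1 (n d : ℕ)
    (a : FibreHom.RSpace d → (FibreHom.Ten n d →L[ℂ] FibreHom.Ten n d))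
    (s : FibreHom.RSpace d → (FibreHom.Vec n →L[ℂ] FibreHom.Vec n))
    (ha : FibreHom.PeriodicCoercive a) (hs : FibreHom.PeriodicCoercive s) :
    -- the cell problems are uniquely solvable
    (∀ θ ∈ FibreHom.zoneΘ d, ∀ (r : Fin n) (q : Fin d),
      ∃! N : (FibreHom.gradTheta n θ).domain, FibreHom.IsCellSolution a θ r q N) ∧
    -- the constant coefficients belong to the same classes
    (∀ θ ∈ FibreHom.zoneΘ d,
      FibreHom.PeriodicCoercive (fun _ : FibreHom.RSpace d => FibreHom.aHom a θ)) ∧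
    FibreHom.PeriodicCoercive (fun _ : FibreHom.RSpace d => FibreHom.meanCoeff s) ∧
    -- the order-sharp resolvent estimate; the inverses, the Gelfand transform and the direct
    -- integral exist and are uniquely determined by the properties listed
    ∃ κ : ℝ, 0 < κ ∧ ∀ ε : ℝ, 0 < ε →
      ∃ (R : FibreHom.L2R n d →L[ℂ] FibreHom.L2R n d)
        (U : FibreHom.L2R n d ≃ₗᵢ[ℂ] FibreHom.L2ΘY n d)
        (T : FibreHom.RSpace d → (FibreHom.L2Y n d →L[ℂ] FibreHom.L2Y n d))
        (D : FibreHom.L2ΘY n d →L[ℂ] FibreHom.L2ΘY n d),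
        FibreHom.IsBoundedInverse (FibreHom.oscOp a s ε) R ∧
        FibreHom.IsGelfandTransform ε U ∧
        (∀ θ ∈ FibreHom.zoneΘ d, FibreHom.IsBoundedInverse
          (FibreHom.fibreOp (FibreHom.aHom a θ) (FibreHom.meanCoeff s) ε θ) (T θ)) ∧
        FibreHom.IsDirectIntegral T D ∧
        ‖R - (U.symm.toContinuousLinearEquiv : FibreHom.L2ΘY n d →L[ℂ] FibreHom.L2R n d) ∘L D ∘L
          (U.toContinuousLinearEquiv : FibreHom.L2R n d →L[ℂ] FibreHom.L2ΘY n d)‖ ≤ κ * ε := by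
  obtain ⟨μ, hμ, hμa⟩ := ha.coercive
  obtain ⟨σ, hσ, hσs⟩ := hs.coercive
  -- One coercivity constant for both coefficients, as the abstract estimate expects.
  set m := min μ σ with hm_def
  have hm : 0 < m := lt_min hμ hσ
  have ham : ∀ᵐ x, ∀ X, m * ‖X‖ ^ 2 ≤ (inner ℂ X (a x X)).re := by
    filter_upwards [hμa] with x hx X
    exact (mul_le_mul_of_nonneg_right (min_le_left _ _) (sq_nonneg _)).trans (hx X)
  have hsm : ∀ᵐ x, ∀ X, m * ‖X‖ ^ 2 ≤ (inner ℂ X (s x X)).re := by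
    filter_upwards [hσs] with x hx X
    exact (mul_le_mul_of_nonneg_right (min_le_right _ _) (sq_nonneg _)).trans (hx X)
  have haY : MemLp a ⊤ (volY d) := ha.memLp.restrict _
  have hsY : MemLp s ⊤ (volY d) := hs.memLp.restrict _
  have hA := inner_mulOp_re_ge haY (ae_restrict_of_ae ham)
  have hS := inner_mulOp_re_ge hsY (ae_restrict_of_ae hsm)
  have hhom : ∀ θ ∈ zoneΘ d, ∀ X, m * ‖X‖ ^ 2 ≤ (inner ℂ X (aHom a θ X)).re := fun θ hθ => by
    rw [aHom_eq_perHom haY hm hA hθ]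
    exact norm_sq_le_inner_perHom hm hA hθ
  have hmean := norm_sq_le_inner_meanCoeff hsY hS
  have hκ : 0 < homConst m ‖mulOp (volY d) a‖ ‖mulOp (volY d) s‖ :=
    homConst_pos hm (norm_nonneg _) (norm_nonneg _)
  refine ⟨fun θ hθ r q => existsUnique_isCellSolution haY hm hA hθ r q,
    fun θ hθ => periodicCoercive_const hm (hhom θ hθ), periodicCoercive_const hm hmean,
    _, hκ, fun ε hε => ?_⟩
  obtain ⟨R, hR, hUR⟩ := exists_isBoundedInverse_oscOp ha hs hm ham hsm hε
  have hT := memLp_fibreRes_hom haY hsY hm hε hA hS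
  exact ⟨R, gelfand hε, _, dirInt hT, hR, isGelfandTransform_gelfand hε,
    fun θ hθ => isBoundedInverse_fibreOp hm hε (hhom θ hθ) hmean θ, dirInt_coeFn hT,
    norm_sub_conj_le _ _ _ (mul_nonneg hκ.le hε.le)
      fun f => norm_gelfand_sub_dirInt_le haY hsY hm hε hA hS (hUR f)⟩
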